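/- **Setting.** Let $k$ be a finite field, $\overline C$ a smooth proper integral curve over $k$, and $C$ a nilpotent extension of $\overline C$: a scheme of finite type over $\mathbb Z$ whose reduced subscheme is $\overline C$. Let $F=F_C$ be the stalk of $\mathcal O_C$ at the generic point; for a closed point $p$ let $\mathcal O_p$ be the completed local ring of $C$ at $p$ and $F_p=F\otimes_{\mathcal O_{C,p}}\mathcal O_p$ (the total ring of fractions of $\mathcal O_p$ if $C$ has no embedded points); let $\mathbb A=\mathbb A_C$ be the restricted product of the rings $F_p$ over all closed points with respect to the images of the $\mathcal O_p$, and $\mathcal O\subset\mathbb A$ the subring of integral adeles. Let $\mathcal N^i\mathbb A$ and $\mathcal N^i_F$ be the $i$-th powers of the nilradicals of $\mathbb A$ and $F$. Let $G$ be a connected split reductive group over $\mathbb Z$ with a split maximal torus $T$ and a Borel subgroup $B\supset T$; a parabolic subgroup of $G$ (over $\mathbb Z$) is standard if it contains $B$. For a compact open subgroup $K\subset G(\mathbb A)$ put $\mathrm{Bun}_G(C,K)=G(F)\backslash G(\mathbb A)/K$ and $\mathrm{Bun}_G(C)=\mathrm{Bun}_G(C,G(\mathcal O))$, and let $\mathbb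 C(\,\cdot\,)$ denote the space of all complex functions. The Hecke algebra $\mathcal H_{G,C,K}$ consists of the compactly supported $K$-biinvariant complex measures $h$ on $G(\mathbb A)$; it acts on $\mathbb C(\mathrm{Bun}_G(C,K))$ by $(h*f)(g)=\int_{G(\mathbb A)}f(gx)\,dh(x)$. For a standard parabolic $P$ with unipotent radical $U$, for $f\in\mathbb C(\mathrm{Bun}_G(C,K))$, $g\in G(\mathbb A)$ and $i\ge 0$, put $$E_Pf(g)=\int_{U(F)\backslash U(\mathbb A)}f(ug)\,du,\qquad E^i_Pf(g)=\int_{U(\mathcal N^i_F)\backslash U(\mathcal N^i\mathbb A)}f(ug)\,du,$$ where $U(\mathcal N^i\mathbb A)=\ker(U(\mathbb A)\to U(\mathbb A/\mathcal N^i\mathbb A))$, $U(\mathcal N^i_F)=\ker(U(F)\to U(F/\mathcal N_F^i))$, and $du$ comes from the Haar measure for which the integral points have volume $1$. The function $f$ is cuspidal (resp. $i$-cuspidal) if $E_Pf\equiv 0$ (resp. $E_P^if\equiv0$) for every proper standard parabolic $P$; let $\mathcal S_{\mathrm{cusp}}(\mathrm{Bun}_G(C,K))\subset\mathbb C(\mathrm{Bun}_G(C,K))$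 be the subspace of cuspidal functions. **Proposition A.** (1) For every nilpotent extension $C$ of $\overline C$ and every compact open subgroup $K\subset G(\mathbb A_C)$, the action of $\mathcal H_{G,C,K}$ on $\mathbb C(\mathrm{Bun}_G(C,K))$ preserves the subspace of cuspidal functions and, for each $i\ge0$, the subspace of $i$-cuspidal functions. (2) Let $C'\subset C$ be a closed embedding of nilpotent extensions of $\overline C$ (compatible with the embeddings of $\overline C$). Pullback along the reduction map $\mathrm{Bun}_G(C)\to\mathrm{Bun}_G(C')$ is an embedding $\mathbb C(\mathrm{Bun}_G(C'))\hookrightarrow\mathbb C(\mathrm{Bun}_G(C))$, and, identifying $\mathbb C(\mathrm{Bun}_G(C'))$ with its image, $$\mathcal S_{\mathrm{cusp}}(\mathrm{Bun}_G(C'))=\mathbb C(\mathrm{Bun}_G(C'))\cap\mathcal S_{\mathrm{cusp}}(\mathrm{Bun}_G(C)).$$ -/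

import Mathlib

open AlgebraicGeometry CategoryTheory TensorProduct MeasureTheory
open scoped RestrictedProduct

noncomputable section

namespace NilBun

set_option linter.unusedSectionVars false

/-! ## Affine group schemes over `ℤ` through their functor of points

An affine group scheme `G` over `ℤ` is given by its coordinate ring, a commutative Hopf algebra `A`
over `ℤ`; its points in a commutative ring `R` are the ring homomorphisms `A → R`. -/

section Groups

variable (A : Type) [CommRing A] [HopfAlgebra ℤ A]

/-- The set `G(R)` of `R`-points of `G = Spec A`. -/
abbrev Points (R : Type) [CommRing R] : Type := WithConv (A →ₐ[ℤ] R)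

variable {A}

/-- The group structure on `G(R)`: the product is convolution, the inverse is composition with
the antipode. -/
instance Points.instGroup (R : Type) [CommRing R] : Group (Points A R) where
  inv x := WithConv.toConv (x.ofConv.comp (HopfAlgebra.antipodeAlgHom ℤ A))
  inv_mul_cancel x := by
    have h := AlgHom.comp_convMul_distrib x.ofConv
      (WithConv.toConv (HopfAlgebra.antipodeAlgHom ℤ A)) (WithConv.toConv (AlgHom.id ℤ A))
    rw [AlgHom.antipode_id_cancel] at h
    apply WithConv.ofConv_injective
    refine Eq.trans ?_ (h.symm.trans ?_)
    · rfl
    · ext a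
      change x.ofConv (algebraMap ℤ A _) = algebraMap ℤ R _
      exact x.ofConv.commutes _

/-- The homomorphism `G(R) → G(S)` induced by a ring homomorphism `R → S`. -/
def Points.map {R S : Type} [CommRing R] [CommRing S] (φ : R →+* S) : Points A R →* Points A S where
  toFun x := WithConv.toConv (φ.toIntAlgHom.comp x.ofConv)
  map_one' := by
    apply WithConv.ofConv_injective
    ext a
    change φ (algebraMap ℤ R _) = algebraMap ℤ S _
    simp
  map_mul' x y :=
    WithConv.ofConv_injective (AlgHom.comp_convMul_distrib φ.toIntAlgHom x y)

@[simp]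
lemma Points.map_apply {R S : Type} [CommRing R] [CommRing S] (φ : R →+* S) (x : Points A R)
    (a : A) : Points.map φ x a = φ (x a) := rfl

lemma Points.ext_apply {R : Type} [CommRing R] {x y : Points A R} (h : ∀ a, x a = y a) : x = y :=
  WithConv.ofConv_injective (AlgHom.ext h)

lemma Points.map_map {R S Q : Type} [CommRing R] [CommRing S] [CommRing Q] (φ : R →+* S)
    (ψ : S →+* Q) (x : Points A R) : Points.map ψ (Points.map φ x) = Points.map (ψ.comp φ) x := rfl

variable (A) in
/-- A closed subgroup scheme of `Spec A`: a Hopf ideal of `A`. -/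
structure ClosedSubgroup where
  /-- the ideal of functions vanishing on the subgroup -/
  ideal : Ideal A
  isHopfIdeal : ideal.IsHopfIdeal ℤ

/-- Inclusion of closed subgroup schemes. -/
instance : LE (ClosedSubgroup A) := ⟨fun P Q => Q.ideal ≤ P.ideal⟩

/-- The common zeros of a Hopf ideal are stable under products. -/
lemma conv_mul_eq_zero {k B S : Type} [CommRing k] [CommRing B] [HopfAlgebra k B] [CommRing S]
    [Algebra k S] (I : Ideal B) (hI : I.IsHopfIdeal k) {x y : WithConv (B →ₐ[k] S)}
    (hx : ∀ a ∈ I, x a = 0) (hy : ∀ a ∈ I, y a = 0) (a : B) (ha : a ∈ I) : (x * y) a = 0 := by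
  have h := hI.map_mkQ_comul_eq_zero ha
  let fx : (B ⧸ I.restrictScalars k) →ₗ[k] S :=
    (I.restrictScalars k).liftQ x.ofConv.toLinearMap (fun b hb => hx b hb)
  let fy : (B ⧸ I.restrictScalars k) →ₗ[k] S :=
    (I.restrictScalars k).liftQ y.ofConv.toLinearMap (fun b hb => hy b hb)
  have key : ∀ t : B ⊗[k] B,
      Algebra.TensorProduct.lift x.ofConv y.ofConv (fun _ _ => .all ..) t =
        LinearMap.mul' k S (TensorProduct.map fx fy
          (TensorProduct.map (I.restrictScalars k).mkQ (I.restrictScalars k).mkQ t)) := by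
    intro t
    induction t with
    | zero => simp
    | tmul b c => simp; rfl
    | add s t hs ht => simp only [map_add, hs, ht]
  rw [AlgHom.convMul_apply, key, h, map_zero, map_zero]

/-- The subgroup `P(R) ⊆ G(R)` of points of a closed subgroup scheme `P`. -/
def ClosedSubgroup.points (P : ClosedSubgroup A) (R : Type) [CommRing R] :
    Subgroup (Points A R) where
  carrier := {x | ∀ a ∈ P.ideal, x a = 0}
  one_mem' a ha := by
    refine (AlgHom.convOne_apply a).trans ?_
    rw [P.isHopfIdeal.counit_eq_zero ha, map_zero]
  mul_mem' hx hy a ha := conv_mul_eq_zero P.ideal P.isHopfIdeal hx hy a ha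
  inv_mem' {x} hx a ha := hx _ (P.isHopfIdeal.antipode_mem ha)

/-! ### Linear algebraic groups over an algebraically closed field, through their points -/

section Geometric

variable (A) (Ω : Type) [Field Ω]

/-- The regular functions on `G(Ω)`. -/
def regularFunctions : Submodule Ω (Points A Ω → Ω) :=
  Submodule.span Ω (Set.range fun (a : A) (x : Points A Ω) => x a)

/-- The Zariski topology on `G(Ω)`. -/
@[reducible] def zariskiTopology : TopologicalSpace (Points A Ω) :=
  TopologicalSpace.generateFrom {U | ∃ f ∈ regularFunctions A Ω, U = {x | f x ≠ 0}}

variable {A Ω}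

/-- A Zariski closed and connected subgroup of `G(Ω)`. -/
def IsClosedConnected (H : Subgroup (Points A Ω)) : Prop :=
  @IsClosed _ (zariskiTopology A Ω) (H : Set (Points A Ω)) ∧
    @IsConnected _ (zariskiTopology A Ω) (H : Set (Points A Ω))

/-- `x ∈ G(Ω)` is unipotent: right translation by `x` is a locally unipotent operator on the
regular functions. -/
def IsUnipotentElt (x : Points A Ω) : Prop :=
  ∀ f ∈ regularFunctions A Ω, ∃ n : ℕ,
    ((LinearMap.funLeft Ω Ω (fun y : Points A Ω => y * x) - 1) ^ n : Module.End Ω _) f = 0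

/-- `N` is the unipotent radical of `M`: the largest closed connected normal subgroup of `M`
consisting of unipotent elements. -/
def IsUnipotentRadicalAt (N M : Subgroup (Points A Ω)) : Prop :=
  IsGreatest {N' : Subgroup (Points A Ω) | N' ≤ M ∧ IsClosedConnected N' ∧
    (∀ m ∈ M, ∀ n ∈ N', m * n * m⁻¹ ∈ N') ∧ ∀ n ∈ N', IsUnipotentElt n} N

/-- A Borel subgroup of `G(Ω)`: a maximal closed connected solvable subgroup. -/
def IsBorelAt (H : Subgroup (Points A Ω)) : Prop :=
  Maximal (fun H' : Subgroup (Points A Ω) => IsClosedConnected H' ∧ Group.IsSolvable H') H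

/-- A subtorus of `G(Ω)`: the image of an algebraic homomorphism `(Ωˣ)ʳ → G(Ω)`, that is, one
whose coordinates are Laurent polynomials. -/
def IsSubtorusAt (H : Subgroup (Points A Ω)) : Prop :=
  ∃ (r : ℕ) (φ : (Fin r → Ωˣ) →* Points A Ω),
    (∀ a : A, (fun t => φ t a) ∈ Submodule.span Ω
      (Set.range fun (n : Fin r → ℤ) (t : Fin r → Ωˣ) => ((∏ i, t i ^ n i : Ωˣ) : Ω))) ∧
    H = φ.range

end Geometric

variable (A) in
/-- `Spec A` is a connected reductive group over `ℤ`: it is smooth, and its geometric fibres are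
connected with trivial unipotent radical. -/
structure IsConnectedReductive : Prop where
  smooth : Algebra.Smooth ℤ A
  connected : ∀ (Ω : Type) [Field Ω] [IsAlgClosed Ω],
    IsClosedConnected (⊤ : Subgroup (Points A Ω))
  reductive : ∀ (Ω : Type) [Field Ω] [IsAlgClosed Ω],
    IsUnipotentRadicalAt (⊥ : Subgroup (Points A Ω)) ⊤

/-- `T` is a split maximal torus: `T` is isomorphic to a power of the multiplicative group over
`ℤ`, and its geometric fibres are maximal tori. -/
structure ClosedSubgroup.IsSplitMaximalTorus (T : ClosedSubgroup A) : Prop where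
  split : ∃ (r : ℕ) (τ : A →ₐc[ℤ] AddMonoidAlgebra ℤ (Fin r → ℤ)),
    Function.Surjective τ ∧ ∀ a : A, a ∈ T.ideal ↔ τ a = 0
  maximal : ∀ (Ω : Type) [Field Ω] [IsAlgClosed Ω],
    Maximal (fun H : Subgroup (Points A Ω) => IsSubtorusAt H) (T.points Ω)

/-- `B` is a Borel subgroup: smooth over `ℤ`, with Borel subgroups as geometric fibres. -/
structure ClosedSubgroup.IsBorel (B : ClosedSubgroup A) : Prop where
  smooth : Algebra.Smooth ℤ (A ⧸ B.ideal)
  fibres : ∀ (Ω : Type) [Field Ω] [IsAlgClosed Ω], IsBorelAt (B.points Ω)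

/-- `P` is a parabolic subgroup: smooth over `ℤ`, and each geometric fibre contains a Borel
subgroup. -/
structure ClosedSubgroup.IsParabolic (P : ClosedSubgroup A) : Prop where
  smooth : Algebra.Smooth ℤ (A ⧸ P.ideal)
  fibres : ∀ (Ω : Type) [Field Ω] [IsAlgClosed Ω],
    ∃ H : Subgroup (Points A Ω), IsBorelAt H ∧ H ≤ P.points Ω

/-- `P` is a proper parabolic subgroup that is standard, i.e. contains the Borel subgroup `B`. -/
structure ClosedSubgroup.IsProperStandardParabolic (P B : ClosedSubgroup A) : Prop where
  isParabolic : P.IsParabolic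
  standard : B ≤ P
  proper : P.ideal ≠ ⊥

/-- `U` is the unipotent radical of `P`: smooth over `ℤ`, and each geometric fibre of `U` is the
unipotent radical of that of `P`. -/
structure ClosedSubgroup.IsUnipotentRadical (U P : ClosedSubgroup A) : Prop where
  smooth : Algebra.Smooth ℤ (A ⧸ U.ideal)
  fibres : ∀ (Ω : Type) [Field Ω] [IsAlgClosed Ω],
    IsUnipotentRadicalAt (U.points Ω) (P.points Ω)

end Groups

/-! ## Nilpotent extensions of curves and their adeles -/

/-- A nilpotent extension of a reduced scheme `X`: a scheme of finite type (over `ℤ`) whose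
reduced subscheme is `X`, i.e. in which `X` sits as a closed subscheme with the same underlying
space. -/
structure NilpotentExtension (X : Scheme.{0}) where
  /-- the extension -/
  scheme : Scheme.{0}
  /-- the embedding of the reduced scheme -/
  incl : X ⟶ scheme
  isClosedImmersion : IsClosedImmersion incl
  surjective : Surjective incl
  locallyOfFiniteType : LocallyOfFiniteType (Limits.terminal.from scheme)
  quasiCompact : QuasiCompact (Limits.terminal.from scheme)

section Adeles

variable {X : Scheme.{0}} [IsIntegral X]

instance NilpotentExtension.irreducibleSpace (C : NilpotentExtension X) :
    IrreducibleSpace C.scheme := by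
  have hs : Function.Surjective C.incl := C.surjective.surj
  have hc : Continuous C.incl := C.incl.continuous
  have h := (PreirreducibleSpace.isPreirreducible_univ (X := X)).image C.incl hc.continuousOn
  rw [Set.image_univ, hs.range_eq] at h
  exact { isPreirreducible_univ := h
          toNonempty := ⟨C.incl (genericPoint X)⟩ }

variable (C : NilpotentExtension X)

/-- The ring `F`: the stalk of the structure sheaf at the generic point. -/
abbrev FunctionRing : Type := C.scheme.functionField

/-- The closed points of the curve. -/
abbrev ClosedPoint : Type := {p : C.scheme // IsClosed ({p} : Set C.scheme)}

variable {C}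

/-- The local ring of `C` at `p`. -/
abbrev LocalRing (p : ClosedPoint C) : Type := C.scheme.presheaf.stalk p.1

/-- The completed local ring of `C` at `p`. -/
abbrev CompletedLocalRing (p : ClosedPoint C) : Type :=
  AdicCompletion (IsLocalRing.maximalIdeal (LocalRing p)) (LocalRing p)

/-- The ring `F_p`, the localization of the completed local ring at `p` obtained by inverting the
functions that are invertible at the generic point (its total ring of fractions, if `C` has no
embedded points). -/
def LocalFunctionRing (p : ClosedPoint C) : Type :=
  FunctionRing C ⊗[LocalRing p] CompletedLocalRing p

instance (p : ClosedPoint C) : CommRing (LocalFunctionRing p) :=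
  inferInstanceAs (CommRing (FunctionRing C ⊗[LocalRing p] CompletedLocalRing p))

/-- The map `F → F_p`. -/
def ofFunctionRing (p : ClosedPoint C) : FunctionRing C →+* LocalFunctionRing p :=
  (Algebra.TensorProduct.includeLeft :
    FunctionRing C →ₐ[LocalRing p] FunctionRing C ⊗[LocalRing p] CompletedLocalRing p).toRingHom

/-- The map from the completed local ring at `p` to `F_p`. -/
def ofCompletedLocalRing (p : ClosedPoint C) : CompletedLocalRing p →+* LocalFunctionRing p :=
  (Algebra.TensorProduct.includeRight :
    CompletedLocalRing p →ₐ[LocalRing p]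
      FunctionRing C ⊗[LocalRing p] CompletedLocalRing p).toRingHom

lemma ofFunctionRing_algebraMap (p : ClosedPoint C) (r : LocalRing p) :
    ofFunctionRing p (algebraMap _ _ r) = ofCompletedLocalRing p (algebraMap _ _ r) :=
  (Algebra.TensorProduct.includeLeft.commutes r).trans
    (Algebra.TensorProduct.includeRight.commutes r).symm

/-- The topology on `F_p` for which the images of the powers of the maximal ideal of the completed
local ring are a basis of neighbourhoods of `0`. -/
instance (p : ClosedPoint C) : TopologicalSpace (LocalFunctionRing p) where
  IsOpen S := ∀ x ∈ S, ∃ n : ℕ, ∀ y ∈ (IsLocalRing.maximalIdeal (LocalRing p) ^ n).map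
    (algebraMap (LocalRing p) (CompletedLocalRing p)), x + ofCompletedLocalRing p y ∈ S
  isOpen_univ _ _ := ⟨0, fun _ _ => trivial⟩
  isOpen_inter S T hS hT x hx := by
    obtain ⟨m, hm⟩ := hS x hx.1
    obtain ⟨n, hn⟩ := hT x hx.2
    exact ⟨max m n, fun y hy =>
      ⟨hm y (Ideal.map_mono (Ideal.pow_le_pow_right (le_max_left m n)) hy),
        hn y (Ideal.map_mono (Ideal.pow_le_pow_right (le_max_right m n)) hy)⟩⟩
  isOpen_sUnion s hs x hx := by
    obtain ⟨S, hS, hxS⟩ := hx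
    obtain ⟨n, hn⟩ := hs S hS x hxS
    exact ⟨n, fun y hy => ⟨S, hS, hn y hy⟩⟩

/-- The subring `O_p ⊆ F_p`. -/
def integerRing (p : ClosedPoint C) : Subring (LocalFunctionRing p) :=
  (ofCompletedLocalRing p).range

variable (C)

/-- The ring of adeles, with the restricted product topology. -/
abbrev Adele : Type := Πʳ p : ClosedPoint C, [LocalFunctionRing p, integerRing p]

/-- The subring of integral adeles. -/
def integralAdeles : Subring (Adele C) :=
  ⨅ p : ClosedPoint C, (integerRing p).comap (RestrictedProduct.evalRingHom _ p)

/-- The components of an adele. -/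
def adeleComponents : Adele C →+* (∀ p : ClosedPoint C, LocalFunctionRing p) :=
  RingHom.pi fun p => RestrictedProduct.evalRingHom _ p

/-- The diagonal map from `F` to the product of all `F_p`. -/
def diagonal : FunctionRing C →+* (∀ p : ClosedPoint C, LocalFunctionRing p) :=
  RingHom.pi fun p => ofFunctionRing p

end Adeles

/-! ## Reduction to a closed subscheme -/

/-- A closed embedding `C' ⊆ C` of nilpotent extensions of `X`. -/
structure NilpotentExtension.ClosedEmbedding {X : Scheme.{0}} (C' C : NilpotentExtension X) where
  /-- the morphism of schemes -/
  hom : C'.scheme ⟶ C.scheme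
  isClosedImmersion : IsClosedImmersion hom
  comm : C'.incl ≫ hom = C.incl

/-- The ring homomorphism out of a tensor product given by two compatible ring homomorphisms. -/
def tensorLift {R P Q S : Type} [CommRing R] [CommRing P] [CommRing Q] [CommRing S] [Algebra R P]
    [Algebra R Q] (f : P →+* S) (g : Q →+* S)
    (h : f.comp (algebraMap R P) = g.comp (algebraMap R Q)) : P ⊗[R] Q →+* S :=
  letI : Algebra R S := (f.comp (algebraMap R P)).toAlgebra
  (Algebra.TensorProduct.lift (R := R) (S := R)
    ({ f with commutes' := fun _ => rfl } : P →ₐ[R] S)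
    ({ g with commutes' := fun r => (RingHom.congr_fun h r).symm } : Q →ₐ[R] S)
    (fun _ _ => Commute.all _ _)).toRingHom

lemma tensorLift_tmul {R P Q S : Type} [CommRing R] [CommRing P] [CommRing Q] [CommRing S]
    [Algebra R P] [Algebra R Q] (f : P →+* S) (g : Q →+* S)
    (h : f.comp (algebraMap R P) = g.comp (algebraMap R Q)) (x : P) (y : Q) :
    tensorLift f g h (x ⊗ₜ y) = f x * g y := rfl

lemma completionMap_aux {R S : Type} [CommRing R] [CommRing S] (φ : R →+* S) {I : Ideal R}
    {J : Ideal S} (h : I ≤ J.comap φ) (n : ℕ) : I ^ n ≤ (J ^ n).comap φ :=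
  (Ideal.pow_right_mono h n).trans (Ideal.le_comap_pow φ n)

lemma completionMap_compat {R S : Type} [CommRing R] [CommRing S] (φ : R →+* S) (I : Ideal R)
    (J : Ideal S) (h : I ≤ J.comap φ) {m n : ℕ} (hle : m ≤ n) :
    (Ideal.Quotient.factorPow J hle).comp
        ((Ideal.quotientMap (J ^ n) φ (completionMap_aux φ h n)).comp
          (AdicCompletion.evalₐ I n : AdicCompletion I R →+* R ⧸ I ^ n)) =
      (Ideal.quotientMap (J ^ m) φ (completionMap_aux φ h m)).comp
        (AdicCompletion.evalₐ I m : AdicCompletion I R →+* R ⧸ I ^ m) := by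
  ext x
  induction x using AdicCompletion.induction_on with
  | h a =>
    have h1 := AdicCompletion.Ideal.mk_eq_mk I hle a
    have h2 := congrArg (Ideal.quotientMap (J ^ m) φ (completionMap_aux φ h m)) h1
    simpa [AdicCompletion.evalₐ_mk] using h2

/-- The map between adic completions induced by a ring homomorphism. -/
def completionMap {R S : Type} [CommRing R] [CommRing S] (φ : R →+* S) (I : Ideal R) (J : Ideal S)
    (h : I ≤ J.comap φ) : AdicCompletion I R →+* AdicCompletion J S :=
  AdicCompletion.liftRingHom J
    (fun n => (Ideal.quotientMap (J ^ n) φ (completionMap_aux φ h n)).comp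
      (AdicCompletion.evalₐ I n : AdicCompletion I R →+* R ⧸ I ^ n))
    (completionMap_compat φ I J h)

lemma completionMap_algebraMap {R S : Type} [CommRing R] [CommRing S] (φ : R →+* S) (I : Ideal R)
    (J : Ideal S) (h : I ≤ J.comap φ) (r : R) :
    completionMap φ I J h (algebraMap R (AdicCompletion I R) r) =
      algebraMap S (AdicCompletion J S) (φ r) := by
  apply AdicCompletion.ext_evalₐ
  intro n
  rw [completionMap, AdicCompletion.evalₐ_liftRingHom (hf := completionMap_compat φ I J h)]
  simp

section Reduction

variable {X : Scheme.{0}} [IsIntegral X] {C' C : NilpotentExtension X}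
  (j : NilpotentExtension.ClosedEmbedding C' C)

lemma NilpotentExtension.ClosedEmbedding.map_genericPoint :
    j.hom (genericPoint C'.scheme) = genericPoint C.scheme := by
  have hs : Function.Surjective j.hom := by
    intro x
    obtain ⟨y, hy⟩ := C.surjective.surj x
    refine ⟨C'.incl y, ?_⟩
    rw [← Scheme.Hom.comp_apply, j.comm, hy]
  apply ((genericPoint_spec C.scheme).eq _).symm
  have h := (genericPoint_spec C'.scheme).image j.hom.continuous
  rwa [Set.image_univ, hs.range_eq, closure_univ] at h

/-- The reduction map `F_C → F_{C'}`. -/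
def reduceFunctionRing : FunctionRing C →+* FunctionRing C' :=
  (C.scheme.presheaf.stalkSpecializes (specializes_of_eq j.map_genericPoint) ≫
    j.hom.stalkMap (genericPoint C'.scheme)).hom

/-- The map on closed points. -/
def mapPoint (p : ClosedPoint C') : ClosedPoint C :=
  ⟨j.hom p.1, by
    have := j.isClosedImmersion
    have h := j.hom.isClosedEmbedding.isClosedMap _ p.2
    rwa [Set.image_singleton] at h⟩

lemma mapPoint_injective : Function.Injective (mapPoint j) := fun p q h => by
  have := j.isClosedImmersion
  exact Subtype.ext (j.hom.isClosedEmbedding.injective (congrArg Subtype.val h))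

/-- The reduction map on local rings. -/
def reduceLocalRing (p : ClosedPoint C') : LocalRing (mapPoint j p) →+* LocalRing p :=
  (j.hom.stalkMap p.1).hom

lemma reduceLocalRing_compat (p : ClosedPoint C') :
    (reduceFunctionRing j).comp (algebraMap (LocalRing (mapPoint j p)) (FunctionRing C)) =
      (algebraMap (LocalRing p) (FunctionRing C')).comp (reduceLocalRing j p) := by
  have h := Scheme.Hom.stalkSpecializes_stalkMap j.hom (genericPoint C'.scheme) p.1
    ((genericPoint_spec C'.scheme).specializes trivial)
  refine Eq.trans ?_ (congrArg CommRingCat.Hom.hom h)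
  rw [← C.scheme.presheaf.stalkSpecializes_comp_assoc]
  · rfl

lemma maximalIdeal_le_comap (p : ClosedPoint C') :
    IsLocalRing.maximalIdeal (LocalRing (mapPoint j p)) ≤
      (IsLocalRing.maximalIdeal (LocalRing p)).comap (reduceLocalRing j p) := by
  have : IsLocalHom (reduceLocalRing j p) :=
    inferInstanceAs (IsLocalHom (j.hom.stalkMap p.1).hom)
  exact ((IsLocalRing.local_hom_TFAE (reduceLocalRing j p)).out 0 3).mp this

/-- The reduction map on completed local rings. -/
def reduceCompletedLocalRing (p : ClosedPoint C') :
    CompletedLocalRing (mapPoint j p) →+* CompletedLocalRing p :=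
  completionMap (reduceLocalRing j p) _ _ (maximalIdeal_le_comap j p)

/-- The reduction map `F_{C,p} → F_{C',p}`. -/
def reduceLocalFunctionRing (p : ClosedPoint C') :
    LocalFunctionRing (mapPoint j p) →+* LocalFunctionRing p :=
  tensorLift ((ofFunctionRing p).comp (reduceFunctionRing j))
    ((ofCompletedLocalRing p).comp (reduceCompletedLocalRing j p)) (by
      ext r
      have h1 := RingHom.congr_fun (reduceLocalRing_compat j p) r
      have h2 := completionMap_algebraMap (reduceLocalRing j p) _ _
        (maximalIdeal_le_comap j p) r
      simp only [RingHom.comp_apply] at h1 ⊢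
      rw [h1]
      refine Eq.trans ?_ (congrArg (ofCompletedLocalRing p) h2.symm)
      exact ofFunctionRing_algebraMap p _)

lemma reduceLocalFunctionRing_ofFunctionRing (p : ClosedPoint C') (x : FunctionRing C) :
    reduceLocalFunctionRing j p (ofFunctionRing (mapPoint j p) x) =
      ofFunctionRing p (reduceFunctionRing j x) := by
  refine (tensorLift_tmul _ _ _ x 1).trans ?_
  simp

lemma reduceLocalFunctionRing_ofCompletedLocalRing (p : ClosedPoint C')
    (x : CompletedLocalRing (mapPoint j p)) :
    reduceLocalFunctionRing j p (ofCompletedLocalRing (mapPoint j p) x) =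
      ofCompletedLocalRing p (reduceCompletedLocalRing j p x) := by
  refine (tensorLift_tmul _ _ _ 1 x).trans ?_
  simp

/-- The reduction map on adeles. -/
def reduceAdele : Adele C →+* Adele C' :=
  RestrictedProduct.mapAlongRingHom _ _ (mapPoint j)
    (mapPoint_injective j).tendsto_cofinite (reduceLocalFunctionRing j)
    (Filter.Eventually.of_forall fun p => by
      rintro _ ⟨x, rfl⟩
      exact ⟨_, (reduceLocalFunctionRing_ofCompletedLocalRing j p x).symm⟩)

end Reduction

/-! ## Adelic groups -/

section AdelicGroups

variable (A : Type) [CommRing A] [HopfAlgebra ℤ A]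
variable {X : Scheme.{0}} [IsIntegral X] (C : NilpotentExtension X)

/-- The adelic topology on `G(𝔸)`: the topology of pointwise convergence of homomorphisms
`A → 𝔸`, which is the subspace topology for any closed embedding of `G` into an affine space. -/
instance adelicTopology : TopologicalSpace (Points A (Adele C)) :=
  TopologicalSpace.induced (fun x (a : A) => x a) inferInstance

/-- The Borel σ-algebra of `G(𝔸)`. -/
instance adelicMeasurableSpace : MeasurableSpace (Points A (Adele C)) :=
  borel _

/-- The subgroup `G(O) ⊆ G(𝔸)`. -/
def integralPoints : Subgroup (Points A (Adele C)) :=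
  (Points.map (integralAdeles C).subtype).range

variable {A C}

/-- The image in `G(𝔸)` of a subgroup of `G(F)`, for the diagonal embedding of `F` in `𝔸`. -/
def principal (S : Subgroup (Points A (FunctionRing C))) : Subgroup (Points A (Adele C)) :=
  (S.map (Points.map (diagonal C))).comap (Points.map (adeleComponents C))

variable (A C)

/-- The subgroup `G(F) ⊆ G(𝔸)`. -/
def rationalPoints : Subgroup (Points A (Adele C)) := principal ⊤

variable {A}

/-- `U(Nⁱ R) ⊆ U(R)`: the kernel of `U(R) → U(R / Nⁱ)`, with `N` the nilradical of `R`. -/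
def congruencePoints (U : ClosedSubgroup A) (R : Type) [CommRing R] (i : ℕ) :
    Subgroup (Points A R) :=
  U.points R ⊓ (Points.map (Ideal.Quotient.mk (nilradical R ^ i))).ker

variable {C}

/-- The Haar measure on a closed subgroup `H` of `G(𝔸)` for which `H ∩ G(O)` has volume `1`
(it is determined by these two properties). -/
def haar (H : Subgroup (Points A (Adele C))) : Measure H :=
  Classical.epsilon fun μ => μ.IsHaarMeasure ∧
    μ {x | (x : Points A (Adele C)) ∈ integralPoints A C} = 1

/-- A fundamental domain for the action of the discrete group `Γ ∩ H` on `H` by left translations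
(integrals of left invariant functions over it do not depend on which one is taken). -/
def fundDomain (Γ H : Subgroup (Points A (Adele C))) : Set H :=
  Classical.epsilon fun S => IsFundamentalDomain (Γ.subgroupOf H) S (haar H)

variable (A C)

/-- The set `Bun_G(C, K) = G(F) \ G(𝔸) / K`. -/
abbrev Bun (K : Subgroup (Points A (Adele C))) : Type :=
  DoubleCoset.Quotient (rationalPoints A C : Set (Points A (Adele C))) K

variable {A C}

/-- The class in `Bun_G(C, K)` of an element of `G(𝔸)`. -/
abbrev Bun.mk (K : Subgroup (Points A (Adele C))) (g : Points A (Adele C)) : Bun A C K :=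
  DoubleCoset.mk (rationalPoints A C) K g

variable {K : Subgroup (Points A (Adele C))}

/-! ## Constant terms and cuspidal functions -/

/-- The integral over `Γ \ H` of `u ↦ f (u g)`, computed over a fundamental domain. -/
def constantTermAlong (Γ H : Subgroup (Points A (Adele C))) (f : Bun A C K → ℂ)
    (g : Points A (Adele C)) : ℂ :=
  ∫ u in fundDomain Γ H, f (Bun.mk K (u * g)) ∂(haar H)

/-- The integral over `Γ \ H` of `u ↦ f (u g)` converges absolutely. -/
def ConvergesAlong (Γ H : Subgroup (Points A (Adele C))) (f : Bun A C K → ℂ)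
    (g : Points A (Adele C)) : Prop :=
  IntegrableOn (fun u : H => f (Bun.mk K (u * g))) (fundDomain Γ H) (haar H)

/-- The functions `f` for which the integral over `Γ \ H` of `u ↦ f (u g)` converges to `0`,
for all `g ∈ G(𝔸)`. -/
def constantTermKernel (Γ H : Subgroup (Points A (Adele C))) : Submodule ℂ (Bun A C K → ℂ) where
  carrier := {f | ∀ g, ConvergesAlong Γ H f g ∧ constantTermAlong Γ H f g = 0}
  zero_mem' g := by simp [ConvergesAlong, constantTermAlong]
  add_mem' {f f'} hf hf' g := by
    refine ⟨(hf g).1.add (hf' g).1, ?_⟩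
    have h := integral_add (hf g).1 (hf' g).1
    have h1 := (hf g).2
    have h2 := (hf' g).2
    simp only [constantTermAlong, Pi.add_apply] at h1 h2 ⊢
    rw [h, h1, h2, add_zero]
  smul_mem' c f hf g := by
    refine ⟨(hf g).1.smul c, ?_⟩
    have h1 := (hf g).2
    simp only [constantTermAlong, Pi.smul_apply] at h1 ⊢
    rw [integral_smul, h1, smul_zero]

variable (C K) in
/-- The constant term `E_P f (g) = ∫_{U(F) \ U(𝔸)} f (u g) du`, where `U` is the unipotent radical
of the parabolic subgroup `P`, vanishes for all `g`, for every proper standard parabolic `P`. -/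
def cuspidal (B : ClosedSubgroup A) : Submodule ℂ (Bun A C K → ℂ) :=
  ⨅ (P : ClosedSubgroup A) (U : ClosedSubgroup A) (_ : P.IsProperStandardParabolic B)
    (_ : U.IsUnipotentRadical P),
    constantTermKernel (principal (U.points (FunctionRing C))) (U.points (Adele C))

variable (C K) in
/-- The constant term `Eⁱ_P f (g) = ∫_{U(Nⁱ_F) \ U(Nⁱ 𝔸)} f (u g) du` vanishes for all `g`, for
every proper standard parabolic `P` with unipotent radical `U`. -/
def iCuspidal (B : ClosedSubgroup A) (i : ℕ) : Submodule ℂ (Bun A C K → ℂ) :=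
  ⨅ (P : ClosedSubgroup A) (U : ClosedSubgroup A) (_ : P.IsProperStandardParabolic B)
    (_ : U.IsUnipotentRadical P),
    constantTermKernel (principal (congruencePoints U (FunctionRing C) i))
      (congruencePoints U (Adele C) i)

/-! ## The Hecke algebra -/

variable (K) in
/-- The space of compactly supported `K`-biinvariant complex measures on `G(𝔸)`. -/
def hecke : Submodule ℂ (ComplexMeasure (Points A (Adele C))) where
  carrier := {h | (∃ Z : Set (Points A (Adele C)), IsCompact Z ∧ ∀ S, Disjoint S Z → h S = 0) ∧
    ∀ k ∈ K, ∀ S : Set (Points A (Adele C)),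
      h ((fun x => k * x) ⁻¹' S) = h S ∧ h ((fun x => x * k) ⁻¹' S) = h S}
  zero_mem' := ⟨⟨∅, isCompact_empty, fun _ _ => rfl⟩, fun _ _ _ => ⟨rfl, rfl⟩⟩
  add_mem' {h h'} := by
    rintro ⟨⟨Z, hZ, hs⟩, hi⟩ ⟨⟨Z', hZ', hs'⟩, hi'⟩
    refine ⟨⟨Z ∪ Z', hZ.union hZ', fun S hS => ?_⟩, fun k hk S => ?_⟩
    · rw [Set.disjoint_union_right] at hS
      simp [hs S hS.1, hs' S hS.2]
    · simp [(hi k hk S).1, (hi k hk S).2, (hi' k hk S).1, (hi' k hk S).2]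
  smul_mem' c h := by
    rintro ⟨⟨Z, hZ, hs⟩, hi⟩
    refine ⟨⟨Z, hZ, fun S hS => ?_⟩, fun k hk S => ?_⟩
    · simp [hs S hS]
    · simp [(hi k hk S).1, (hi k hk S).2]

/-- The value at `g` of the convolution `h * f`, i.e. the integral `∫ f (g x) dh(x)` over `G(𝔸)`.
Since `x ↦ f (g x)` is constant on each coset `y ∈ G(𝔸) / K`, this is the sum over all `y` of the
`h`-measure of `y` times the value of `f` at `g y`; as the support of `h` is compact, only finitely
many terms are nonzero. -/
def convolution (h : ComplexMeasure (Points A (Adele C))) (f : Bun A C K → ℂ)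
    (g : Points A (Adele C)) : ℂ :=
  ∑ᶠ y : Points A (Adele C) ⧸ K, h {x | (x : Points A (Adele C) ⧸ K) = y} *
    f (Bun.mk K (g * y.out))

lemma convolution_mul (h : hecke K) (f : Bun A C K → ℂ) (γ g k : Points A (Adele C))
    (hγ : γ ∈ rationalPoints A C) (hk : k ∈ K) :
    convolution h.1 f (γ * g * k) = convolution h.1 f g := by
  unfold convolution
  refine finsum_eq_of_bijective (fun y => k • y) (MulAction.bijective k) fun y => ?_
  congr 1
  · refine Eq.trans (congrArg h.1 ?_) (h.2.2 k hk _).1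
    ext x
    exact ((MulAction.injective k).eq_iff (a := (x : Points A (Adele C) ⧸ K)) (b := y)).symm
  · congr 1
    rw [DoubleCoset.eq]
    have e : ((k • y).out : Points A (Adele C) ⧸ K) = ((k * y.out : Points A (Adele C)) : _ ⧸ K) := by
      rw [QuotientGroup.out_eq']
      conv_lhs => rw [← QuotientGroup.out_eq' y]
      rfl
    refine ⟨γ⁻¹, inv_mem hγ, (k * y.out)⁻¹ * (k • y).out, QuotientGroup.eq.mp e.symm, ?_⟩
    group

/-- The action `f ↦ h * f` of an element `h` of the Hecke algebra on the functions on
`Bun_G(C, K)`. -/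
def heckeAction (h : hecke K) (f : Bun A C K → ℂ) : Bun A C K → ℂ :=
  fun b => Quotient.liftOn' b (convolution h.1 f) fun g g' hg => by
    obtain ⟨γ, hγ, k, hk, rfl⟩ := DoubleCoset.rel_iff.mp hg
    exact (convolution_mul h f γ g k hγ hk).symm

/-! ## Reduction of bundles -/

variable {C' : NilpotentExtension X} (j : NilpotentExtension.ClosedEmbedding C' C)

lemma reduce_mem_rationalPoints {g : Points A (Adele C)} (hg : g ∈ rationalPoints A C) :
    Points.map (reduceAdele j) g ∈ rationalPoints A C' := by
  obtain ⟨x, -, hx⟩ := hg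
  refine ⟨Points.map (reduceFunctionRing j) x, trivial, Points.ext_apply fun a => ?_⟩
  ext p
  have h := congrFun (congrArg (fun y : Points A _ => y a) hx) (mapPoint j p)
  exact (reduceLocalFunctionRing_ofFunctionRing j p (x a)).symm.trans
    (congrArg (reduceLocalFunctionRing j p) h)

lemma reduceAdele_mem_integralAdeles {a : Adele C} (ha : a ∈ integralAdeles C) :
    reduceAdele j a ∈ integralAdeles C' := by
  rw [integralAdeles, Subring.mem_iInf] at ha ⊢
  intro p
  obtain ⟨x, hx⟩ := ha (mapPoint j p)
  exact ⟨_, (reduceLocalFunctionRing_ofCompletedLocalRing j p x).symm.trans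
    (congrArg (reduceLocalFunctionRing j p) hx)⟩

lemma reduce_mem_integralPoints {g : Points A (Adele C)} (hg : g ∈ integralPoints A C) :
    Points.map (reduceAdele j) g ∈ integralPoints A C' := by
  obtain ⟨x, rfl⟩ := hg
  exact ⟨Points.map (((reduceAdele j).comp (integralAdeles C).subtype).codRestrict _
    fun a => reduceAdele_mem_integralAdeles j a.2) x, rfl⟩

variable (A) in
/-- The reduction map `Bun_G(C) → Bun_G(C')`, where `Bun_G(C) = Bun_G(C, G(O))`. -/
def reduceBun : Bun A C (integralPoints A C) → Bun A C' (integralPoints A C') :=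
  Quotient.map' (Points.map (reduceAdele j)) fun g g' hg => by
    obtain ⟨γ, hγ, k, hk, rfl⟩ := DoubleCoset.rel_iff.mp hg
    exact DoubleCoset.rel_iff.mpr ⟨_, reduce_mem_rationalPoints j hγ, _,
      reduce_mem_integralPoints j hk, by simp only [map_mul]⟩

variable (A) in
/-- The pullback of functions along the reduction map, from functions on `Bun_G(C')` to functions
on `Bun_G(C)`. -/
def pullback : (Bun A C' (integralPoints A C') → ℂ) →ₗ[ℂ] (Bun A C (integralPoints A C) → ℂ) :=
  LinearMap.funLeft ℂ ℂ (reduceBun A j)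

end AdelicGroups

end NilBun

end

open AlgebraicGeometry CategoryTheory TensorProduct MeasureTheory
open scoped RestrictedProduct

noncomputable section

set_option linter.unusedSectionVars false

namespace NilBun

/-! ## Points congruent to the identity -/

section Congruence

variable {A : Type} [CommRing A] [HopfAlgebra ℤ A]

/-! For the Hecke algebra: `K` is open and `h` has compact support, so only finitely many cosets `y
K` carry mass and `h * f` is a finite linear combination of the right translates `g ↦ f (g y)`.
Constant terms integrate over translations on the left and are required to vanish for every `g`.
Right translation therefore preserves their kernel, whichever subgroup is integrated over; this
settles the cuspidal and the `i`-cuspidal case together (`heckeAction_mem_constantTermKernel`).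

For the reduction from `C` to `C'`: the map `𝔸_C → 𝔸_{C'}` is surjective with nilpotent kernel, so
smoothness of `G` makes `G(𝔸_C) → G(𝔸_{C'})` surjective and pullback injective. The main point is
that, for each unipotent radical `U`, the constant term of a pulled back function is a fixed nonzero
multiple of the pullback of the constant term (`exists_constantTerm_pullback`). Vanishing and
absolute convergence are transferred together, so compactness of `U(F) \ U(𝔸)` is not needed.

That comparison is a statement about a surjection `ρ : U(𝔸_C) → U(𝔸_{C'})` carrying `U(F_C)` onto
`U(F_{C'})`. Push forward the Haar measure restricted to a fundamental domain of `U(F_C) ∩ ker ρ`: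
the result is a nonzero right invariant measure, locally finite because `U(F_C) ∩ ker ρ` is
cocompact in `ker ρ`, hence a multiple of Haar measure (`exists_map_restrict_eq_smul`,
`integral_fundDomain_comp`). Both groups are unimodular for a simple reason: a prime `p` is
nilpotent in `𝔸`, so every element of `U(𝔸)` has finite order (`ClosedSubgroup.exists_pow_eq_one`).

Cocompactness in `ker ρ` comes from `𝔸 = F + (compact)` by successive approximation along the powers
of the nilpotent ideal, using coordinates on `U` near the identity in which the group law is
additive modulo products (`ClosedSubgroup.exists_isCompact_congruence`). It also needs that the
kernel of `𝔸_C → 𝔸_{C'}` is generated by the kernel of `F_C → F_{C'}` (`ker_reduceAdele`).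

The arithmetic inputs are `𝔸 = F + (compact)` and the finiteness of the set of elements of `F` that
are integral everywhere. Both are reduced to the integral curve by filtering with nilpotent ideals.
There the first follows from the Chinese remainder theorem on an affine open set together with
Noether normalization and weak approximation at the missing points, and the second from the
finiteness of global sections of a proper scheme. -/

variable (A) in
/-- The augmentation of the coordinate ring, i.e. evaluation at the identity. -/
def augmentation : A →+* ℤ := (Bialgebra.counitAlgHom ℤ A).toRingHom

lemma Points.one_apply {R : Type} [CommRing R] (a : A) :
    (1 : Points A R) a = (augmentation A a : ℤ) :=
  (AlgHom.convOne_apply a).trans (by simp; rfl)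

lemma Points.mem_ker_map_mk_iff {R : Type} [CommRing R] (I : Ideal R) (x : Points A R) :
    x ∈ (Points.map (Ideal.Quotient.mk I)).ker ↔
      ∀ a, x a - (augmentation A a : ℤ) ∈ I := by
  rw [MonoidHom.mem_ker]
  constructor
  · intro h a
    have := congrArg (fun y : Points A (R ⧸ I) => y a) h
    simp only [Points.map_apply, Points.one_apply] at this
    rw [← Ideal.Quotient.eq, this]
    simp
  · intro h
    refine Points.ext_apply fun a => ?_
    rw [Points.map_apply, Points.one_apply, Ideal.Quotient.eq.mpr (h a)]
    simp

/-- Writing the comultiplication of `b` as a finite sum of pure tensors gives one bilinear formula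
for the product, valid over all rings at once. Continuity of multiplication and the congruences
below both rest on it. -/
lemma exists_convMul_apply_eq_sum {k B : Type} [CommRing k] [CommRing B] [HopfAlgebra k B] (b : B) :
    ∃ S : Finset (B × B), ∀ (R : Type) [CommRing R] [Algebra k R] (x y : WithConv (B →ₐ[k] R)),
      (x * y) b = ∑ i ∈ S, x i.1 * y i.2 := by
  obtain ⟨S, hS⟩ := TensorProduct.exists_finset (R := k) (CoalgebraStruct.comul (R := k) b)
  refine ⟨S, fun R _ _ x y => ?_⟩
  rw [AlgHom.convMul_apply, hS, map_sum]
  rfl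

lemma Points.exists_mul_apply_eq_sum (a : A) : ∃ S : Finset (A × A), ∀ (R : Type) [CommRing R]
    (x y : Points A R), (x * y) a = ∑ i ∈ S, x i.1 * y i.2 :=
  (exists_convMul_apply_eq_sum (k := ℤ) a).imp fun _ h R _ => h R

/-- Modulo products, the group law is additive on points congruent to the identity. -/
lemma Points.mul_apply_sub_mem {R : Type} [CommRing R] {I J : Ideal R} {x y : Points A R}
    (hx : x ∈ (Points.map (Ideal.Quotient.mk I)).ker)
    (hy : y ∈ (Points.map (Ideal.Quotient.mk J)).ker) (a : A) :
    (x * y) a - (x a + y a - (augmentation A a : ℤ)) ∈ I * J := by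
  rw [Points.mem_ker_map_mk_iff] at hx hy
  obtain ⟨S, hS⟩ := Points.exists_mul_apply_eq_sum a
  -- Expanding `x * 1`, `1 * y` and `1 * 1` over the same index set turns the difference into a sum
  -- of products `(x - ε)(y - ε)`, where `ε` is the augmentation.
  have e1 : x a = ∑ i ∈ S, x i.1 * (augmentation A i.2 : ℤ) := by
    conv_lhs => rw [← mul_one x, hS]
    simp only [Points.one_apply]
  have e2 : y a = ∑ i ∈ S, (augmentation A i.1 : ℤ) * y i.2 := by
    conv_lhs => rw [← one_mul y, hS]
    simp only [Points.one_apply]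
  have e3 : ((augmentation A a : ℤ) : R) = ∑ i ∈ S,
      (augmentation A i.1 : R) * (augmentation A i.2 : R) := by
    have := hS R 1 1
    rw [one_mul] at this
    simpa only [Points.one_apply] using this
  rw [hS, e1, e2, e3, ← Finset.sum_add_distrib,
    ← Finset.sum_sub_distrib, ← Finset.sum_sub_distrib]
  refine sum_mem fun i _ => ?_
  convert Ideal.mul_mem_mul (hx i.1) (hy i.2) using 1
  ring

lemma ker_map_mk_mono {R : Type} [CommRing R] {I J : Ideal R} (h : I ≤ J) :
    (Points.map (A := A) (Ideal.Quotient.mk I)).ker ≤ (Points.map (Ideal.Quotient.mk J)).ker := by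
  intro x hx
  rw [Points.mem_ker_map_mk_iff] at hx ⊢
  exact fun a => h (hx a)

lemma ker_map_mk_bot {R : Type} [CommRing R] :
    (Points.map (A := A) (Ideal.Quotient.mk (⊥ : Ideal R))).ker = ⊥ := by
  refine (Subgroup.eq_bot_iff_forall _).mpr fun x hx => Points.ext_apply fun a => ?_
  rw [Points.mem_ker_map_mk_iff] at hx
  rw [Points.one_apply]
  exact sub_eq_zero.mp (hx a)

/-- Modulo `J ^ (2 * i)`, which lies in `J ^ (i + 1)` because `i ≠ 0`, taking `k`-th powers
multiplies `x - ε` by `k`. For `k = p` the extra factor lies in `J`. -/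
lemma pow_mem_ker_map_mk {R : Type} [CommRing R] {p : ℕ} {J : Ideal R} (hp : (p : R) ∈ J)
    {i : ℕ} (hi : i ≠ 0) {x : Points A R}
    (hx : x ∈ (Points.map (Ideal.Quotient.mk (J ^ i))).ker) :
    x ^ p ∈ (Points.map (Ideal.Quotient.mk (J ^ (i + 1)))).ker := by
  have hle : J ^ i * J ^ i ≤ J ^ (i + 1) := by
    rw [← pow_add]
    exact Ideal.pow_le_pow_right (by omega)
  have key : ∀ (k : ℕ) (a : A), (x ^ k) a - ((augmentation A a : ℤ) +
      k * (x a - (augmentation A a : ℤ))) ∈ J ^ (i + 1) := by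
    intro k
    induction k with
    | zero => intro a; rw [pow_zero, Points.one_apply]; simp
    | succ k ih =>
      intro a
      have h1 := hle (Points.mul_apply_sub_mem (pow_mem hx k) hx a)
      rw [pow_succ x]
      convert add_mem h1 (ih a) using 1
      push_cast
      ring
  rw [Points.mem_ker_map_mk_iff] at hx ⊢
  intro a
  convert add_mem (key p a) (Ideal.mul_mem_mul (hx a) hp) using 1
  ring

/-- Points that are congruent to the identity modulo a nilpotent ideal containing `p` have finite
order. -/
lemma exists_pow_eq_one_of_mem_ker {R : Type} [CommRing R] {p : ℕ} (hp0 : p ≠ 0) {J : Ideal R}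
    (hp : (p : R) ∈ J) (hJ : IsNilpotent J) {x : Points A R}
    (hx : x ∈ (Points.map (Ideal.Quotient.mk J)).ker) : ∃ n ≠ 0, x ^ n = 1 := by
  obtain ⟨m, hm⟩ := hJ
  have key : ∀ i : ℕ, x ^ p ^ i ∈ (Points.map (Ideal.Quotient.mk (J ^ (i + 1)))).ker := by
    intro i
    induction i with
    | zero => rwa [pow_zero, pow_one, pow_one]
    | succ i ih =>
      rw [pow_succ p, pow_mul]
      exact pow_mem_ker_map_mk hp (by omega) ih
  refine ⟨p ^ m, pow_ne_zero _ hp0, ?_⟩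
  have h := key m
  rw [pow_succ, hm, zero_mul, Ideal.zero_eq_bot, ker_map_mk_bot] at h
  exact h

end Congruence

/-! ## Smooth lifting -/

section Lifting

variable {A : Type} [CommRing A] [HopfAlgebra ℤ A]

lemma Points.map_surjective_of_formallySmooth [Algebra.FormallySmooth ℤ A] {R S : Type} [CommRing R]
    [CommRing S] (φ : R →+* S) (hφ : Function.Surjective φ) (hn : IsNilpotent (RingHom.ker φ)) :
    Function.Surjective (Points.map (A := A) φ) := by
  intro y
  let z := Algebra.FormallySmooth.liftOfSurjective (R := ℤ) y.ofConv φ.toIntAlgHom hφ hn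
  refine ⟨WithConv.toConv z, Points.ext_apply fun a => ?_⟩
  exact Algebra.FormallySmooth.liftOfSurjective_apply (R := ℤ) y.ofConv φ.toIntAlgHom hφ hn a

/-- The homomorphism from the coordinate ring of a closed subgroup given by a point. -/
def ClosedSubgroup.toQuotient (U : ClosedSubgroup A) {R : Type} [CommRing R] (x : Points A R)
    (hx : x ∈ U.points R) : A ⧸ U.ideal →+* R :=
  Ideal.Quotient.lift U.ideal x.ofConv.toRingHom hx

/-- The point given by a ring homomorphism. -/
def Points.ofRingHom {R : Type} [CommRing R] (f : A →+* R) : Points A R :=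
  WithConv.toConv { f with commutes' := fun n => by
                             change f (algebraMap ℤ A n) = algebraMap ℤ R n
                             simp }

/-- The point of a closed subgroup given by a homomorphism from its coordinate ring. -/
def ClosedSubgroup.ofQuotient (U : ClosedSubgroup A) {R : Type} [CommRing R]
    (f : A ⧸ U.ideal →+* R) : Points A R :=
  Points.ofRingHom (f.comp (Ideal.Quotient.mk U.ideal))

lemma ClosedSubgroup.ofQuotient_apply (U : ClosedSubgroup A) {R : Type} [CommRing R]
    (f : A ⧸ U.ideal →+* R) (a : A) : U.ofQuotient f a = f (Ideal.Quotient.mk U.ideal a) := rfl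

lemma ClosedSubgroup.ofQuotient_mem (U : ClosedSubgroup A) {R : Type} [CommRing R]
    (f : A ⧸ U.ideal →+* R) : U.ofQuotient f ∈ U.points R := fun a ha => by
  rw [ofQuotient_apply, Ideal.Quotient.eq_zero_iff_mem.mpr ha, map_zero]

lemma ClosedSubgroup.map_mem (U : ClosedSubgroup A) {R S : Type} [CommRing R] [CommRing S]
    (φ : R →+* S) {x : Points A R} (hx : x ∈ U.points R) : Points.map φ x ∈ U.points S :=
  fun a ha => by rw [Points.map_apply, hx a ha, map_zero]

/-- Points of `U` are homomorphisms out of `A ⧸ U.ideal`, so infinitesimal lifting for this quotient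
produces lifts that stay in `U`. -/
lemma ClosedSubgroup.exists_map_eq (U : ClosedSubgroup A)
    [Algebra.FormallySmooth ℤ (A ⧸ U.ideal)] {R S : Type} [CommRing R]
    [CommRing S] (φ : R →+* S) (hφ : Function.Surjective φ) (hn : IsNilpotent (RingHom.ker φ))
    {y : Points A S} (hy : y ∈ U.points S) : ∃ x ∈ U.points R, Points.map φ x = y := by
  let f : A ⧸ U.ideal →ₐ[ℤ] S := { U.toQuotient y hy with
    commutes' := fun n => by
      change U.toQuotient y hy (algebraMap ℤ _ n) = algebraMap ℤ S n
      simp }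
  let z := Algebra.FormallySmooth.liftOfSurjective (R := ℤ) f φ.toIntAlgHom hφ hn
  refine ⟨U.ofQuotient z.toRingHom, U.ofQuotient_mem _, Points.ext_apply fun a => ?_⟩
  exact Algebra.FormallySmooth.liftOfSurjective_apply (R := ℤ) f
    φ.toIntAlgHom hφ hn (Ideal.Quotient.mk U.ideal a)

end Lifting

/-! ## Coordinates near the identity of a smooth subgroup -/

section Coordinates

open MvPolynomial

lemma aeval_sub_constantCoeff_mem {σ R : Type} [CommRing R] (J : Ideal R) {c : σ → R}
    (hc : ∀ j, c j ∈ J) (w : MvPolynomial σ ℤ) :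
    aeval c w - (constantCoeff w : ℤ) ∈ J := by
  induction w using MvPolynomial.induction_on with
  | C a => simp
  | add p q hp hq =>
    convert add_mem hp hq using 1
    simp
    ring
  | mul_X p j hp => simpa using J.mul_mem_left _ (hc j)

/-- Modulo products, polynomials are affine functions. -/
lemma aeval_add_sub_mem {σ R : Type} [CommRing R] (I : Ideal R) {c d : σ → R}
    (hc : ∀ j, c j ∈ I) (hd : ∀ j, d j ∈ I) (w : MvPolynomial σ ℤ) :
    aeval (c + d) w - (aeval c w + aeval d w - (constantCoeff w : ℤ)) ∈ I * I := by
  induction w using MvPolynomial.induction_on with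
  | C a => simp
  | add p q hp hq =>
    convert add_mem hp hq using 1
    simp
    ring
  | mul_X p j hp =>
    have h1 := Ideal.mul_mem_mul (aeval_sub_constantCoeff_mem I hc p) (hd j)
    have h2 := Ideal.mul_mem_mul (aeval_sub_constantCoeff_mem I hd p) (hc j)
    convert add_mem (add_mem (Ideal.mul_mem_left _ (c j + d j) hp) h1) h2 using 1
    simp
    ring

lemma aeval_mem_pow_of_mem {σ R : Type} [CommRing R] (J : Ideal R) {c : σ → R}
    (hc : ∀ j, c j ∈ J) (n : ℕ) {w : MvPolynomial σ ℤ}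
    (hw : w ∈ RingHom.ker (constantCoeff (σ := σ) (R := ℤ)) ^ n) : aeval c w ∈ J ^ n := by
  have h : RingHom.ker (constantCoeff (σ := σ) (R := ℤ)) ≤ J.comap (aeval c : MvPolynomial σ ℤ →ₐ[ℤ] R) := by
    intro w hw
    have := aeval_sub_constantCoeff_mem J hc w
    rw [RingHom.mem_ker] at hw
    simpa [hw] using this
  exact Ideal.le_comap_pow _ n (Ideal.pow_right_mono h n hw)

variable {A : Type} [CommRing A] [HopfAlgebra ℤ A]

/-- Near the identity, a smooth subgroup is a retract of an affine space: the points of `U`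
congruent to the identity modulo a nilpotent ideal are given by polynomials in finitely many of
their coordinates, and these polynomials define points for all values of the coordinates in the
ideal. -/
lemma ClosedSubgroup.exists_coordinates (U : ClosedSubgroup A) [Algebra.Smooth ℤ (A ⧸ U.ideal)]
    {n : ℕ} (hn : n ≠ 0) :
    ∃ (N : ℕ) (t : Fin N → A) (P : A → MvPolynomial (Fin N) ℤ),
      (∀ j, augmentation A (t j) = 0) ∧
      (∀ a, constantCoeff (P a) = augmentation A a) ∧
      ∀ (R : Type) [CommRing R] (J : Ideal R), J ^ n = ⊥ →
        (∀ c : Fin N → R, (∀ j, c j ∈ J) → ∃ x ∈ U.points R, ∀ a, x a = aeval c (P a)) ∧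
        ∀ x ∈ U.points R, x ∈ (Points.map (Ideal.Quotient.mk J)).ker →
          ∀ a, x a = aeval (fun j => x (t j)) (P a) := by
  let B := A ⧸ U.ideal
  let ε : B →+* ℤ := Ideal.Quotient.lift U.ideal (augmentation A)
    fun a ha => U.isHopfIdeal.counit_eq_zero ha
  obtain ⟨N, f, hf⟩ := Algebra.FiniteType.iff_quotient_mvPolynomial''.mp
    (inferInstance : Algebra.FiniteType ℤ B)
  -- Generators of the coordinate ring of `U`, shifted by their values at the identity so that they
  -- vanish there.
  choose t ht using fun j : Fin N =>
    Ideal.Quotient.mk_surjective (I := U.ideal) (f (X j) - ((ε (f (X j)) : ℤ) : B))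
  let π : MvPolynomial (Fin N) ℤ →ₐ[ℤ] B := aeval fun j => Ideal.Quotient.mk U.ideal (t j)
  have hεint : ∀ n : ℤ, ε (n : B) = n := fun n => map_intCast ε n
  have hπε : ∀ w, ε (π w) = constantCoeff w := by
    intro w
    have : ε.comp π.toRingHom = constantCoeff := by
      apply MvPolynomial.ringHom_ext
      · intro r
        simp [π]
      · intro j
        simp only [AlgHom.toRingHom_eq_coe, RingHom.coe_comp, RingHom.coe_coe, Function.comp_apply,
          π, aeval_X, ht, constantCoeff_X, map_sub, hεint, sub_self]
    exact RingHom.congr_fun this w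
  have hπ : Function.Surjective π := by
    intro b
    obtain ⟨w, rfl⟩ := hf b
    refine ⟨aeval (fun j => X j + C (ε (f (X j)))) w, ?_⟩
    have : π.comp (aeval (fun j => X j + C (ε (f (X j))))) = f := by
      apply MvPolynomial.algHom_ext
      intro j
      simp [π, ht]
    exact AlgHom.congr_fun this w
  let 𝔛 : Ideal (MvPolynomial (Fin N) ℤ) := RingHom.ker constantCoeff
  let I : Ideal B := RingHom.ker ε
  have h𝔛 : 𝔛 ≤ I.comap π := fun w hw => by
    change ε (π w) = 0
    rw [hπε]
    exact hw
  have h𝔛n : 𝔛 ^ n ≤ (I ^ n).comap π :=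
    (Ideal.pow_right_mono h𝔛 n).trans (Ideal.le_comap_pow π n)
  let ψ : MvPolynomial (Fin N) ℤ ⧸ 𝔛 ^ n →ₐ[ℤ] B ⧸ I ^ n := Ideal.quotientMapₐ (I ^ n) π h𝔛n
  have hψ : Function.Surjective ψ := Ideal.quotientMap_surjective (H := h𝔛n) hπ
  have hle : RingHom.ker ψ ≤ 𝔛.map (Ideal.Quotient.mk (𝔛 ^ n)) := by
    intro w hw
    obtain ⟨w, rfl⟩ := Ideal.Quotient.mk_surjective w
    have h1 : π w ∈ I ^ n := Ideal.Quotient.eq_zero_iff_mem.mp hw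
    have h2 : ε (π w) = 0 := Ideal.pow_le_self hn h1
    rw [hπε] at h2
    exact Ideal.mem_map_of_mem _ h2
  have hnil : IsNilpotent (RingHom.ker ψ) := by
    refine ⟨n, ?_⟩
    have := Ideal.pow_right_mono hle n
    rw [← Ideal.map_pow, Ideal.map_quotient_self] at this
    exact le_bot_iff.mp this
  -- Since `π` respects the augmentations, the kernel of `ψ` lies in the augmentation ideal and is
  -- nilpotent. Smoothness of `B` then lifts `B → B ⧸ I ^ n` through `ψ`; the polynomials `P a`
  -- represent the values of this lift.
  let s : B →ₐ[ℤ] MvPolynomial (Fin N) ℤ ⧸ 𝔛 ^ n :=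
    Algebra.FormallySmooth.liftOfSurjective (Ideal.Quotient.mkₐ ℤ (I ^ n)) ψ hψ hnil
  have hs : ∀ b, ψ (s b) = Ideal.Quotient.mk (I ^ n) b :=
    Algebra.FormallySmooth.liftOfSurjective_apply (Ideal.Quotient.mkₐ ℤ (I ^ n)) ψ hψ hnil
  choose P hP using fun a : A => Ideal.Quotient.mk_surjective (s (Ideal.Quotient.mk U.ideal a))
  have hπP : ∀ a, π (P a) - Ideal.Quotient.mk U.ideal a ∈ I ^ n := by
    intro a
    rw [← Ideal.Quotient.eq]
    exact (congrArg ψ (hP a)).trans (hs _)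
  refine ⟨N, t, P, fun j => ?_, fun a => ?_, fun R _ J hJ => ⟨fun c hc => ?_, fun x hx hx1 a => ?_⟩⟩
  · change ε (Ideal.Quotient.mk U.ideal (t j)) = 0
    rw [ht, map_sub, hεint, sub_self]
  · have h : ε (π (P a) - Ideal.Quotient.mk U.ideal a) = 0 := Ideal.pow_le_self hn (hπP a)
    rw [map_sub, hπε, sub_eq_zero] at h
    exact h
  -- Evaluation at coordinates in `J` kills `𝔛 ^ n` because `J ^ n = 0`, so it can be composed with
  -- `s`; this is how arbitrary small coordinates define a point of `U`.
  · let e : MvPolynomial (Fin N) ℤ ⧸ 𝔛 ^ n →+* R :=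
      Ideal.Quotient.lift (𝔛 ^ n) (aeval c : MvPolynomial (Fin N) ℤ →ₐ[ℤ] R).toRingHom
        fun w hw => by
          have := aeval_mem_pow_of_mem J hc n hw
          rw [hJ] at this
          exact this
    refine ⟨U.ofQuotient (e.comp s.toRingHom), U.ofQuotient_mem _, fun a => ?_⟩
    rw [U.ofQuotient_apply]
    change e (s (Ideal.Quotient.mk U.ideal a)) = _
    rw [← hP]
    rfl
  · let v := U.toQuotient x hx
    have hv : ∀ w, v (π w) = aeval (fun j => x (t j)) w := by
      intro w
      have : v.comp π.toRingHom = (aeval (R := ℤ) fun j => x (t j)).toRingHom := by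
        apply MvPolynomial.ringHom_ext
        · intro r
          simp [π]
        · intro j
          simp [π]
          rfl
      exact RingHom.congr_fun this w
    -- A point congruent to the identity maps `I` into `J`, hence `I ^ n` to zero, and so does not
    -- see the difference between `a` and `P a`.
    have hI : I ≤ J.comap v := by
      intro b hb
      obtain ⟨a, rfl⟩ := Ideal.Quotient.mk_surjective b
      have h0 : augmentation A a = 0 := hb
      have := (Points.mem_ker_map_mk_iff J x).mp hx1 a
      rw [h0, Int.cast_zero, sub_zero] at this
      exact this
    have h := (Ideal.pow_right_mono hI n).trans (Ideal.le_comap_pow v n) (hπP a)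
    rw [hJ] at h
    have h' : v (π (P a) - Ideal.Quotient.mk U.ideal a) = 0 := h
    rw [map_sub, hv, sub_eq_zero] at h'
    exact h'.symm

end Coordinates

/-! ## Unipotent groups in positive characteristic -/

section Torsion

variable {A : Type} [CommRing A] [HopfAlgebra ℤ A]

/-- In characteristic `p` the translation operator `T` of `x` satisfies `(T - 1) ^ p ^ M = T ^ p ^ M
- 1`. Once `p ^ M` exceeds the nilpotency order on the coordinate `a`, that coordinate is fixed by
translation by `x ^ p ^ M`; evaluate at `1`. -/
lemma IsUnipotentElt.exists_apply_pow_eq {Ω : Type} [Field Ω] {p : ℕ} [Fact p.Prime] [CharP Ω p]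
    {x : Points A Ω} (hx : IsUnipotentElt x) (a : A) :
    ∃ N : ℕ, ∀ M ≥ N, (x ^ p ^ M) a = (1 : Points A Ω) a := by
  obtain ⟨n, hn⟩ := hx (fun y => y a) (Submodule.subset_span ⟨a, rfl⟩)
  refine ⟨n, fun M hM => ?_⟩
  set T : Module.End Ω (Points A Ω → Ω) :=
    LinearMap.funLeft Ω Ω (fun y : Points A Ω => y * x) with hT
  have hpow : ∀ (k : ℕ) (f : Points A Ω → Ω) (y : Points A Ω), (T ^ k) f y = f (y * x ^ k) := by
    intro k
    induction k with
    | zero => intro f y; simp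
    | succ k ih =>
      intro f y
      rw [pow_succ, Module.End.mul_apply, ih, pow_succ, ← mul_assoc]
      rfl
  have : CharP (Module.End Ω (Points A Ω → Ω)) p :=
    charP_of_injective_algebraMap (algebraMap Ω (Module.End Ω (Points A Ω → Ω))).injective p
  have h1 : (T - 1) ^ p ^ M = T ^ p ^ M - 1 := by
    rw [sub_pow_char_pow_of_commute _ _ (Commute.one_right T), one_pow]
  have h2 : ((T - 1) ^ p ^ M) (fun y => y a) = 0 := by
    have hle : n ≤ p ^ M := hM.trans (Nat.lt_pow_self (Fact.out : p.Prime).one_lt).le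
    rw [← Nat.sub_add_cancel hle, pow_add, Module.End.mul_apply, hn, map_zero]
  rw [h1] at h2
  have h3 := congrFun h2 1
  simp only [LinearMap.sub_apply, Pi.sub_apply, hpow, one_mul, Module.End.one_apply,
    Pi.zero_apply] at h3
  exact sub_eq_zero.mp h3

/-- Two points that agree on generators of the coordinate ring are equal. -/
lemma Points.ext_of_adjoin_eq_top {R : Type} [CommRing R] {S : Set A}
    (hS : Algebra.adjoin ℤ S = ⊤) {x y : Points A R} (h : ∀ a ∈ S, x a = y a) : x = y :=
  WithConv.ofConv_injective (AlgHom.ext_of_adjoin_eq_top hS h)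

lemma IsUnipotentElt.exists_pow_eq_one [hA : Algebra.FiniteType ℤ A] {Ω : Type} [Field Ω] {p : ℕ}
    [Fact p.Prime] [CharP Ω p] {x : Points A Ω} (hx : IsUnipotentElt x) :
    ∃ N : ℕ, ∀ M ≥ N, x ^ p ^ M = 1 := by
  obtain ⟨S, hS⟩ := hA.out
  choose N hN using fun a => hx.exists_apply_pow_eq (p := p) a
  exact ⟨S.sup N, fun M hM => Points.ext_of_adjoin_eq_top hS fun a ha =>
    hN a M ((Finset.le_sup ha).trans hM)⟩

/-- If the geometric points of a closed subgroup are unipotent, then its points in a ring in which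
a prime number is nilpotent have finite order. -/
lemma ClosedSubgroup.exists_pow_eq_one [Algebra.FiniteType ℤ A] (U : ClosedSubgroup A)
    (hU : ∀ (Ω : Type) [Field Ω] [IsAlgClosed Ω], ∀ x ∈ U.points Ω, IsUnipotentElt x)
    {p : ℕ} [Fact p.Prime] {R : Type} [CommRing R] (hp : IsNilpotent (p : R))
    {x : Points A R} (hx : x ∈ U.points R) : ∃ n ≠ 0, x ^ n = 1 := by
  obtain ⟨m, hm⟩ := hp
  -- The ring `R` need not be Noetherian, so the argument is run for the universal point `ξ` of `U`
  -- over a ring with `p ^ m = 0`; this ring is Noetherian and `x` is an image of `ξ`.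
  let I : Ideal A := U.ideal ⊔ Ideal.span {(p : A) ^ m}
  let B := A ⧸ I
  have : IsNoetherianRing A := Algebra.FiniteType.isNoetherianRing ℤ A
  let ξ : Points A B := Points.ofRingHom (Ideal.Quotient.mk I)
  have hξ : ξ ∈ U.points B := fun a ha =>
    Ideal.Quotient.eq_zero_iff_mem.mpr (Ideal.mem_sup_left ha)
  have hpB : (p : B) ^ m = 0 := by
    have : Ideal.Quotient.mk I ((p : A) ^ m) = 0 :=
      Ideal.Quotient.eq_zero_iff_mem.mpr (Ideal.mem_sup_right (Ideal.mem_span_singleton_self _))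
    simpa using this
  -- At a minimal prime, pass to an algebraic closure of the residue field. It has characteristic
  -- `p`, and there the unipotence hypothesis gives `ξ` a `p`-power order.
  have hprime : ∀ q ∈ minimalPrimes B, ∃ N : ℕ, ∀ M ≥ N, ∀ a : A,
      (ξ ^ p ^ M) a - (augmentation A a : ℤ) ∈ q := by
    intro q hq
    have hqp : q.IsPrime := hq.1.1
    let Ω := AlgebraicClosure (FractionRing (B ⧸ q))
    let φ : B →+* Ω := ((algebraMap (FractionRing (B ⧸ q)) Ω).comp
      (algebraMap (B ⧸ q) (FractionRing (B ⧸ q)))).comp (Ideal.Quotient.mk q)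
    have hφ : ∀ b, φ b = 0 → b ∈ q := by
      intro b hb
      rw [← Ideal.Quotient.eq_zero_iff_mem]
      apply IsFractionRing.injective (B ⧸ q) (FractionRing (B ⧸ q))
      apply (algebraMap (FractionRing (B ⧸ q)) Ω).injective
      simpa [φ] using hb
    have hchar : CharP Ω p := by
      have h0 : (p : Ω) = 0 := by
        have := congrArg φ hpB
        rw [map_pow, map_natCast, map_zero] at this
        exact (pow_eq_zero_iff (by rintro rfl; simp at this)).mp this
      exact (CharP.charP_iff_prime_eq_zero Fact.out).mpr h0
    obtain ⟨N, hN⟩ := (hU Ω (Points.map φ ξ) (U.map_mem φ hξ)).exists_pow_eq_one (p := p)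
    refine ⟨N, fun M hM a => hφ _ ?_⟩
    have := congrArg (fun y : Points A Ω => y a) (hN M hM)
    rw [← map_pow] at this
    simp only [Points.map_apply, Points.one_apply] at this
    rw [map_sub, this, map_intCast, sub_self]
  -- One exponent serves all of the finitely many minimal primes. That power of `ξ` is congruent to
  -- `1` modulo the nilradical, which is nilpotent and contains `p`.
  have hex : ∃ M : ℕ, ∀ q ∈ minimalPrimes B, ∀ a : A,
      (ξ ^ p ^ M) a - (augmentation A a : ℤ) ∈ q := by
    choose! N hN using hprime
    have hfin : (minimalPrimes B).Finite := minimalPrimes.finite_of_isNoetherianRing B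
    exact ⟨hfin.toFinset.sup N, fun q hq a => hN q hq _ (Finset.le_sup (by simpa using hq)) a⟩
  obtain ⟨M, hM⟩ := hex
  have h1 : ξ ^ p ^ M ∈ (Points.map (Ideal.Quotient.mk (nilradical B))).ker := by
    rw [Points.mem_ker_map_mk_iff]
    intro a
    rw [nilradical, ← Ideal.sInf_minimalPrimes]
    exact Submodule.mem_sInf.mpr fun q hq => hM q hq a
  obtain ⟨n, hn0, hn⟩ := exists_pow_eq_one_of_mem_ker (Fact.out : p.Prime).ne_zero
    (show (p : B) ∈ nilradical B from ⟨m, hpB⟩)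
    (IsNoetherianRing.isNilpotent_nilradical B) h1
  refine ⟨p ^ M * n, mul_ne_zero (pow_ne_zero _ (Fact.out : p.Prime).ne_zero) hn0, ?_⟩
  let φ : B →+* R := Ideal.Quotient.lift I x.ofConv.toRingHom fun a ha => by
    have hle : I ≤ RingHom.ker x.ofConv.toRingHom := by
      refine sup_le (fun a ha => hx a ha) ?_
      rw [Ideal.span_singleton_le_iff_mem, RingHom.mem_ker, map_pow, map_natCast, hm]
    exact hle ha
  have e : x = Points.map φ ξ := Points.ext_apply fun a => rfl
  rw [e, ← map_pow, pow_mul, hn, map_one]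

end Torsion

/-! ## The topology of adelic groups -/

section AdelicTopology

variable {A : Type} [CommRing A] [HopfAlgebra ℤ A]
variable {X : Scheme.{0}} [IsIntegral X] {C C' : NilpotentExtension X}

lemma continuous_points_apply (a : A) : Continuous fun x : Points A (Adele C) => x a :=
  (continuous_apply a).comp continuous_induced_dom

lemma continuous_points_iff {Y : Type*} [TopologicalSpace Y] {f : Y → Points A (Adele C)} :
    Continuous f ↔ ∀ a, Continuous fun y => f y a :=
  continuous_induced_rng.trans continuous_pi_iff

instance : BorelSpace (Points A (Adele C)) := ⟨rfl⟩

instance [IsTopologicalRing (Adele C)] : IsTopologicalGroup (Points A (Adele C)) where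
  continuous_mul := by
    refine continuous_points_iff.mpr fun a => ?_
    obtain ⟨S, hS⟩ := Points.exists_mul_apply_eq_sum a
    simp only [hS]
    exact continuous_finsetSum _ fun i _ =>
      ((continuous_points_apply i.1).comp continuous_fst).mul
        ((continuous_points_apply i.2).comp continuous_snd)
  continuous_inv := continuous_points_iff.mpr fun a =>
    continuous_points_apply (HopfAlgebra.antipodeAlgHom ℤ A a)

instance [T2Space (Adele C)] : T2Space (Points A (Adele C)) :=
  T2Space.of_injective_continuous (f := fun (x : Points A (Adele C)) (a : A) => x a)
    (fun _ _ h => Points.ext_apply (congrFun h)) continuous_induced_dom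

lemma secondCountableTopology_points [Countable A] [SecondCountableTopology (Adele C)] :
    SecondCountableTopology (Points A (Adele C)) :=
  TopologicalSpace.secondCountableTopology_induced _ _ _

lemma isClosed_subgroup_points [T2Space (Adele C)] (U : ClosedSubgroup A) :
    IsClosed (U.points (Adele C) : Set (Points A (Adele C))) := by
  have : (U.points (Adele C) : Set (Points A (Adele C))) =
      ⋂ a ∈ U.ideal, {x | x a = 0} := by
    ext x
    simp only [Set.mem_iInter]
    rfl
  rw [this]
  exact isClosed_biInter fun a _ => isClosed_eq (continuous_points_apply a) continuous_const

lemma mem_integralPoints_iff {g : Points A (Adele C)} :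
    g ∈ integralPoints A C ↔ ∀ a, g a ∈ integralAdeles C := by
  constructor
  · rintro ⟨x, rfl⟩ a
    exact (x a).2
  · intro h
    exact ⟨Points.ofRingHom (g.ofConv.toRingHom.codRestrict _ h), rfl⟩

/-- Integrality needs to be tested only on finitely many generators of `A`, so the condition is a
finite intersection of open ones. -/
lemma isOpen_integralPoints [hA : Algebra.FiniteType ℤ A]
    (hO : IsOpen (integralAdeles C : Set (Adele C))) :
    IsOpen (integralPoints A C : Set (Points A (Adele C))) := by
  obtain ⟨S, hS⟩ := hA.out
  have : (integralPoints A C : Set (Points A (Adele C))) =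
      ⋂ a ∈ S, {x | x a ∈ integralAdeles C} := by
    ext x
    simp only [Set.mem_iInter, SetLike.mem_coe, mem_integralPoints_iff, Set.mem_ofPred_eq]
    refine ⟨fun h a _ => h a, fun h a => ?_⟩
    have ha : a ∈ Algebra.adjoin ℤ (S : Set A) := hS ▸ Algebra.mem_top
    induction ha using Algebra.adjoin_induction with
    | mem a ha => exact h a ha
    | algebraMap n =>
      rw [show x (algebraMap ℤ A n) = algebraMap ℤ (Adele C) n from x.ofConv.commutes n]
      simp
    | add a b _ _ ha hb => exact (map_add x.ofConv a b) ▸ add_mem ha hb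
    | mul a b _ _ ha hb => exact (map_mul x.ofConv a b) ▸ mul_mem ha hb
  rw [this]
  exact isOpen_biInter_finset fun a _ => hO.preimage (continuous_points_apply a)

/-- Inside the product of copies of the compact ring of integral adeles, being a ring homomorphism
is a closed condition; Tychonoff applies. -/
lemma isCompact_integralPoints [IsTopologicalRing (Adele C)] [T2Space (Adele C)]
    (hO : IsCompact (integralAdeles C : Set (Adele C))) :
    IsCompact (integralPoints A C : Set (Points A (Adele C))) := by
  have hind : Topology.IsInducing fun (x : Points A (Adele C)) (a : A) => x a := ⟨rfl⟩
  rw [hind.isCompact_iff]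
  have : (fun (x : Points A (Adele C)) (a : A) => x a) '' integralPoints A C =
      (Set.univ.pi fun _ : A => (integralAdeles C : Set (Adele C))) ∩
        ({f | f 1 = 1} ∩ (⋂ (a) (b), {f | f (a + b) = f a + f b}) ∩
          ⋂ (a) (b), {f | f (a * b) = f a * f b}) := by
    ext f
    constructor
    · rintro ⟨x, hx, rfl⟩
      refine ⟨fun a _ => mem_integralPoints_iff.mp hx a, ⟨map_one x.ofConv, ?_⟩, ?_⟩ <;>
        simp only [Set.mem_iInter] <;> intro a b
      · exact map_add x.ofConv a b
      · exact map_mul x.ofConv a b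
    · rintro ⟨h, ⟨h1, h2⟩, h3⟩
      simp only [Set.mem_iInter] at h2 h3
      let g : A →+* Adele C := RingHom.mk' (⟨⟨f, h1⟩, h3⟩ : A →* Adele C) h2
      exact ⟨Points.ofRingHom g, mem_integralPoints_iff.mpr fun a => h a trivial, rfl⟩
  rw [this]
  refine (isCompact_univ_pi fun _ => hO).inter_right ?_
  refine ((isClosed_eq (continuous_apply 1) continuous_const).inter ?_).inter ?_ <;>
    refine isClosed_iInter fun a => isClosed_iInter fun b => isClosed_eq (continuous_apply _) ?_
  · exact (continuous_apply a).add (continuous_apply b)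
  · exact (continuous_apply a).mul (continuous_apply b)

lemma continuous_map_reduceAdele {j : NilpotentExtension.ClosedEmbedding C' C}
    (hj : Continuous (reduceAdele j)) : Continuous (Points.map (A := A) (reduceAdele j)) :=
  continuous_points_iff.mpr fun a => hj.comp (continuous_points_apply a)

/-! ### Principal subgroups -/

/-- `principal` is defined inside the full product of the rings `F_p`. Once the diagonal is known to
factor through `𝔸`, it becomes an honest image, because an adele is determined by its components. -/
lemma mem_principal_iff {δ : FunctionRing C →+* Adele C}
    (hδ : (adeleComponents C).comp δ = diagonal C)
    (S : Subgroup (Points A (FunctionRing C))) {g : Points A (Adele C)} :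
    g ∈ principal S ↔ ∃ x ∈ S, Points.map δ x = g := by
  have hinj : Function.Injective (adeleComponents C) := fun x y h => by
    ext p
    exact congrFun h p
  constructor
  · rintro ⟨x, hx, h⟩
    refine ⟨x, hx, Points.ext_apply fun a => hinj ?_⟩
    have := congrArg (fun y : Points A _ => y a) h
    rw [← hδ] at this
    exact this
  · rintro ⟨x, hx, rfl⟩
    refine ⟨x, hx, ?_⟩
    rw [← hδ]
    rfl

end AdelicTopology

/-! ## Cocompactness of principal adeles in congruence subgroups -/

section Cocompact

open scoped Pointwise

lemma continuous_mvPolynomial_aeval {σ R : Type} [CommRing R] [TopologicalSpace R]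
    [IsTopologicalRing R] (w : MvPolynomial σ ℤ) :
    Continuous fun c : σ → R => MvPolynomial.aeval c w := by
  induction w using MvPolynomial.induction_on with
  | C a => simpa using continuous_const
  | add p q hp hq =>
    simp only [map_add]
    exact hp.add hq
  | mul_X p j hp =>
    simp only [map_mul, MvPolynomial.aeval_X]
    exact hp.mul (continuous_apply j)

/-- If `𝔸 = F + Q` with `Q` compact, then the ideal of `𝔸` generated by a finitely generated ideal
`𝔞` of `F` is the sum of `𝔞` and a compact set. -/
lemma exists_isCompact_ideal_map {F 𝔸 : Type} [CommRing F] [CommRing 𝔸] [TopologicalSpace 𝔸]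
    [IsTopologicalRing 𝔸] (δ : F →+* 𝔸) {Q : Set 𝔸} (hQ : IsCompact Q)
    (h : ∀ a : 𝔸, ∃ f : F, ∃ q ∈ Q, a = δ f + q) {𝔞 : Ideal F} (h𝔞 : 𝔞.FG) :
    ∃ K : Set 𝔸, IsCompact K ∧ K ⊆ 𝔞.map δ ∧ ∀ x ∈ 𝔞.map δ, ∃ f ∈ 𝔞, ∃ q ∈ K, x = δ f + q := by
  obtain ⟨S, rfl⟩ := h𝔞
  refine ⟨(fun c : S → 𝔸 => ∑ e : S, c e * δ e) '' Set.univ.pi fun _ => Q,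
    (isCompact_univ_pi fun _ => hQ).image (by fun_prop), ?_, fun x hx => ?_⟩
  · rintro _ ⟨c, -, rfl⟩
    exact sum_mem fun e _ => Ideal.mul_mem_left _ _
      (Ideal.mem_map_of_mem δ (Submodule.subset_span e.2))
  · rw [Ideal.map_span] at hx
    have hx' : x ∈ Submodule.span 𝔸 (Set.range fun e : S => δ e) := by
      convert hx using 2
      ext y
      simp
    obtain ⟨c, rfl⟩ := (Submodule.mem_span_range_iff_exists_fun 𝔸).mp hx'
    choose f q hq hc using fun e : S => h (c e)
    refine ⟨∑ e : S, f e * e, sum_mem fun e _ => Ideal.mul_mem_left _ _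
      (Submodule.subset_span e.2), _, ⟨q, fun e _ => hq e, rfl⟩, ?_⟩
    rw [map_sum, ← Finset.sum_add_distrib]
    refine Finset.sum_congr rfl fun e _ => ?_
    rw [smul_eq_mul, map_mul, hc]
    simp only [add_mul]

variable {A : Type} [CommRing A] [HopfAlgebra ℤ A]
variable {X : Scheme.{0}} [IsIntegral X] {C : NilpotentExtension X}

/-- Successive approximation along the powers of `J`: split the coordinates of `v` into a part from
`J ^ i` and a part in a compact set, and turn each part into a point of `U`. Their product agrees
with `v` to the next order. After finitely many corrections nothing is left, since `J` is nilpotent.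
-/
lemma ClosedSubgroup.exists_isCompact_congruence [IsTopologicalRing (Adele C)] (U : ClosedSubgroup A)
    [Algebra.Smooth ℤ (A ⧸ U.ideal)] {F : Type} [CommRing F] [IsNoetherianRing F]
    (δ : F →+* Adele C) {Q : Set (Adele C)} (hQ : IsCompact Q)
    (h : ∀ a, ∃ f : F, ∃ q ∈ Q, a = δ f + q) {J : Ideal F} (hJ : IsNilpotent J) :
    ∃ K : Set (Points A (Adele C)), IsCompact K ∧ K ⊆ U.points (Adele C) ∧
      ∀ v ∈ U.points (Adele C), v ∈ (Points.map (Ideal.Quotient.mk (J.map δ))).ker →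
        ∃ γ ∈ U.points F, γ ∈ (Points.map (Ideal.Quotient.mk J)).ker ∧
          ∃ q ∈ K, v = Points.map δ γ * q := by
  obtain ⟨n, hn⟩ := hJ
  have hJn : J ^ (n + 1) = ⊥ := by rw [pow_succ, hn, zero_mul, Ideal.zero_eq_bot]
  obtain ⟨N, t, P, ht, hP0, hP⟩ := U.exists_coordinates (n := n + 1) (by omega)
  have hδn : (J.map δ) ^ (n + 1) = ⊥ := by rw [← Ideal.map_pow, hJn, Ideal.map_bot]
  -- Here `m` bounds the number of remaining steps; with `m = 0` the `i`-th congruence subgroup is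
  -- already trivial.
  have key : ∀ m i : ℕ, i ≠ 0 → n + 1 ≤ i + m →
      ∃ K : Set (Points A (Adele C)), IsCompact K ∧ K ⊆ U.points (Adele C) ∧
      ∀ v ∈ U.points (Adele C), v ∈ (Points.map (Ideal.Quotient.mk (J.map δ ^ i))).ker →
        ∃ γ ∈ U.points F, γ ∈ (Points.map (Ideal.Quotient.mk J)).ker ∧
          ∃ q ∈ K, v = Points.map δ γ * q := by
    intro m
    induction m with
    | zero =>
      intro i _ hi
      refine ⟨{1}, isCompact_singleton, by simp, fun v _ hv => ⟨1, one_mem _,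
        one_mem _, 1, rfl, ?_⟩⟩
      have := ker_map_mk_mono (Ideal.pow_le_pow_right hi) hv
      rw [hδn, ker_map_mk_bot, Subgroup.mem_bot] at this
      simpa using this
    | succ m ih =>
      intro i hi0 hi
      obtain ⟨K', hK', hK'U, hK'v⟩ := ih (i + 1) (by omega) (by omega)
      obtain ⟨Q', hQ', hQ'J, hQ'x⟩ := exists_isCompact_ideal_map δ hQ h
        (IsNoetherian.noetherian (J ^ i))
      rw [Ideal.map_pow] at hQ'J hQ'x
      have hJi : J.map δ ^ i ≤ J.map δ := Ideal.pow_le_self hi0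
      have hJF : J ^ i ≤ J := Ideal.pow_le_self hi0
      have hcompat : ∀ c : Set.univ.pi fun _ : Fin N => Q', ∀ j, c.1 j ∈ J.map δ :=
        fun c j => hJi (hQ'J (c.2 j trivial))
      choose s hsU hs using fun c : Set.univ.pi fun _ : Fin N => Q' =>
        (hP (Adele C) (J.map δ) hδn).1 c.1 (hcompat c)
      have hscont : Continuous s := continuous_points_iff.mpr fun a => by
        simp only [hs]
        exact (continuous_mvPolynomial_aeval (P a)).comp continuous_subtype_val
      have : CompactSpace (Set.univ.pi fun _ : Fin N => Q') :=
        isCompact_iff_compactSpace.mp (isCompact_univ_pi fun _ => hQ')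
      have hcong : ∀ {R : Type} [CommRing R] (I : Ideal R) (c : Fin N → R) (x : Points A R),
          (∀ j, c j ∈ I) → (∀ a, x a = MvPolynomial.aeval c (P a)) →
          x ∈ (Points.map (Ideal.Quotient.mk I)).ker := by
        intro R _ I c x hc hx
        rw [Points.mem_ker_map_mk_iff]
        intro a
        rw [hx, ← hP0]
        exact aeval_sub_constantCoeff_mem I hc (P a)
      refine ⟨K' * Set.range s, hK'.mul (isCompact_range hscont), ?_, fun v hvU hv => ?_⟩
      · rintro _ ⟨x, hx, _, ⟨c, rfl⟩, rfl⟩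
        exact mul_mem (hK'U hx) (hsU c)
      · have hvt : ∀ j, v (t j) ∈ J.map δ ^ i := fun j => by
          simpa [ht j] using (Points.mem_ker_map_mk_iff _ v).mp hv (t j)
        choose f hf q hq hfq using fun j => hQ'x _ (hvt j)
        obtain ⟨γ, hγU, hγ⟩ := (hP F J hJn).1 f fun j => hJF (hf j)
        let c : Set.univ.pi fun _ : Fin N => Q' := ⟨q, fun j _ => hq j⟩
        have hv' := (hP (Adele C) (J.map δ) hδn).2 v hvU (ker_map_mk_mono hJi hv)
        have hγδ : ∀ a, Points.map δ γ a = MvPolynomial.aeval (fun j => δ (f j)) (P a) := by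
          intro a
          rw [Points.map_apply, hγ]
          exact MvPolynomial.comp_aeval_apply (R := ℤ) f δ.toIntAlgHom (P a)
        have hδf : ∀ j, δ (f j) ∈ J.map δ ^ i := fun j => by
          rw [← Ideal.map_pow]
          exact Ideal.mem_map_of_mem δ (hf j)
        have hxmem := hcong (J.map δ ^ i) _ _ hδf hγδ
        have hymem := hcong (J.map δ ^ i) _ _ (fun j => hQ'J (hq j)) (hs c)
        have hle : J.map δ ^ i * J.map δ ^ i ≤ J.map δ ^ (i + 1) := by
          rw [← pow_add]
          exact Ideal.pow_le_pow_right (by omega)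
        -- Both the group law and the coordinate polynomials are additive, up to the constant term,
        -- modulo the square of the `i`-th power ideal. That square lies in the next power.
        have hclose : ∀ a, v a - (Points.map δ γ * s c) a ∈ J.map δ ^ (i + 1) := by
          intro a
          have h1 := hle (Points.mul_apply_sub_mem hxmem hymem a)
          have h2 := hle (aeval_add_sub_mem (J.map δ ^ i) hδf (fun j => hQ'J (hq j)) (P a))
          rw [hγδ, hs] at h1
          have h3 : v a = MvPolynomial.aeval ((fun j => δ (f j)) + q) (P a) := by
            rw [hv']
            congr 2
            ext1 j
            exact hfq j
          rw [hP0] at h2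
          rw [h3]
          convert sub_mem h2 h1 using 1
          ring
        have heq : Points.map (Ideal.Quotient.mk (J.map δ ^ (i + 1))) v =
            Points.map (Ideal.Quotient.mk (J.map δ ^ (i + 1))) (Points.map δ γ * s c) :=
          Points.ext_apply fun a => Ideal.Quotient.eq.mpr (hclose a)
        -- The rational factor is removed on the left and the compact one on the right. Rational
        -- corrections then accumulate on the left and compact ones on the right, without commuting
        -- the two.
        have hv1 : (Points.map δ γ)⁻¹ * v * (s c)⁻¹ ∈
            (Points.map (Ideal.Quotient.mk (J.map δ ^ (i + 1)))).ker := by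
          rw [MonoidHom.mem_ker, map_mul, map_mul, heq, map_mul, map_inv, map_inv]
          group
        obtain ⟨γ', hγ'U, hγ'J, k, hk, e⟩ := hK'v _
          (mul_mem (mul_mem (inv_mem (U.map_mem δ hγU)) hvU) (inv_mem (hsU c))) hv1
        refine ⟨γ * γ', mul_mem hγU hγ'U,
          mul_mem (hcong J f γ (fun j => hJF (hf j)) hγ) hγ'J, k * s c,
          Set.mul_mem_mul hk ⟨c, rfl⟩, ?_⟩
        rw [map_mul, mul_assoc, ← mul_assoc (Points.map δ γ'), ← e]
        group
  have := key n 1 one_ne_zero (by omega)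
  rwa [pow_one] at this

end Cocompact

/-! ## Integration over quotients by discrete subgroups -/

section DiscreteQuotients

open scoped Pointwise Topology ENNReal
open Measure

variable {G G' : Type*} [Group G] [TopologicalSpace G] [IsTopologicalGroup G]
  [SecondCountableTopology G] [MeasurableSpace G] [BorelSpace G]
  [Group G'] [TopologicalSpace G'] [IsTopologicalGroup G']
  [SecondCountableTopology G'] [MeasurableSpace G'] [BorelSpace G']

lemma countable_of_discrete (Γ : Subgroup G) {W : Set G} (hW : W ∈ 𝓝 1)
    (hΓ : ∀ γ ∈ Γ, γ ∈ W → γ = 1) : Countable Γ := by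
  have : DiscreteTopology Γ := by
    apply discreteTopology_of_isOpen_singleton_one
    obtain ⟨V, hVW, hV, h1⟩ := mem_nhds_iff.mp hW
    refine ⟨V, hV, ?_⟩
    ext γ
    exact ⟨fun h => Subtype.ext (hΓ γ γ.2 (hVW h)), fun h => by
      rw [Set.mem_singleton_iff.mp h]
      exact h1⟩
  exact countable_of_Lindelof_of_discrete

/-- A discrete subgroup of a second countable group has a measurable strict fundamental domain. -/
lemma exists_strict_fundDomain (Γ : Subgroup G) {W : Set G} (hW : W ∈ 𝓝 1)
    (hΓ : ∀ γ ∈ Γ, γ ∈ W → γ = 1) :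
    ∃ D : Set G, MeasurableSet D ∧ ∀ x, ∃! γ : Γ, γ • x ∈ D := by
  -- With `V V⁻¹ ⊆ W`, each right translate of `V` meets every orbit of `Γ` at most once. By second
  -- countability, countably many such translates cover the group.
  obtain ⟨V, hV, h1V, hVW⟩ : ∃ V : Set G, IsOpen V ∧ 1 ∈ V ∧ ∀ v ∈ V, ∀ w ∈ V, v * w⁻¹ ∈ W := by
    have hc : Filter.Tendsto (fun x : G × G => x.1 * x.2⁻¹) (𝓝 (1, 1)) (𝓝 1) := by
      have : Continuous fun x : G × G => x.1 * x.2⁻¹ := by fun_prop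
      simpa using this.tendsto (1, 1)
    obtain ⟨U, hU, hUW⟩ := mem_nhds_prod_iff.mp (hc hW)
    obtain ⟨U', hU', hUU⟩ := hUW
    have hUU' : ∀ v ∈ U, ∀ w ∈ U', v * w⁻¹ ∈ W := fun v hv w hw => hUU (Set.mk_mem_prod hv hw)
    obtain ⟨V, hVU, hVo, h1⟩ := mem_nhds_iff.mp (Filter.inter_mem hU hU')
    exact ⟨V, hVo, h1, fun v hv w hw => hUU' v (hVU hv).1 w (hVU hw).2⟩
  obtain ⟨T, hT, hTV⟩ := TopologicalSpace.isOpen_iUnion_countable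
    (fun g : G => (fun x => x * g⁻¹) ⁻¹' V) fun g => hV.preimage (continuous_mul_const _)
  have hcov : ⋃ g ∈ T, (fun x => x * g⁻¹) ⁻¹' V = Set.univ := by
    rw [hTV]
    refine Set.eq_univ_of_forall fun x => Set.mem_iUnion.mpr ⟨x, ?_⟩
    simpa using h1V
  have hTne : T.Nonempty := by
    by_contra h
    rw [Set.not_nonempty_iff_eq_empty.mp h] at hcov
    rw [Set.biUnion_empty] at hcov
    exact Set.empty_ne_univ hcov
  obtain ⟨t, rfl⟩ := hT.exists_eq_range hTne
  let E : ℕ → Set G := fun n => (fun x => x * (t n)⁻¹) ⁻¹' V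
  have hE : ∀ n, IsOpen (E n) := fun n => hV.preimage (continuous_mul_const _)
  have hEdisj : ∀ n x (γ : G), γ ∈ Γ → x ∈ E n → γ * x ∈ E n → γ = 1 := by
    intro n x γ hγ hx hγx
    refine hΓ γ hγ ?_
    have := hVW _ hγx _ hx
    convert this using 1
    group
  let S : ℕ → Set G := fun n => ⋃ γ : Γ, (fun x => (γ : G) * x) ⁻¹' E n
  have hS : ∀ n, IsOpen (S n) := fun n =>
    isOpen_iUnion fun γ => (hE n).preimage (continuous_const_mul _)
  have hSΓ : ∀ n x (γ : Γ), (γ : G) * x ∈ S n ↔ x ∈ S n := by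
    intro n x γ
    simp only [S, Set.mem_iUnion, Set.mem_preimage]
    constructor
    · rintro ⟨γ', h⟩
      exact ⟨γ' * γ, by rwa [Subgroup.coe_mul, mul_assoc]⟩
    · rintro ⟨γ', h⟩
      exact ⟨γ' * γ⁻¹, by simpa [mul_assoc] using h⟩
  -- From each orbit take its point in the first `E n` that it meets; the sets `S m` are the
  -- saturations of the `E m` under `Γ`.
  refine ⟨⋃ n, E n \ ⋃ m < n, S m, MeasurableSet.iUnion fun n => (hE n).measurableSet.diff
    (MeasurableSet.iUnion fun m => MeasurableSet.iUnion fun _ => (hS m).measurableSet), fun x => ?_⟩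
  have hex : ∃ n, x ∈ S n := by
    have hx : x ∈ ⋃ g ∈ Set.range t, (fun x => x * g⁻¹) ⁻¹' V := hcov ▸ Set.mem_univ x
    simp only [Set.mem_iUnion, Set.mem_range, exists_prop, exists_exists_eq_and] at hx
    obtain ⟨n, hn⟩ := hx
    exact ⟨n, Set.mem_iUnion.mpr ⟨1, by simpa [E] using hn⟩⟩
  classical
  have hmem : ∀ γ : Γ, γ • x ∈ (⋃ n, E n \ ⋃ m < n, S m) ↔ (γ : G) * x ∈ E (Nat.find hex) := by
    intro γ
    simp only [Set.mem_iUnion, Set.mem_sdiff, not_exists, exists_prop, not_and]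
    constructor
    · rintro ⟨n, hn, hm⟩
      have h1 : x ∈ S n := Set.mem_iUnion.mpr ⟨γ, hn⟩
      have h2 : Nat.find hex = n := by
        rw [Nat.find_eq_iff]
        exact ⟨h1, fun m hmn hxm => hm m hmn ((hSΓ m x γ).mpr hxm)⟩
      rw [h2]
      exact hn
    · intro h
      exact ⟨_, h, fun m hm hxm => Nat.find_min hex hm ((hSΓ m x γ).mp hxm)⟩
  obtain ⟨γ, hγ⟩ := Set.mem_iUnion.mp (Nat.find_spec hex)
  refine ⟨γ, (hmem γ).mpr hγ, fun γ' hγ' => ?_⟩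
  have h' := (hmem γ').mp hγ'
  have := hEdisj _ _ ((γ' : G) * (γ : G)⁻¹) (mul_mem γ'.2 (inv_mem γ.2)) hγ (by simpa using h')
  exact Subtype.ext (mul_inv_eq_one.mp this)

/-- A locally compact group all of whose elements have finite order is unimodular. -/
lemma isMulRightInvariant_of_finite_order [LocallyCompactSpace G] (μ : Measure G) [μ.IsHaarMeasure]
    (h : ∀ g : G, ∃ n ≠ 0, g ^ n = 1) : μ.IsMulRightInvariant := by
  refine ⟨fun g => ?_⟩
  have h1 : modularCharacter g = 1 := by
    obtain ⟨n, hn, hg⟩ := h g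
    have : modularCharacter g ^ n = 1 := by rw [← map_pow, hg, map_one]
    -- The modular character takes nonnegative real values, and such a number with a nontrivial
    -- power equal to `1` is `1`.
    exact (pow_eq_one_iff.mp this).resolve_right hn
  have h2 := isMulLeftInvariant_eq_smul (map (· * g) μ) μ
  rw [← modularCharacterFun_eq_haarScalarFactor] at h2
  rw [h2, show modularCharacterFun g = 1 from h1, one_smul]

variable [LocallyCompactSpace G'] (ρ : G →* G') (μ : Measure G) (μ' : Measure G')
  [μ.IsHaarMeasure] [μ'.IsHaarMeasure] [μ.IsMulRightInvariant] [μ'.IsMulRightInvariant]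

/-- The push forward of a Haar measure from the quotient by a cocompact lattice in the kernel. -/
lemma exists_map_restrict_eq_smul (hρ : Continuous ρ) (hsurj : Function.Surjective ρ)
    (Δ : Subgroup G) [Countable Δ] (hΔ : Δ ≤ ρ.ker) {Q K₀ : Set G} (hQ : IsCompact Q)
    (hker : ∀ v ∈ ρ.ker, ∃ δ ∈ Δ, ∃ q ∈ Q, v = δ * q) (hK₀ : IsCompact K₀)
    (hK₀' : ρ '' K₀ ∈ 𝓝 (1 : G')) {D : Set G} (hD : MeasurableSet D)
    (hD' : ∀ x, ∃! δ : Δ, δ • x ∈ D) :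
    ∃ c : NNReal, c ≠ 0 ∧ (μ.restrict D).map ρ = c • μ' := by
  have hfd : IsFundamentalDomain Δ D μ := IsFundamentalDomain.mk' hD.nullMeasurableSet hD'
  have hρm : Measurable ρ := hρ.measurable
  let ν := (μ.restrict D).map ρ
  have hνapply : ∀ E, MeasurableSet E → ν E = μ (ρ ⁻¹' E ∩ D) := fun E hE => by
    rw [Measure.map_apply hρm hE, Measure.restrict_apply (hρm hE)]
  -- Right translation replaces `D` by another fundamental domain of `Δ`. The preimage under `ρ` of
  -- any set is `Δ`-invariant, so its measure inside a fundamental domain does not depend on the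
  -- domain.
  have hνr : ν.IsMulRightInvariant := by
    refine ⟨fun g' => ?_⟩
    obtain ⟨g, rfl⟩ := hsurj g'
    ext E hE
    rw [Measure.map_apply (measurable_mul_const _) hE, hνapply _ (measurable_mul_const _ hE),
      hνapply E hE]
    have e : ρ ⁻¹' ((fun x => x * ρ g) ⁻¹' E) ∩ D =
        (fun x => x * g) ⁻¹' (ρ ⁻¹' E ∩ (fun x => x * g⁻¹) ⁻¹' D) := by
      ext x
      simp
    rw [e, measure_preimage_mul_right]
    have hfd' : IsFundamentalDomain Δ ((fun x => x * g⁻¹) ⁻¹' D) μ := by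
      refine IsFundamentalDomain.mk' (measurable_mul_const _ hD).nullMeasurableSet fun x => ?_
      have := hD' (x * g⁻¹)
      simp only [Set.mem_preimage]
      convert this using 3 with δ
      exact mul_assoc (δ : G) x g⁻¹
    refine hfd'.measure_set_eq hfd (hρm hE) fun δ => ?_
    ext x
    have : ρ (δ : G) = 1 := hΔ δ.2
    simp [Subgroup.smul_def, this]
  -- Near `1` the fibres are covered by the `Δ`-translates of the compact set `Q * K₀`, and these
  -- together have measure at most `μ (Q * K₀)` inside `D`. This is the only use of cocompactness.
  have hνfin : ∃ E : Set G', IsOpen E ∧ 1 ∈ E ∧ ν E < ∞ := by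
    obtain ⟨E, hE, hEo, h1⟩ := mem_nhds_iff.mp hK₀'
    refine ⟨E, hEo, h1, ?_⟩
    rw [hνapply E hEo.measurableSet]
    have hsub : ρ ⁻¹' E ⊆ ⋃ δ : Δ, (δ • (Q * K₀) : Set G) := by
      intro x hx
      obtain ⟨k, hk, hkx⟩ := hE hx
      obtain ⟨δ, hδ, q, hq, e⟩ := hker (x * k⁻¹) (by
        rw [MonoidHom.mem_ker, map_mul, map_inv, hkx, mul_inv_cancel])
      refine Set.mem_iUnion.mpr ⟨⟨δ, hδ⟩, q * k, Set.mul_mem_mul hq hk, ?_⟩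
      change δ * (q * k) = x
      rw [← mul_assoc, ← e]
      group
    calc μ (ρ ⁻¹' E ∩ D) ≤ μ (⋃ δ : Δ, (δ • (Q * K₀) : Set G) ∩ D) := by
          rw [← Set.iUnion_inter]
          exact measure_mono (Set.inter_subset_inter_left _ hsub)
      _ ≤ ∑' δ : Δ, μ ((δ • (Q * K₀) : Set G) ∩ D) := measure_iUnion_le _
      _ = μ (Q * K₀) := (hfd.measure_eq_tsum _).symm
      _ < ∞ := (hQ.mul hK₀).measure_lt_top
  have hνloc : IsLocallyFiniteMeasure ν := by
    refine ⟨fun x => ?_⟩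
    obtain ⟨E, hEo, h1, hE⟩ := hνfin
    refine ⟨(fun y => y * x⁻¹) ⁻¹' E,
      (hEo.preimage (continuous_mul_const _)).mem_nhds (by simpa using h1), ?_⟩
    rwa [measure_preimage_mul_right]
  have hinvfin : ∀ m : Measure G', IsFiniteMeasureOnCompacts m →
      IsFiniteMeasureOnCompacts m.inv := fun m hm => by
    refine ⟨fun K hK => ?_⟩
    rw [Measure.inv_apply]
    exact hK.inv.measure_lt_top
  have := hinvfin ν inferInstance
  have := hinvfin μ' inferInstance
  -- Uniqueness of Haar measure is applied to left invariant measures, so the right invariant `ν` is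
  -- inverted, compared with `μ'`, and inverted back.
  have h1 := isMulLeftInvariant_eq_smul ν.inv μ'
  have h2 := isMulLeftInvariant_eq_smul μ'.inv μ'
  set c := ν.inv.haarScalarFactor μ'
  set c' := μ'.inv.haarScalarFactor μ'
  have h3 : ν = (c * c') • μ' := by
    have : ν = ν.inv.inv := (Measure.inv_inv ν).symm
    rw [this, h1, Measure.inv, Measure.map_smul, ← Measure.inv, h2, smul_smul]
  refine ⟨c * c', fun h0 => ?_, h3⟩
  rw [h0, zero_smul] at h3
  have h4 : ν Set.univ = 0 := by rw [h3]; rfl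
  rw [hνapply _ MeasurableSet.univ, Set.preimage_univ, Set.univ_inter] at h4
  exact hfd.measure_ne_zero (NeZero.ne μ) h4

/-- Integration of functions pulled back from a quotient by a subgroup in which a discrete
subgroup is cocompact. -/
lemma integral_fundDomain_comp (hρ : Continuous ρ) (hsurj : Function.Surjective ρ)
    (Γ : Subgroup G) (Γ' : Subgroup G') (hΓΓ' : Γ.map ρ = Γ')
    {W : Set G} (hW : W ∈ 𝓝 1) (hΓW : ∀ γ ∈ Γ, γ ∈ W → γ = 1)
    {W' : Set G'} (hW' : W' ∈ 𝓝 1) (hΓW' : ∀ γ ∈ Γ', γ ∈ W' → γ = 1)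
    {Q K₀ : Set G} (hQ : IsCompact Q)
    (hker : ∀ v ∈ ρ.ker, ∃ δ ∈ Γ ⊓ ρ.ker, ∃ q ∈ Q, v = δ * q) (hK₀ : IsCompact K₀)
    (hK₀' : ρ '' K₀ ∈ 𝓝 (1 : G')) {S : Set G} (hS : IsFundamentalDomain Γ S μ)
    {S' : Set G'} (hS' : IsFundamentalDomain Γ' S' μ') :
    ∃ c : ℝ, c ≠ 0 ∧ ∀ φ : G' → ℂ, Continuous φ → (∀ γ ∈ Γ', ∀ x, φ (γ * x) = φ x) →
      ((IntegrableOn (fun x => φ (ρ x)) S μ ↔ IntegrableOn φ S' μ') ∧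
        ∫ x in S, φ (ρ x) ∂μ = c * ∫ x in S', φ x ∂μ') := by
  have : Countable Γ := countable_of_discrete Γ hW hΓW
  have : Countable Γ' := countable_of_discrete Γ' hW' hΓW'
  have hΔW : ∀ γ ∈ Γ ⊓ ρ.ker, γ ∈ W → γ = 1 := fun γ hγ => hΓW γ hγ.1
  have : Countable ↥(Γ ⊓ ρ.ker) := countable_of_discrete _ hW hΔW
  obtain ⟨D, hD, hD'⟩ := exists_strict_fundDomain (Γ ⊓ ρ.ker) hW hΔW
  obtain ⟨D₁, hD₁, hD₁'⟩ := exists_strict_fundDomain Γ' hW' hΓW'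
  obtain ⟨c, hc0, hc⟩ := exists_map_restrict_eq_smul ρ μ μ' hρ hsurj (Γ ⊓ ρ.ker) inf_le_right hQ
    hker hK₀ hK₀' hD hD'
  have hρm : Measurable ρ := hρ.measurable
  -- A fundamental domain adapted to `ρ`: first move `ρ x` into `D₁` by a lift of an element of
  -- `Γ'`, then move within the fibre into `D` by an element of `Γ ⊓ ρ.ker`.
  have hT : IsFundamentalDomain Γ (ρ ⁻¹' D₁ ∩ D) μ := by
    refine IsFundamentalDomain.mk' ((hρm hD₁).inter hD).nullMeasurableSet fun x => ?_
    obtain ⟨γ', hγ', hγ'u⟩ := hD₁' (ρ x)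
    obtain ⟨γ, hγ, hγγ'⟩ : ∃ γ ∈ Γ, ρ γ = γ' := by
      have h : (γ' : G') ∈ Γ.map ρ := hΓΓ'.symm ▸ γ'.2
      exact h
    obtain ⟨δ, hδ, hδu⟩ := hD' (γ * x)
    have hδ1 : ρ (δ : G) = 1 := δ.2.2
    refine ⟨⟨δ * γ, mul_mem δ.2.1 hγ⟩, ⟨?_, ?_⟩, ?_⟩
    · change ρ (δ * γ * x) ∈ D₁
      rw [map_mul, map_mul, hδ1, one_mul, hγγ']
      exact hγ'
    · change δ * γ * x ∈ D
      rw [mul_assoc]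
      exact hδ
    · rintro ⟨β, hβ⟩ ⟨h1, h2⟩
      have h3 := hγ'u ⟨ρ β, by rw [← hΓΓ']; exact ⟨β, hβ, rfl⟩⟩ (by
        have h1' : ρ (β * x) ∈ D₁ := h1
        rwa [map_mul] at h1')
      have h4 : ρ β = ρ γ := by rw [hγγ', ← h3]
      have h5 := hδu ⟨β * γ⁻¹, Γ.mul_mem hβ (Γ.inv_mem hγ), by
        change ρ (β * γ⁻¹) = 1
        rw [ map_mul, map_inv, h4, mul_inv_cancel]⟩ (by
        change β * γ⁻¹ * (γ * x) ∈ D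
        rw [mul_assoc, inv_mul_cancel_left]
        exact h2)
      apply Subtype.ext
      change β = δ * γ
      rw [← h5]
      simp
  refine ⟨c, by exact_mod_cast hc0, fun φ hφ hφΓ => ?_⟩
  have hinv : ∀ (γ : Γ) x, φ (ρ (γ • x)) = φ (ρ x) := fun γ x => by
    change φ (ρ (γ * x)) = _
    rw [map_mul]
    exact hφΓ _ (by rw [← hΓΓ']; exact ⟨γ, γ.2, rfl⟩) _
  have hinv' : ∀ (γ : Γ') x, φ (γ • x) = φ x := fun γ x => hφΓ _ γ.2 x
  have hfd₁ : IsFundamentalDomain Γ' D₁ μ' := IsFundamentalDomain.mk' hD₁.nullMeasurableSet hD₁'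
  -- On the adapted domain the comparison is a change of variables with constant `c`, independent of
  -- `φ`. Invariance of the integrands makes the given domains `S` and `S'` interchangeable with the
  -- adapted ones.
  have hmeas : (μ.restrict (ρ ⁻¹' D₁ ∩ D)).map ρ = c • μ'.restrict D₁ := by
    rw [← Measure.restrict_smul, ← hc, Measure.restrict_map hρm hD₁,
      Measure.restrict_restrict (hρm hD₁)]
  have hφm : ∀ m : Measure G', AEStronglyMeasurable φ m := fun m => hφ.aestronglyMeasurable
  constructor
  · rw [hS.integrableOn_iff hT hinv, hS'.integrableOn_iff hfd₁ hinv', IntegrableOn,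
      ← Function.comp_def φ ρ, ← integrable_map_measure (hφm _) hρm.aemeasurable, hmeas]
    exact integrable_smul_measure (by exact_mod_cast hc0) ENNReal.coe_ne_top
  · rw [hS.setIntegral_eq hT hinv, hS'.setIntegral_eq hfd₁ hinv',
      ← integral_map hρm.aemeasurable (hφm _), hmeas, integral_smul_nnreal_measure]
    rfl

end DiscreteQuotients

/-! ## Completions of Noetherian local rings with finite residue field -/

section Completion

open IsLocalRing
open scoped Topology

variable (R : Type) [CommRing R] [IsLocalRing R]

/-- The completion of a local ring. -/
local notation "𝓡" => AdicCompletion (maximalIdeal R) R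

/-- The projective limit topology on the completion of a local ring. -/
@[reducible] def completionTopology : TopologicalSpace (AdicCompletion (maximalIdeal R) R) :=
  TopologicalSpace.induced
    (fun x n => AdicCompletion.evalₐ (maximalIdeal R) n x)
    (@Pi.topologicalSpace ℕ (fun n => R ⧸ maximalIdeal R ^ n) fun _ => ⊥)

attribute [local instance] completionTopology

lemma continuous_evalₐ (n : ℕ) :
    @Continuous _ _ (completionTopology R) ⊥ (AdicCompletion.evalₐ (maximalIdeal R) n) := by
  exact @Continuous.comp _ _ _ (completionTopology R)
    (@Pi.topologicalSpace ℕ (fun n => R ⧸ maximalIdeal R ^ n) fun _ => ⊥) ⊥ _ _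
    (@continuous_apply ℕ (fun n => R ⧸ maximalIdeal R ^ n) (fun _ => ⊥) n) continuous_induced_dom

lemma isTopologicalRing_completion : IsTopologicalRing 𝓡 := by
  let : ∀ n, TopologicalSpace (R ⧸ maximalIdeal R ^ n) := fun _ => ⊥
  have : ∀ n, DiscreteTopology (R ⧸ maximalIdeal R ^ n) := fun _ => ⟨rfl⟩
  have h := continuous_evalₐ R
  refine { continuous_add := ?_, continuous_mul := ?_, continuous_neg := ?_ } <;>
    refine continuous_induced_rng.mpr (continuous_pi fun n => ?_)
  · simp only [Function.comp_def, map_add]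
    exact ((h n).comp continuous_fst).add ((h n).comp continuous_snd)
  · simp only [Function.comp_def, map_mul]
    exact ((h n).comp continuous_fst).mul ((h n).comp continuous_snd)
  · simp only [Function.comp_def, map_neg]
    exact (h n).neg

lemma t2Space_completion : T2Space 𝓡 := by
  let : ∀ n, TopologicalSpace (R ⧸ maximalIdeal R ^ n) := fun _ => ⊥
  have : ∀ n, DiscreteTopology (R ⧸ maximalIdeal R ^ n) := fun _ => ⟨rfl⟩
  exact T2Space.of_injective_continuous
    (f := fun (x : 𝓡) n => AdicCompletion.evalₐ (maximalIdeal R) n x)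
    (fun _ _ h => AdicCompletion.ext_evalₐ (congrFun h)) continuous_induced_dom

variable [IsNoetherianRing R]

/-- Finite generation of the maximal ideal makes the kernel of the projection equal to the extended
power. This reconciles the projective limit topology, used for compactness, with the topology by
extended powers used to define the one on `F_p`. -/
lemma ker_evalₐ_eq (n : ℕ) : RingHom.ker (AdicCompletion.evalₐ (maximalIdeal R) n) =
    (maximalIdeal R ^ n).map (algebraMap R 𝓡) := by
  have h := AdicCompletion.pow_smul_top_eq_ker_eval (I := maximalIdeal R) (M := R) (n := n)
    (maximalIdeal R).fg_of_isNoetherianRing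
  ext x
  rw [RingHom.mem_ker]
  have h1 : x ∈ (maximalIdeal R ^ n • ⊤ : Submodule R 𝓡) ↔
      x ∈ (maximalIdeal R ^ n).map (algebraMap R 𝓡) := by
    rw [Ideal.smul_top_eq_map]
    rfl
  rw [← h1, h, LinearMap.mem_ker]
  have e : (maximalIdeal R ^ n • ⊤ : Ideal R) ≤ maximalIdeal R ^ n := by simp
  have e' : maximalIdeal R ^ n ≤ (maximalIdeal R ^ n • ⊤ : Ideal R) := by simp
  constructor
  · intro hx
    have := AdicCompletion.factor_evalₐ_eq_eval (maximalIdeal R) x e'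
    rw [hx, map_zero] at this
    exact this.symm
  · intro hx
    have := AdicCompletion.factor_eval_eq_evalₐ (maximalIdeal R) x e
    rw [hx, map_zero] at this
    exact this.symm

lemma evalₐ_algebraMap (n : ℕ) (r : R) :
    AdicCompletion.evalₐ (maximalIdeal R) n (algebraMap R 𝓡 r) = Ideal.Quotient.mk _ r :=
  AlgHom.commutes _ r

lemma algebraMap_mem_map_pow_iff (n : ℕ) (r : R) :
    algebraMap R 𝓡 r ∈ (maximalIdeal R ^ n).map (algebraMap R 𝓡) ↔ r ∈ maximalIdeal R ^ n := by
  rw [← ker_evalₐ_eq, RingHom.mem_ker, evalₐ_algebraMap, Ideal.Quotient.eq_zero_iff_mem]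

lemma exists_sub_algebraMap_mem (n : ℕ) (y : 𝓡) :
    ∃ r : R, y - algebraMap R 𝓡 r ∈ (maximalIdeal R ^ n).map (algebraMap R 𝓡) := by
  obtain ⟨r, hr⟩ := Ideal.Quotient.mk_surjective (AdicCompletion.evalₐ (maximalIdeal R) n y)
  refine ⟨r, ?_⟩
  rw [← ker_evalₐ_eq, RingHom.mem_ker, map_sub, evalₐ_algebraMap, hr, sub_self]

lemma isOpen_completion_iff (S : Set 𝓡) : IsOpen S ↔
    ∀ x ∈ S, ∃ n : ℕ, ∀ y ∈ (maximalIdeal R ^ n).map (algebraMap R 𝓡), x + y ∈ S := by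
  let : ∀ n, TopologicalSpace (R ⧸ maximalIdeal R ^ n) := fun _ => ⊥
  have : ∀ n, DiscreteTopology (R ⧸ maximalIdeal R ^ n) := fun _ => ⟨rfl⟩
  have hO : ∀ (x : 𝓡) (n : ℕ), IsOpen {z : 𝓡 | AdicCompletion.evalₐ (maximalIdeal R) n z =
      AdicCompletion.evalₐ (maximalIdeal R) n x} := fun x n =>
    (isOpen_discrete {AdicCompletion.evalₐ (maximalIdeal R) n x}).preimage (continuous_evalₐ R n)
  constructor
  · rintro ⟨V, hV, rfl⟩ x hx
    obtain ⟨I, u, hu, huV⟩ := isOpen_pi_iff.mp hV _ hx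
    refine ⟨I.sup id, fun y hy => huV fun n hn => ?_⟩
    have h1 : y ∈ (maximalIdeal R ^ n).map (algebraMap R 𝓡) :=
      Ideal.map_mono (Ideal.pow_le_pow_right (Finset.le_sup (f := id) hn)) hy
    rw [← ker_evalₐ_eq, RingHom.mem_ker] at h1
    change AdicCompletion.evalₐ (maximalIdeal R) n (x + y) ∈ u n
    rw [map_add, h1, add_zero]
    exact (hu n hn).2
  · intro h
    rw [isOpen_iff_mem_nhds]
    intro x hx
    obtain ⟨n, hn⟩ := h x hx
    refine Filter.mem_of_superset ((hO x n).mem_nhds rfl) fun z hz => ?_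
    have := hn (z - x) (by
      rw [← ker_evalₐ_eq, RingHom.mem_ker, map_sub, sub_eq_zero]
      exact hz)
    rwa [add_sub_cancel] at this

variable [Finite (ResidueField R)]

lemma finite_quotient_pow (n : ℕ) : Finite (R ⧸ maximalIdeal R ^ n) := by
  have : Finite (R ⧸ maximalIdeal R) := inferInstanceAs (Finite (ResidueField R))
  exact Ideal.finite_quotient_pow (maximalIdeal R).fg_of_isNoetherianRing n

/-- The completion is the closed set of compatible sequences in a product of finite discrete rings.
-/
lemma compactSpace_completion : CompactSpace 𝓡 := by
  let : ∀ n, TopologicalSpace (R ⧸ maximalIdeal R ^ n) := fun _ => ⊥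
  have : ∀ n, DiscreteTopology (R ⧸ maximalIdeal R ^ n) := fun _ => ⟨rfl⟩
  have := finite_quotient_pow R
  have hind : Topology.IsInducing
      fun (x : 𝓡) n => AdicCompletion.evalₐ (maximalIdeal R) n x := ⟨rfl⟩
  refine ⟨hind.isCompact_iff.mpr ?_⟩
  rw [Set.image_univ]
  refine IsClosed.isCompact ?_
  have e : (Set.range fun (x : 𝓡) n => AdicCompletion.evalₐ (maximalIdeal R) n x) =
      ⋂ (m : ℕ) (n : ℕ) (h : m ≤ n),
        {f | Ideal.Quotient.factorPow (maximalIdeal R) h (f n) = f m} := by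
    ext f
    simp only [Set.mem_iInter]
    constructor
    · rintro ⟨x, rfl⟩ m n h
      induction x using AdicCompletion.induction_on with
      | h a =>
        have h1 := AdicCompletion.Ideal.mk_eq_mk (maximalIdeal R) h a
        simpa using h1
    · intro h
      choose r hr using fun n => Ideal.Quotient.mk_surjective (f n)
      have hr' : ∀ {m n : ℕ}, m ≤ n → r m ≡ r n [SMOD (maximalIdeal R ^ m • ⊤ : Ideal R)] := by
        intro m n hmn
        rw [SModEq.sub_mem]
        have h1 : Ideal.Quotient.factorPow (maximalIdeal R) hmn (f n) = f m := h m n hmn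
        rw [← hr m, ← hr n] at h1
        have h2 : Ideal.Quotient.mk (maximalIdeal R ^ m) (r n) =
          Ideal.Quotient.mk (maximalIdeal R ^ m) (r m) := h1
        have h3 := Ideal.Quotient.eq.mp h2.symm
        simpa using h3
      refine ⟨AdicCompletion.mk _ _ ⟨r, hr'⟩, ?_⟩
      ext n
      exact hr n
  rw [e]
  refine isClosed_iInter fun m => isClosed_iInter fun n => isClosed_iInter fun h => ?_
  exact isClosed_eq (continuous_of_discreteTopology.comp (continuous_apply n)) (continuous_apply m)

/-- Ideals extended from a Noetherian local ring are closed in the completion. -/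
lemma mem_map_algebraMap_of_forall_exists (I : Ideal R) (y : 𝓡)
    (h : ∀ n : ℕ, ∃ i ∈ I.map (algebraMap R 𝓡),
      y - i ∈ (maximalIdeal R ^ n).map (algebraMap R 𝓡)) : y ∈ I.map (algebraMap R 𝓡) := by
  have := isTopologicalRing_completion R
  have := t2Space_completion R
  have := compactSpace_completion R
  -- Because the residue field is finite, compactness suffices here: a finitely generated ideal is
  -- the continuous image of a power of a compact ring.
  have hclosed : IsClosed (I.map (algebraMap R 𝓡) : Set 𝓡) := by
    obtain ⟨S, rfl⟩ := I.fg_of_isNoetherianRing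
    have e : ((Ideal.span (S : Set R)).map (algebraMap R 𝓡) : Set 𝓡) =
        Set.range fun c : S → 𝓡 => ∑ e : S, c e * algebraMap R 𝓡 e := by
      ext x
      rw [SetLike.mem_coe, Ideal.map_span]
      have : (algebraMap R 𝓡 '' (S : Set R)) = Set.range fun e : S => algebraMap R 𝓡 e := by
        ext y
        simp
      rw [this]
      exact Submodule.mem_span_range_iff_exists_fun 𝓡
    rw [e]
    exact (isCompact_range (by fun_prop)).isClosed
  by_contra hy
  obtain ⟨n, hn⟩ := (isOpen_completion_iff R _).mp hclosed.isOpen_compl y hy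
  obtain ⟨i, hi, hyi⟩ := h n
  refine hn (i - y) ?_ ?_
  · rw [← neg_sub]
    exact neg_mem hyi
  · rwa [add_sub_cancel]

end Completion

/-! ### Completions of surjective local homomorphisms -/

section CompletionMap

open IsLocalRing

attribute [local instance] completionTopology

variable {R S : Type} [CommRing R] [IsLocalRing R] [IsNoetherianRing R]
  [CommRing S] [IsLocalRing S] [IsNoetherianRing S] [Finite (ResidueField R)]
  (φ : R →+* S)
  (h : maximalIdeal R ≤ (maximalIdeal S).comap φ)

lemma map_maximalIdeal_of_surjective (hφ : Function.Surjective φ) :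
     (maximalIdeal R).map φ = maximalIdeal S := by
  have : IsLocalHom φ := IsLocalHom.of_surjective φ hφ
  have e : (maximalIdeal S).comap φ = maximalIdeal R :=
    ((local_hom_TFAE φ).out 0 4).mp this
  rw [← e, Ideal.map_comap_of_surjective φ hφ]

lemma evalₐ_completionMap (n : ℕ) (x : AdicCompletion (maximalIdeal R) R) :
    AdicCompletion.evalₐ (maximalIdeal S) n (completionMap φ _ _ h x) =
      Ideal.quotientMap (maximalIdeal S ^ n) φ (completionMap_aux φ h n)
        (AdicCompletion.evalₐ (maximalIdeal R) n x) := by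
  rw [completionMap, AdicCompletion.evalₐ_liftRingHom (hf := completionMap_compat φ _ _ h)]
  rfl

/-- Approximate `y` by `r` modulo the `n`-th power. Then `φ r` lies in the `n`-th power of the
maximal ideal of `S`, which is the image of that of `R`, so `r` differs from an element of `ker φ`
by something equally small. Closedness of extended ideals concludes. -/
lemma ker_completionMap (hφ : Function.Surjective φ) : RingHom.ker (completionMap φ _ _ h) =
    (RingHom.ker φ).map (algebraMap R (AdicCompletion (maximalIdeal R) R)) := by
  apply le_antisymm
  · intro y hy
    refine mem_map_algebraMap_of_forall_exists R _ y fun n => ?_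
    obtain ⟨r, hr⟩ := exists_sub_algebraMap_mem R n y
    have h1 := evalₐ_completionMap φ h n y
    rw [RingHom.mem_ker.mp hy, map_zero] at h1
    rw [← ker_evalₐ_eq, RingHom.mem_ker, map_sub, evalₐ_algebraMap, sub_eq_zero] at hr
    rw [hr, Ideal.quotientMap_mk, eq_comm, Ideal.Quotient.eq_zero_iff_mem,
      ← map_maximalIdeal_of_surjective φ hφ, ← Ideal.map_pow,
      Ideal.mem_map_iff_of_surjective φ hφ] at h1
    obtain ⟨z, hz, hzr⟩ := h1
    refine ⟨algebraMap R _ (r - z), Ideal.mem_map_of_mem _ (by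
      rw [RingHom.mem_ker, map_sub, hzr, sub_self]), ?_⟩
    rw [← ker_evalₐ_eq, RingHom.mem_ker, map_sub, evalₐ_algebraMap, hr, map_sub, sub_sub_cancel,
      Ideal.Quotient.eq_zero_iff_mem]
    exact hz
  · rw [Ideal.map_le_iff_le_comap]
    intro r hr
    rw [Ideal.mem_comap, RingHom.mem_ker, completionMap_algebraMap, RingHom.mem_ker.mp hr, map_zero]

/-- The image is compact, hence closed, and it contains the dense image of `S`. -/
lemma completionMap_surjective (hφ : Function.Surjective φ) :
    Function.Surjective (completionMap φ _ _ h) := by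
  have := isTopologicalRing_completion R
  have := compactSpace_completion R
  have := t2Space_completion S
  have hcont : Continuous (completionMap φ _ _ h) := by
    refine continuous_induced_rng.mpr ?_
    let : ∀ n, TopologicalSpace (S ⧸ maximalIdeal S ^ n) := fun _ => ⊥
    refine continuous_pi fun n => ?_
    let : ∀ n, TopologicalSpace (R ⧸ maximalIdeal R ^ n) := fun _ => ⊥
    have : DiscreteTopology (R ⧸ maximalIdeal R ^ n) := ⟨rfl⟩
    simp only [Function.comp_def, evalₐ_completionMap]
    exact (continuous_of_discreteTopology (f := Ideal.quotientMap (maximalIdeal S ^ n) φ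
      (completionMap_aux φ h n))).comp (continuous_evalₐ R n)
  have hclosed : IsClosed (Set.range (completionMap φ _ _ h)) := (isCompact_range hcont).isClosed
  intro y
  by_contra hy
  obtain ⟨n, hn⟩ := (isOpen_completion_iff S _).mp hclosed.isOpen_compl y hy
  obtain ⟨s, hs⟩ := exists_sub_algebraMap_mem S n y
  obtain ⟨r, rfl⟩ := hφ s
  refine hn (algebraMap S _ (φ r) - y) ?_ ⟨algebraMap R _ r, ?_⟩
  · rw [← neg_sub]
    exact neg_mem hs
  · rw [add_sub_cancel, completionMap_algebraMap]

end CompletionMap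

/-! ## The local rings of a nilpotent extension of a curve -/

section LocalAlgebra

open IsLocalRing

/-- A Noetherian local ring of dimension at most `1` with finite residue field and irreducible
spectrum. -/
class IsCurveLocalRing (R : Type) [CommRing R] [IsLocalRing R] : Prop where
  isNoetherianRing : IsNoetherianRing R
  finite_residueField : Finite (ResidueField R)
  isPrime_nilradical : (nilradical R).IsPrime
  eq_nilradical_or_eq : ∀ q : Ideal R, q.IsPrime → q = nilradical R ∨ q = maximalIdeal R

attribute [instance] IsCurveLocalRing.isNoetherianRing IsCurveLocalRing.finite_residueField
  IsCurveLocalRing.isPrime_nilradical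

/-- A prime containing `s · m ^ k` contains the maximal ideal `m`: there are only two primes, and
the nilradical does not contain `s`. Thus division by `s` costs only a bounded amount of `m`-adic
precision. -/
lemma exists_pow_maximalIdeal_le {R : Type} [CommRing R] [IsLocalRing R] [IsCurveLocalRing R]
    {s : R} (hs : s ∉ nilradical R) (k : ℕ) :
    ∃ n, maximalIdeal R ^ n ≤ Ideal.span {s} * maximalIdeal R ^ k := by
  refine Ideal.exists_pow_le_of_le_radical_of_fg ?_ (maximalIdeal R).fg_of_isNoetherianRing
  rw [Ideal.radical_eq_sInf]
  refine le_sInf fun q ⟨hq, hqp⟩ => ?_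
  rcases IsCurveLocalRing.eq_nilradical_or_eq q hqp with rfl | rfl
  · rcases (Ideal.IsPrime.mul_le hqp).mp hq with h | h
    · exact absurd (h (Ideal.mem_span_singleton_self s)) hs
    · exact fun x hx => hqp.mem_of_pow_mem k (h (Ideal.pow_mem_pow hx k))
  · exact le_rfl

lemma exists_pow_map_maximalIdeal_le {R : Type} [CommRing R] [IsLocalRing R] [IsCurveLocalRing R]
    {s : R} (hs : s ∉ nilradical R) (k : ℕ) :
    ∃ n, k ≤ n ∧ ∀ y ∈ (maximalIdeal R ^ n).map
        (algebraMap R (AdicCompletion (maximalIdeal R) R)),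
      ∃ z ∈ (maximalIdeal R ^ k).map (algebraMap R (AdicCompletion (maximalIdeal R) R)),
        y = algebraMap R _ s * z := by
  obtain ⟨n, hn⟩ := exists_pow_maximalIdeal_le hs k
  refine ⟨max n k, le_max_right _ _, fun y hy => ?_⟩
  have h1 := Ideal.map_mono (f := algebraMap R (AdicCompletion (maximalIdeal R) R))
    ((Ideal.pow_le_pow_right (le_max_left n k)).trans hn) hy
  rw [Ideal.map_mul, Ideal.map_span, Set.image_singleton, Ideal.mem_span_singleton_mul] at h1
  obtain ⟨z, hz, rfl⟩ := h1
  exact ⟨z, hz, rfl⟩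

/-- If `s` kills `y` and `r` approximates `y` closely, then `s r` is small, so `s r = s r'` with
`r'` small. The difference `r - r'` is killed by `s`, lies in `I`, and still approximates `y`. -/
lemma mem_map_ker_of_mul_eq_zero {R : Type} [CommRing R] [IsLocalRing R] [IsCurveLocalRing R]
    {I : Ideal R} {s : R} (hs : s ∉ nilradical R) (hI : ∀ r, s * r = 0 → r ∈ I)
    {y : AdicCompletion (maximalIdeal R) R} (hy : algebraMap R _ s * y = 0) :
    y ∈ I.map (algebraMap R (AdicCompletion (maximalIdeal R) R)) := by
  refine mem_map_algebraMap_of_forall_exists R _ _ fun k => ?_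
  obtain ⟨n, hkn, hn⟩ := exists_pow_maximalIdeal_le hs k |>.imp fun n hn => hn |> fun h =>
    (⟨le_rfl, h⟩ : n ≤ n ∧ _)
  obtain ⟨r, hr⟩ := exists_sub_algebraMap_mem R (max n k) y
  have h1 : s * r ∈ maximalIdeal R ^ max n k := by
    rw [← algebraMap_mem_map_pow_iff, map_mul]
    have h2 := Ideal.mul_mem_left _ (algebraMap R _ s) hr
    rw [mul_sub, hy, zero_sub] at h2
    exact neg_mem_iff.mp h2
  have h3 := hn (Ideal.pow_le_pow_right (le_max_left n k) h1)
  obtain ⟨r', hr', e⟩ := Ideal.mem_span_singleton_mul.mp h3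
  refine ⟨algebraMap R _ (r - r'), Ideal.mem_map_of_mem _ (hI _ (by rw [mul_sub, e, sub_self])), ?_⟩
  have h4 := Ideal.map_mono (Ideal.pow_le_pow_right (le_max_right n k)) hr
  have h5 := (algebraMap_mem_map_pow_iff R k r').mpr hr'
  have h6 := add_mem h4 h5
  rw [map_sub]
  convert h6 using 1
  ring

variable {X : Scheme.{0}} [IsIntegral X]

/-- The local properties of nilpotent extensions of smooth proper curves over finite fields. -/
class NilpotentExtension.IsLocallyCurve (C : NilpotentExtension X) : Prop where
  isCurveLocalRing : ∀ p : ClosedPoint C, IsCurveLocalRing (LocalRing p)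
  isLocalization : ∀ p : ClosedPoint C,
    IsLocalization (nilradical (LocalRing p)).primeCompl (FunctionRing C)

attribute [instance] NilpotentExtension.IsLocallyCurve.isCurveLocalRing

variable {C : NilpotentExtension X} [C.IsLocallyCurve] (p : ClosedPoint C)

/-- Since `F` is a localization of the local ring, `F_p` is the same localization of the completed
local ring; its elements are fractions with denominators already in the uncompleted ring. -/
lemma isLocalizedModule_ofCompletedLocalRing :
    IsLocalizedModule (nilradical (LocalRing p)).primeCompl
      (TensorProduct.mk (LocalRing p) (FunctionRing C) (CompletedLocalRing p) 1) := by
  have := NilpotentExtension.IsLocallyCurve.isLocalization p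
  rw [isLocalizedModule_iff_isBaseChange _ (FunctionRing C)]
  exact TensorProduct.isBaseChange _ _ _

lemma exists_mul_eq_ofCompletedLocalRing (x : LocalFunctionRing p) :
    ∃ s : LocalRing p, s ∉ nilradical (LocalRing p) ∧ ∃ y,
      ofCompletedLocalRing p (algebraMap _ _ s) * x = ofCompletedLocalRing p y := by
  have := isLocalizedModule_ofCompletedLocalRing p
  obtain ⟨⟨y, s⟩, h⟩ := IsLocalizedModule.surj (nilradical (LocalRing p)).primeCompl
    (TensorProduct.mk (LocalRing p) (FunctionRing C) (CompletedLocalRing p) 1) x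
  refine ⟨s.1, s.2, y, ?_⟩
  refine Eq.trans ?_ h
  rw [← ofFunctionRing_algebraMap]
  exact (Algebra.smul_def (A := FunctionRing C ⊗[LocalRing p] CompletedLocalRing p) s.1 x).symm

lemma ofCompletedLocalRing_eq_zero_iff (y : CompletedLocalRing p) :
    ofCompletedLocalRing p y = 0 ↔
      ∃ s : LocalRing p, s ∉ nilradical (LocalRing p) ∧ algebraMap _ _ s * y = 0 := by
  have := isLocalizedModule_ofCompletedLocalRing p
  refine (IsLocalizedModule.eq_zero_iff (nilradical (LocalRing p)).primeCompl
    (TensorProduct.mk (LocalRing p) (FunctionRing C) (CompletedLocalRing p) 1)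
    (m := y)).trans ⟨?_, ?_⟩
  · rintro ⟨s, h⟩
    exact ⟨s.1, s.2, (Algebra.smul_def s.1 y).symm.trans h⟩
  · rintro ⟨s, hs, h⟩
    exact ⟨⟨s, hs⟩, (Algebra.smul_def s y).trans h⟩

lemma isUnit_algebraMap_functionRing {s : LocalRing p} (hs : s ∉ nilradical (LocalRing p)) :
    IsUnit (algebraMap (LocalRing p) (FunctionRing C) s) := by
  have := NilpotentExtension.IsLocallyCurve.isLocalization p
  exact IsLocalization.map_units (M := (nilradical (LocalRing p)).primeCompl) _ ⟨s, hs⟩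

lemma exists_mul_eq_algebraMap (f : FunctionRing C) : ∃ s : LocalRing p,
    s ∉ nilradical (LocalRing p) ∧ ∃ r, algebraMap _ _ s * f = algebraMap (LocalRing p) _ r := by
  have := NilpotentExtension.IsLocallyCurve.isLocalization p
  obtain ⟨⟨r, s⟩, h⟩ := IsLocalization.surj (nilradical (LocalRing p)).primeCompl f
  exact ⟨s.1, s.2, r, by rw [mul_comm]; exact h⟩

lemma algebraMap_functionRing_eq_zero_iff (r : LocalRing p) :
    algebraMap (LocalRing p) (FunctionRing C) r = 0 ↔
      ∃ s : LocalRing p, s ∉ nilradical (LocalRing p) ∧ s * r = 0 := by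
  have := NilpotentExtension.IsLocallyCurve.isLocalization p
  rw [IsLocalization.map_eq_zero_iff (nilradical (LocalRing p)).primeCompl]
  exact ⟨fun ⟨s, h⟩ => ⟨s.1, s.2, h⟩, fun ⟨s, hs, h⟩ => ⟨⟨s, hs⟩, h⟩⟩

/-- Density of `F` in `F_p`: clear the denominator `s` and approximate the numerator so well that
the error is still small after division by `s`. -/
lemma exists_sub_ofFunctionRing_mem (n : ℕ) (x : LocalFunctionRing p) :
    ∃ f, ∃ y ∈ (maximalIdeal (LocalRing p) ^ n).map
      (algebraMap (LocalRing p) (CompletedLocalRing p)),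
      x = ofFunctionRing p f + ofCompletedLocalRing p y := by
  obtain ⟨s, hs, y, hy⟩ := exists_mul_eq_ofCompletedLocalRing p x
  obtain ⟨N, -, hN⟩ := exists_pow_map_maximalIdeal_le hs n
  obtain ⟨r, hr⟩ := exists_sub_algebraMap_mem _ N y
  obtain ⟨z, hz, e⟩ := hN _ hr
  have hu := isUnit_algebraMap_functionRing p hs
  obtain ⟨t, ht⟩ := hu.exists_right_inv
  refine ⟨t * algebraMap _ _ r, z, hz, ?_⟩
  have hu' := hu.map (ofFunctionRing p)
  refine hu'.mul_left_cancel ?_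
  rw [mul_add, ← map_mul, ← mul_assoc, ht, one_mul, ofFunctionRing_algebraMap, hy,
    ofFunctionRing_algebraMap, ← map_mul, ← map_add, ← e]
  congr 1
  ring

/-- Clearing denominators, the claim becomes that `t r`, divisible by `t s` in the completion, is
divisible by it in the local ring. It lies in the ideal of `t s` up to every power of the maximal
ideal, so Krull's intersection theorem in the quotient applies. -/
lemma exists_eq_algebraMap_of_mem_integerRing {f : FunctionRing C}
    (hf : ofFunctionRing p f ∈ integerRing p) : ∃ r, f = algebraMap (LocalRing p) _ r := by
  obtain ⟨y, hy⟩ := hf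
  obtain ⟨s, hs, r, hr⟩ := exists_mul_eq_algebraMap p f
  have h1 : ofCompletedLocalRing p (algebraMap _ _ r - algebraMap _ _ s * y) = 0 := by
    rw [map_sub, map_mul, hy, ← ofFunctionRing_algebraMap, ← ofFunctionRing_algebraMap, ← map_mul,
      hr, sub_self]
  obtain ⟨t, ht, e⟩ := (ofCompletedLocalRing_eq_zero_iff p _).mp h1
  have hts : t * s ∉ nilradical (LocalRing p) := fun h =>
    (Ideal.IsPrime.mem_or_mem inferInstance h).elim ht hs
  have key : t * r ∈ Ideal.span {t * s} := by
    have hcl : IsHausdorff (maximalIdeal (LocalRing p)) (LocalRing p ⧸ Ideal.span {t * s}) :=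
      IsHausdorff.of_isLocalRing _ _ (Ideal.IsPrime.ne_top inferInstance)
    rw [← Ideal.Quotient.eq_zero_iff_mem]
    refine hcl.haus _ fun n => ?_
    obtain ⟨a, ha⟩ := exists_sub_algebraMap_mem _ n y
    have h2 : t * r - t * s * a ∈ maximalIdeal (LocalRing p) ^ n := by
      rw [← algebraMap_mem_map_pow_iff]
      have h3 := Ideal.mul_mem_left _ (algebraMap _ (CompletedLocalRing p) (t * s)) ha
      convert h3 using 1
      rw [mul_sub, sub_eq_zero] at e
      rw [map_sub, map_mul, e, map_mul, map_mul]
      ring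
    rw [SModEq.zero]
    have h4 : (Ideal.Quotient.mk (Ideal.span {t * s}) (t * r)) =
      (t * r - t * s * a) • (1 : LocalRing p ⧸ Ideal.span {t * s}) := by
      rw [Algebra.smul_def, mul_one]
      refine Ideal.Quotient.eq.mpr ?_
      rw [sub_sub_cancel]
      exact Ideal.mul_mem_right _ _ (Ideal.mem_span_singleton_self _)
    rw [h4]
    exact Submodule.smul_mem_smul h2 trivial
  obtain ⟨b, hb⟩ := Ideal.mem_span_singleton.mp key
  refine ⟨b, (isUnit_algebraMap_functionRing p hts).mul_left_cancel ?_⟩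
  rw [← map_mul, ← hb, map_mul, map_mul, mul_assoc, hr]

lemma exists_mul_ofCompletedLocalRing_eq (x : LocalFunctionRing p) (n : ℕ) :
    ∃ N, ∀ y ∈ (maximalIdeal (LocalRing p) ^ N).map
        (algebraMap (LocalRing p) (CompletedLocalRing p)),
      ∃ z ∈ (maximalIdeal (LocalRing p) ^ n).map
        (algebraMap (LocalRing p) (CompletedLocalRing p)),
        x * ofCompletedLocalRing p y = ofCompletedLocalRing p z := by
  obtain ⟨s, hs, a, ha⟩ := exists_mul_eq_ofCompletedLocalRing p x
  obtain ⟨N, -, hN⟩ := exists_pow_map_maximalIdeal_le hs n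
  refine ⟨N, fun y hy => ?_⟩
  obtain ⟨z, hz, rfl⟩ := hN y hy
  refine ⟨a * z, Ideal.mul_mem_left _ _ hz, ?_⟩
  rw [map_mul, map_mul, ← ha]
  ring

lemma ofCompletedLocalRing_eq_zero_iff_mem (y : CompletedLocalRing p) :
    ofCompletedLocalRing p y = 0 ↔
      y ∈ (RingHom.ker (algebraMap (LocalRing p) (FunctionRing C))).map
        (algebraMap (LocalRing p) (CompletedLocalRing p)) := by
  constructor
  · intro h
    obtain ⟨s, hs, e⟩ := (ofCompletedLocalRing_eq_zero_iff p y).mp h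
    exact mem_map_ker_of_mul_eq_zero hs
      (fun r hr => (algebraMap_functionRing_eq_zero_iff p r).mpr ⟨s, hs, hr⟩) e
  · have h : (RingHom.ker (algebraMap (LocalRing p) (FunctionRing C))).map
        (algebraMap (LocalRing p) (CompletedLocalRing p)) ≤
        RingHom.ker (ofCompletedLocalRing p) := by
      rw [Ideal.map_le_iff_le_comap]
      intro r hr
      rw [Ideal.mem_comap, RingHom.mem_ker, ← ofFunctionRing_algebraMap, RingHom.mem_ker.mp hr,
        map_zero]
    exact fun hy => h hy

/-- The kernel of the map from the completed local ring to `F_p` is an extended ideal, hence closed.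
This makes `F_p` Hausdorff even at an embedded point, where the map is not injective. -/
lemma ofCompletedLocalRing_eq_zero_of_forall {y : CompletedLocalRing p}
    (h : ∀ n, ∃ z ∈ (maximalIdeal (LocalRing p) ^ n).map
        (algebraMap (LocalRing p) (CompletedLocalRing p)),
      ofCompletedLocalRing p y = ofCompletedLocalRing p z) : ofCompletedLocalRing p y = 0 := by
  rw [ofCompletedLocalRing_eq_zero_iff_mem]
  refine mem_map_algebraMap_of_forall_exists _ _ _ fun n => ?_
  obtain ⟨z, hz, e⟩ := h n
  refine ⟨y - z, ?_, by rwa [sub_sub_cancel]⟩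
  rw [← ofCompletedLocalRing_eq_zero_iff_mem, map_sub, e, sub_self]

end LocalAlgebra

/-! ### The topological ring `F_p` -/

section LocalTopology

open IsLocalRing
open scoped Topology

variable {X : Scheme.{0}} [IsIntegral X] {C : NilpotentExtension X} [C.IsLocallyCurve]
  (p : ClosedPoint C)

/-- The neighbourhood of zero in `F_p` defined by a power of the maximal ideal. -/
def basicNeighborhood (n : ℕ) : AddSubgroup (LocalFunctionRing p) :=
  (Submodule.toAddSubgroup ((maximalIdeal (LocalRing p) ^ n).map
    (algebraMap (LocalRing p) (CompletedLocalRing p)))).map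
      (ofCompletedLocalRing p).toAddMonoidHom

lemma mem_basicNeighborhood {n : ℕ} {x : LocalFunctionRing p} :
    x ∈ basicNeighborhood p n ↔ ∃ y ∈ (maximalIdeal (LocalRing p) ^ n).map
      (algebraMap (LocalRing p) (CompletedLocalRing p)), ofCompletedLocalRing p y = x := Iff.rfl

lemma basicNeighborhood_anti {m n : ℕ} (h : m ≤ n) :
    basicNeighborhood p n ≤ basicNeighborhood p m := by
  rintro _ ⟨y, hy, rfl⟩
  exact ⟨y, Ideal.map_mono (Ideal.pow_le_pow_right h) hy, rfl⟩

lemma basicNeighborhood_zero : (basicNeighborhood p 0 : Set (LocalFunctionRing p)) =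
    integerRing p := by
  ext x
  rw [SetLike.mem_coe, mem_basicNeighborhood]
  rw [pow_zero, Ideal.one_eq_top, Ideal.map_top]
  exact ⟨fun ⟨y, _, h⟩ => ⟨y, h⟩, fun ⟨y, h⟩ => ⟨y, trivial, h⟩⟩

lemma isOpen_localFunctionRing_iff {S : Set (LocalFunctionRing p)} : IsOpen S ↔
    ∀ x ∈ S, ∃ n, ∀ y ∈ basicNeighborhood p n, x + y ∈ S := by
  refine forall₂_congr fun x _ => exists_congr fun n => ⟨?_, ?_⟩
  · rintro h _ ⟨y, hy, rfl⟩
    exact h y hy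
  · intro h y hy
    exact h _ ⟨y, hy, rfl⟩

lemma isOpen_coset (x : LocalFunctionRing p) (n : ℕ) :
    IsOpen {z : LocalFunctionRing p | z - x ∈ basicNeighborhood p n} := by
  rw [isOpen_localFunctionRing_iff]
  refine fun z hz => ⟨n, fun y hy => ?_⟩
  change z + y - x ∈ basicNeighborhood p n
  rw [add_sub_right_comm]
  exact add_mem hz hy

lemma mem_nhds_localFunctionRing_iff {x : LocalFunctionRing p} {S : Set (LocalFunctionRing p)} :
    S ∈ 𝓝 x ↔ ∃ n, ∀ z, z - x ∈ basicNeighborhood p n → z ∈ S := by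
  constructor
  · intro h
    obtain ⟨V, hVS, hV, hx⟩ := mem_nhds_iff.mp h
    obtain ⟨n, hn⟩ := (isOpen_localFunctionRing_iff p).mp hV x hx
    refine ⟨n, fun z hz => hVS ?_⟩
    have := hn _ hz
    rwa [add_sub_cancel] at this
  · rintro ⟨n, hn⟩
    refine Filter.mem_of_superset ((isOpen_coset p x n).mem_nhds ?_) hn
    simp [zero_mem]

lemma mul_mem_basicNeighborhood {n : ℕ} {x y : LocalFunctionRing p}
    (hx : x ∈ basicNeighborhood p n) (hy : y ∈ integerRing p) : x * y ∈ basicNeighborhood p n := by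
  obtain ⟨a, ha, rfl⟩ := hx
  obtain ⟨b, rfl⟩ := hy
  exact ⟨a * b, Ideal.mul_mem_right _ _ ha, map_mul (ofCompletedLocalRing p) _ _⟩

lemma exists_mul_mem_basicNeighborhood (x : LocalFunctionRing p) (n : ℕ) :
    ∃ N, ∀ y ∈ basicNeighborhood p N, x * y ∈ basicNeighborhood p n := by
  obtain ⟨N, hN⟩ := exists_mul_ofCompletedLocalRing_eq p x n
  refine ⟨N, ?_⟩
  rintro _ ⟨y, hy, rfl⟩
  obtain ⟨z, hz, e⟩ := hN y hy
  exact ⟨z, hz, e.symm⟩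

lemma basicNeighborhood_le_integerRing {n : ℕ} {x : LocalFunctionRing p}
    (hx : x ∈ basicNeighborhood p n) : x ∈ integerRing p := by
  obtain ⟨y, -, rfl⟩ := hx
  exact ⟨y, rfl⟩

instance isTopologicalRing_localFunctionRing : IsTopologicalRing (LocalFunctionRing p) where
  continuous_add := by
    rw [continuous_iff_continuousAt]
    rintro ⟨x, y⟩ S hS
    obtain ⟨n, hn⟩ := (mem_nhds_localFunctionRing_iff p).mp hS
    rw [Filter.mem_map, nhds_prod_eq, Filter.mem_prod_iff]
    refine ⟨_, (mem_nhds_localFunctionRing_iff p).mpr ⟨n, fun _ => id⟩,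
      _, (mem_nhds_localFunctionRing_iff p).mpr ⟨n, fun _ => id⟩, ?_⟩
    rintro ⟨x', y'⟩ ⟨hx, hy⟩
    refine hn _ ?_
    convert add_mem hx hy using 1
    simp only
    ring
  continuous_neg := by
    rw [continuous_iff_continuousAt]
    intro x S hS
    obtain ⟨n, hn⟩ := (mem_nhds_localFunctionRing_iff p).mp hS
    refine (mem_nhds_localFunctionRing_iff p).mpr ⟨n, fun z hz => hn _ ?_⟩
    convert neg_mem hz using 1
    ring
  continuous_mul := by
    rw [continuous_iff_continuousAt]
    rintro ⟨x, y⟩ S hS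
    obtain ⟨n, hn⟩ := (mem_nhds_localFunctionRing_iff p).mp hS
    obtain ⟨a, ha⟩ := exists_mul_mem_basicNeighborhood p x n
    obtain ⟨b, hb⟩ := exists_mul_mem_basicNeighborhood p y n
    rw [Filter.mem_map, nhds_prod_eq, Filter.mem_prod_iff]
    refine ⟨_, (mem_nhds_localFunctionRing_iff p).mpr ⟨max b n, fun _ => id⟩,
      _, (mem_nhds_localFunctionRing_iff p).mpr ⟨a, fun _ => id⟩, ?_⟩
    rintro ⟨x', y'⟩ ⟨hx, hy⟩
    refine hn _ ?_
    -- The difference `x' y' - x y` is split as `(x' - x) y + x (y' - y) + (x' - x)(y' - y)`.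
    have h1 := hb _ (basicNeighborhood_anti p (le_max_left b n) hx)
    have h2 := ha _ hy
    have h3 := mul_mem_basicNeighborhood p (basicNeighborhood_anti p (le_max_right b n) hx)
      (basicNeighborhood_le_integerRing p hy)
    convert add_mem (add_mem h1 h2) h3 using 1
    simp only
    ring

instance t2Space_localFunctionRing : T2Space (LocalFunctionRing p) := by
  have : T1Space (LocalFunctionRing p) := by
    refine IsTopologicalAddGroup.t1Space _ ?_
    rw [← isOpen_compl_iff, isOpen_localFunctionRing_iff]
    intro x hx
    by_contra! h
    have hx' : ∀ n, x ∈ basicNeighborhood p n := by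
      intro n
      obtain ⟨y, hy, e⟩ := h n
      have e' : x + y = 0 := by simpa using e
      rw [eq_neg_of_add_eq_zero_left e']
      exact neg_mem hy
    obtain ⟨y, -, rfl⟩ := hx' 0
    refine hx (ofCompletedLocalRing_eq_zero_of_forall p fun n => ?_)
    obtain ⟨z, hz, e⟩ := hx' n
    exact ⟨z, hz, e.symm⟩
  infer_instance

lemma isOpen_integerRing : IsOpen (integerRing p : Set (LocalFunctionRing p)) := by
  rw [← basicNeighborhood_zero]
  have := isOpen_coset p 0 0
  simpa using this

lemma isCompact_integerRing : IsCompact (integerRing p : Set (LocalFunctionRing p)) := by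
  let := completionTopology (LocalRing p)
  have := compactSpace_completion (LocalRing p)
  have hc : Continuous (ofCompletedLocalRing p) := by
    refine continuous_def.mpr fun S hS => ?_
    rw [isOpen_completion_iff]
    intro x hx
    obtain ⟨n, hn⟩ := hS _ hx
    exact ⟨n, fun y hy => by
      rw [Set.mem_preimage, map_add]
      exact hn y hy⟩
  exact isCompact_range hc

instance secondCountableTopology_localFunctionRing [Countable (FunctionRing C)] :
    SecondCountableTopology (LocalFunctionRing p) := by
  let b : Set (Set (LocalFunctionRing p)) := Set.range fun a : FunctionRing C × ℕ =>
    {z | z - ofFunctionRing p a.1 ∈ basicNeighborhood p a.2}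
  have hb : TopologicalSpace.IsTopologicalBasis b := by
    refine TopologicalSpace.isTopologicalBasis_of_isOpen_of_nhds ?_ ?_
    · rintro _ ⟨a, rfl⟩
      exact isOpen_coset p _ _
    · intro x S hx hS
      obtain ⟨n, hn⟩ := (mem_nhds_localFunctionRing_iff p).mp (hS.mem_nhds hx)
      obtain ⟨f, y, hy, e⟩ := exists_sub_ofFunctionRing_mem p n x
      have h1 : x - ofFunctionRing p f ∈ basicNeighborhood p n := ⟨y, hy, by rw [e]; simp⟩
      refine ⟨_, ⟨(f, n), rfl⟩, h1, fun z hz => hn z ?_⟩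
      have := sub_mem hz h1
      simpa using this
  exact hb.secondCountableTopology (Set.countable_range _)

end LocalTopology

/-! ## Smooth curves over finite fields are regular -/

section SmoothRegular

open IsLocalRing

/-- The field `k` is perfect, so `m / m²` embeds into the fibre of the Kähler differentials at `m`,
which has dimension one. Hence one element generates `m` modulo `m²`. -/
lemma exists_le_span_singleton_sup_sq {k A : Type} [Field k] [Finite k] [CommRing A] [Nontrivial A]
    [Algebra k A] [Algebra.IsStandardSmoothOfRelativeDimension 1 k A] (m : Ideal A)
    [hm : m.IsMaximal] : ∃ t ∈ m, m ≤ Ideal.span {t} ⊔ m ^ 2 := by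
  have := Algebra.IsStandardSmoothOfRelativeDimension.isStandardSmooth 1 (R := k) (S := A)
  let := Ideal.Quotient.field m
  have hker : RingHom.ker (algebraMap A (A ⧸ m)) = m := Ideal.mk_ker
  have hinj := (Algebra.FormallySmooth.kerCotangentToTensor_injective_iff (R := k) (P := A)
    (A := A ⧸ m) Ideal.Quotient.mk_surjective).mpr inferInstance
  have hrank : Module.finrank (A ⧸ m) ((A ⧸ m) ⊗[A] Ω[A⁄k]) = 1 := by
    have h1 := Algebra.IsStandardSmoothOfRelativeDimension.rank_kaehlerDifferential
      (R := k) (S := A) 1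
    rw [Module.finrank_baseChange, Module.finrank, h1]
    simp
  have hmem : ∀ x : A, x ∈ m → x ∈ RingHom.ker (algebraMap A (A ⧸ m)) := fun x hx => by rwa [hker]
  let v : m → (A ⧸ m) ⊗[A] Ω[A⁄k] := fun x =>
    KaehlerDifferential.kerCotangentToTensor k A (A ⧸ m) (Ideal.toCotangent _ ⟨x, hmem x x.2⟩)
  have hv : ∀ x : m, v x = 0 → (x : A) ∈ m ^ 2 := by
    intro x hx
    have h1 : Ideal.toCotangent _ ⟨x.1, hmem x x.2⟩ = 0 := hinj (hx.trans (map_zero _).symm)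
    have h2 : (x : A) ∈ RingHom.ker (algebraMap A (A ⧸ m)) ^ 2 :=
      (Ideal.toCotangent_eq_zero _ _).mp h1
    rwa [hker] at h2
  by_cases h0 : ∀ x : m, v x = 0
  · exact ⟨0, zero_mem _, fun x hx => Submodule.mem_sup_right (hv ⟨x, hx⟩ (h0 _))⟩
  · push Not at h0
    obtain ⟨t, ht⟩ := h0
    refine ⟨t, t.2, fun x hx => ?_⟩
    obtain ⟨c, hc⟩ := (finrank_eq_one_iff_of_nonzero' (v t) ht).mp hrank (v ⟨x, hx⟩)
    obtain ⟨a, rfl⟩ := Ideal.Quotient.mk_surjective c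
    have h1 : v (⟨x, hx⟩ - a • t) = 0 := by
      have h2 : v (⟨x, hx⟩ - a • t) = v ⟨x, hx⟩ - a • v t := by
        simp only [v]
        rw [← map_smul, ← map_sub, ← map_smul, ← map_sub]
        rfl
      rw [h2, ← hc, sub_eq_zero]
      exact (algebraMap_smul (A ⧸ m) a (v t))
    have h2 : x - a * t ∈ m ^ 2 := hv _ h1
    rw [show x = a * t + (x - a * t) by ring]
    exact add_mem (Submodule.mem_sup_left (Ideal.mul_mem_left _ _ (Ideal.mem_span_singleton_self _)))
      (Submodule.mem_sup_right h2)

/-- A field of finite type over `k` is finite and separable over `k`, so its differentials vanish;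
here they have rank one. -/
lemma not_isField_of_isStandardSmooth {k A : Type} [Field k] [Finite k] [CommRing A]
    [Algebra k A] [Algebra.IsStandardSmoothOfRelativeDimension 1 k A] : ¬ IsField A := by
  intro h
  let := h.toField
  have := Algebra.IsStandardSmoothOfRelativeDimension.isStandardSmooth 1 (R := k) (S := A)
  have : Module.Finite k A := finite_of_finite_type_of_isJacobsonRing k A
  have : Algebra.IsSeparable k A := inferInstance
  have := Algebra.FormallyUnramified.of_isSeparable k A
  have h2 : Subsingleton Ω[A⁄k] := Algebra.FormallyUnramified.subsingleton_kaehlerDifferential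
  have h1 := Algebra.IsStandardSmoothOfRelativeDimension.rank_kaehlerDifferential
      (R := k) (S := A) 1
  rw [rank_subsingleton'] at h1
  simp at h1

/-- By Nakayama, a generator of `m` modulo `m²` generates the maximal ideal of the localization. The
base carries only a proof of `IsField` because it will be the ring of global sections of `Spec k`.
-/
lemma isDiscreteValuationRing_of_isStandardSmooth {k A : Type} [CommRing k] (hk : IsField k)
    [Finite k] [CommRing A] [IsDomain A]
    [Algebra k A] [Algebra.IsStandardSmoothOfRelativeDimension 1 k A] (m : Ideal A)
    [m.IsMaximal] (R : Type) [CommRing R] [IsDomain R] [Algebra A R] [IsLocalization.AtPrime R m] :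
    IsDiscreteValuationRing R := by
  let := hk.toField
  have := Algebra.IsStandardSmoothOfRelativeDimension.isStandardSmooth 1 (R := k) (S := A)
  have : IsNoetherianRing A := Algebra.FiniteType.isNoetherianRing k A
  have : IsNoetherianRing R := IsLocalization.isNoetherianRing m.primeCompl R inferInstance
  have : IsLocalRing R := IsLocalization.AtPrime.isLocalRing R m
  have hmap : m.map (algebraMap A R) = maximalIdeal R :=
    IsLocalization.AtPrime.map_eq_maximalIdeal m R
  have hinj : Function.Injective (algebraMap A R) :=
    IsLocalization.injective R m.primeCompl_le_nonZeroDivisors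
  have hR : ¬ IsField R := by
    intro h
    rw [isField_iff_maximalIdeal_eq, ← hmap, Ideal.map_eq_bot_iff_of_injective hinj] at h
    subst h
    exact not_isField_of_isStandardSmooth (k := k) (A := A)
      (Ring.isField_iff_maximal_bot.mpr inferInstance)
  refine ((IsDiscreteValuationRing.TFAE R hR).out 0 4).mpr ?_
  obtain ⟨t, htm, ht⟩ := exists_le_span_singleton_sup_sq (k := k) m
  refine ⟨algebraMap A R t, le_antisymm ?_ ?_⟩
  · refine Submodule.le_of_le_smul_of_le_jacobson_bot (I := maximalIdeal R)
      (maximalIdeal R).fg_of_isNoetherianRing (maximalIdeal_le_jacobson _) ?_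
    have h1 := Ideal.map_mono (f := algebraMap A R) ht
    rw [Ideal.map_sup, Ideal.map_pow, hmap, Ideal.map_span, Set.image_singleton, pow_two] at h1
    exact h1
  · rw [Submodule.span_singleton_le_iff_mem, ← hmap]
    exact Ideal.mem_map_of_mem _ htm

end SmoothRegular

/-! ## Stalks of irreducible Noetherian schemes -/

section IrreducibleScheme

variable {Y : Scheme.{0}}

lemma exists_isAffineOpen_subset {x : Y} {U : Y.Opens} (hx : x ∈ U) :
    ∃ V : Y.Opens, IsAffineOpen V ∧ x ∈ V ∧ V ≤ U := by
  obtain ⟨_, ⟨A, hA, rfl⟩, hxA, hAU⟩ := Y.isBasis_affineOpens.exists_subset_of_mem_open hx U.isOpen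
  exact ⟨A, hA, hxA, hAU⟩

/-- The germ of a section. -/
def germHom {U : Y.Opens} {x : Y} (hx : x ∈ U) : Γ(Y, U) →+* Y.presheaf.stalk x :=
  (Y.presheaf.germ U x hx).hom

lemma exists_germHom_mul_eq {U : Y.Opens} (hU : IsAffineOpen U) {x : Y} (hx : x ∈ U)
    (r : Y.presheaf.stalk x) :
    ∃ a s : Γ(Y, U), IsUnit (germHom hx s) ∧ germHom hx s * r = germHom hx a := by
  let := Y.presheaf.algebra_section_stalk ⟨x, hx⟩
  have := hU.isLocalization_stalk ⟨x, hx⟩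
  obtain ⟨⟨a, s⟩, h⟩ := IsLocalization.surj (hU.primeIdealOf ⟨x, hx⟩).asIdeal.primeCompl r
  exact ⟨a, s, IsLocalization.map_units _ s, (mul_comm _ _).trans h⟩

lemma exists_mul_eq_zero_of_germHom_eq_zero {U : Y.Opens} (hU : IsAffineOpen U) {x : Y}
    (hx : x ∈ U) {a : Γ(Y, U)} (h : germHom hx a = 0) :
    ∃ s : Γ(Y, U), IsUnit (germHom hx s) ∧ s * a = 0 := by
  let := Y.presheaf.algebra_section_stalk ⟨x, hx⟩
  have := hU.isLocalization_stalk ⟨x, hx⟩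
  obtain ⟨s, hs⟩ := (IsLocalization.map_eq_zero_iff
    (hU.primeIdealOf ⟨x, hx⟩).asIdeal.primeCompl (Y.presheaf.stalk x) a).mp h
  exact ⟨s, IsLocalization.map_units _ s, hs⟩

lemma isUnit_germHom_iff {U : Y.Opens} {x : Y} (hx : x ∈ U) (a : Γ(Y, U)) :
    IsUnit (germHom hx a) ↔ x ∈ Y.basicOpen a :=
  (Y.mem_basicOpen a x hx).symm

variable [IrreducibleSpace Y]

lemma genericPoint_mem {U : Y.Opens} {x : Y} (hx : x ∈ U) : genericPoint Y ∈ U :=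
  ((genericPoint_spec Y).mem_open_set_iff U.isOpen).mpr ⟨x, trivial, hx⟩

lemma algebraMap_germHom {U : Y.Opens} {x : Y} (hx : x ∈ U) (a : Γ(Y, U)) :
    algebraMap (Y.presheaf.stalk x) Y.functionField (germHom hx a) =
      germHom (genericPoint_mem hx) a :=
  TopCat.Presheaf.germ_stalkSpecializes_apply Y.presheaf hx _ a

/-- A nonempty open set contains the generic point. If the section is not invertible there, its
basic open set is empty and the section is nilpotent. -/
lemma isUnit_or_isNilpotent {U : Y.Opens} (hU : IsAffineOpen U) (hη : genericPoint Y ∈ U)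
    (a : Γ(Y, U)) : IsUnit (germHom hη a) ∨ IsNilpotent a := by
  rw [isUnit_germHom_iff, Scheme.isNilpotent_iff_basicOpen_eq_bot_of_isCompact hU.isCompact]
  by_cases h : genericPoint Y ∈ Y.basicOpen a
  · exact Or.inl h
  · refine Or.inr (le_bot_iff.mp fun x hx => (h (genericPoint_mem hx)).elim)

lemma isUnit_or_isNilpotent_functionField (f : Y.functionField) : IsUnit f ∨ IsNilpotent f := by
  obtain ⟨U, hU, hη, -⟩ := exists_isAffineOpen_subset (Y := Y) (x := genericPoint Y) (U := ⊤) trivial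
  obtain ⟨a, s, hs, e⟩ := exists_germHom_mul_eq hU hη f
  rcases isUnit_or_isNilpotent hU hη a with h | h
  · exact Or.inl (isUnit_of_mul_isUnit_right (e ▸ h))
  · right
    have h1 := h.map (germHom hη)
    rw [← e] at h1
    obtain ⟨t, ht⟩ := hs.exists_left_inv
    have := (Commute.all t _).isNilpotent_mul_left h1
    rwa [← mul_assoc, ht, one_mul] at this

lemma isUnit_algebraMap_functionField_iff {x : Y} (r : Y.presheaf.stalk x) :
    IsUnit (algebraMap (Y.presheaf.stalk x) Y.functionField r) ↔ ¬ IsNilpotent r := by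
  constructor
  · intro h h'
    have h1 := h'.map (algebraMap (Y.presheaf.stalk x) Y.functionField)
    have : Nontrivial Y.functionField := inferInstanceAs (Nontrivial (Y.presheaf.stalk _))
    exact h1.not_isUnit h
  · intro h
    obtain ⟨U, hU, hx, -⟩ := exists_isAffineOpen_subset (Y := Y) (x := x) (U := ⊤) trivial
    obtain ⟨a, s, hs, e⟩ := exists_germHom_mul_eq hU hx r
    rcases isUnit_or_isNilpotent hU (genericPoint_mem hx) a with h1 | h1
    · have h2 := congrArg (algebraMap (Y.presheaf.stalk x) Y.functionField) e
      rw [map_mul, algebraMap_germHom hx a] at h2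
      exact isUnit_of_mul_isUnit_right (h2 ▸ h1)
    · refine (h ?_).elim
      have h1 := h1.map (germHom hx)
      rw [← e] at h1
      obtain ⟨t, ht⟩ := hs.exists_left_inv
      have := (Commute.all t _).isNilpotent_mul_left h1
      rwa [← mul_assoc, ht, one_mul] at this

/-- The germs that are not nilpotent are exactly those that become units at the generic point, and
these are closed under products. -/
lemma isPrime_nilradical_stalk (x : Y) : (nilradical (Y.presheaf.stalk x)).IsPrime where
  ne_top' := by
    rw [Ideal.ne_top_iff_one, mem_nilradical]
    exact not_isNilpotent_one
  mem_or_mem' {r s} h := by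
    by_contra! h'
    simp only [mem_nilradical] at h h'
    rw [← isUnit_algebraMap_functionField_iff, ← isUnit_algebraMap_functionField_iff] at h'
    have := h'.1.mul h'.2
    rw [← map_mul, isUnit_algebraMap_functionField_iff] at this
    exact this h

lemma isLocalization_functionField (x : Y) [(nilradical (Y.presheaf.stalk x)).IsPrime] :
    IsLocalization (nilradical (Y.presheaf.stalk x)).primeCompl Y.functionField := by
  obtain ⟨U, hU, hx, -⟩ := exists_isAffineOpen_subset (Y := Y) (x := x) (U := ⊤) trivial
  have key : ∀ s : Γ(Y, U), IsUnit (germHom (genericPoint_mem hx) s) →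
      germHom hx s ∈ (nilradical (Y.presheaf.stalk x)).primeCompl := fun s hs => by
    rw [← algebraMap_germHom, isUnit_algebraMap_functionField_iff] at hs
    exact hs
  refine { map_units := fun y => ?_, surj := fun z => ?_, exists_of_eq := fun {r r'} h => ?_ }
  · exact (isUnit_algebraMap_functionField_iff _).mpr y.2
  · obtain ⟨a, s, hs, e⟩ := exists_germHom_mul_eq hU (genericPoint_mem hx) z
    refine ⟨⟨germHom hx a, ⟨germHom hx s, key s hs⟩⟩, ?_⟩
    simp only
    rw [algebraMap_germHom, algebraMap_germHom, mul_comm, e]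
  · obtain ⟨a, s, hs, e⟩ := exists_germHom_mul_eq hU hx (r - r')
    have h1 : germHom (genericPoint_mem hx) a = 0 := by
      rw [← algebraMap_germHom hx, ← e, map_mul, map_sub, h, sub_self, mul_zero]
    obtain ⟨t, ht, e'⟩ := exists_mul_eq_zero_of_germHom_eq_zero hU _ h1
    refine ⟨⟨germHom hx t, key t ht⟩, ?_⟩
    have h2 : germHom hx s * (germHom hx t * (r - r')) = 0 := by
      rw [mul_left_comm, e, ← map_mul, e', map_zero]
    have h3 := (hs.mul_right_eq_zero).mp h2
    rwa [mul_sub, sub_eq_zero] at h3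

/-- Every point specializes to a closed point `p` by quasi-compactness, and the points specializing
to `p` are the primes of the stalk at `p`, of which there are at most two. -/
lemma eq_genericPoint_or_isClosed [CompactSpace Y]
    (h : ∀ p : Y, IsClosed ({p} : Set Y) → ∀ q : Ideal (Y.presheaf.stalk p), q.IsPrime →
      q = nilradical _ ∨ q = IsLocalRing.maximalIdeal _) (z : Y) :
    z = genericPoint Y ∨ IsClosed ({z} : Set Y) := by
  obtain ⟨p, hpz, hp⟩ := (isClosed_closure (s := {z})).exists_closed_singleton ⟨z, subset_closure rfl⟩
  have hzp : z ⤳ p := specializes_iff_mem_closure.mpr hpz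
  have hr := Scheme.range_fromSpecStalk (X := Y) (x := p)
  obtain ⟨q, hq⟩ : z ∈ Set.range (Y.fromSpecStalk p) := hr ▸ hzp
  obtain ⟨q', hq'⟩ : genericPoint Y ∈ Set.range (Y.fromSpecStalk p) :=
    hr ▸ (genericPoint_spec Y).specializes trivial
  have hm : ∀ a : Spec (Y.presheaf.stalk p), a.asIdeal = IsLocalRing.maximalIdeal _ →
      Y.fromSpecStalk p a = p := by
    intro a ha
    have e : a = IsLocalRing.closedPoint (Y.presheaf.stalk p) := PrimeSpectrum.ext ha
    rw [e, Scheme.fromSpecStalk_closedPoint]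
  rcases h p hp q.asIdeal q.2 with e | e
  · rcases h p hp q'.asIdeal q'.2 with e' | e'
    · have : q = q' := PrimeSpectrum.ext (e.trans e'.symm)
      exact Or.inl (by rw [← hq, this, hq'])
    · left
      have h1 : genericPoint Y = p := by rw [← hq', hm _ e']
      have h2 : z ∈ closure {genericPoint Y} := by
        rw [(genericPoint_spec Y).def]
        trivial
      rw [h1, hp.closure_eq] at h2
      rw [h1]
      exact h2
  · right
    have h1 : z = p := by rw [← hq, hm _ e]
    rwa [h1]

/-- The closed complement has finitely many irreducible components. Their generic points are not the
generic point of `Y`, so they are closed and the components are single points. -/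
lemma finite_compl_of_isOpen [TopologicalSpace.NoetherianSpace Y]
    (h : ∀ z : Y, z = genericPoint Y ∨ IsClosed ({z} : Set Y)) {U : Y.Opens}
    (hU : genericPoint Y ∈ U) : (U : Set Y)ᶜ.Finite := by
  obtain ⟨S, hS, hcl, hirr, e⟩ :=
    TopologicalSpace.NoetherianSpace.exists_finite_set_isClosed_irreducible U.isOpen.isClosed_compl
  rw [e]
  refine hS.sUnion fun t ht => ?_
  obtain ⟨z, hz⟩ := QuasiSober.sober (hirr t ht) (hcl t ht)
  have hzt : z ∈ t := by
    rw [← hz.def]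
    exact subset_closure rfl
  have hzU : z ∈ (U : Set Y)ᶜ := by
    rw [e]
    exact ⟨t, ht, hzt⟩
  rcases h z with rfl | hc
  · exact (hzU hU).elim
  · rw [← hz.def, hc.closure_eq]
    exact Set.finite_singleton z

end IrreducibleScheme

/-! ### Kernels of stalk maps -/

section ClosedImmersion

variable {Y' Y : Scheme.{0}} [IrreducibleSpace Y] [IrreducibleSpace Y']
  (f : Y' ⟶ Y)

lemma stalkMap_germHom {U : Y.Opens} {x : Y'} (hx : f x ∈ U) (a : Γ(Y, U)) :
    f.stalkMap x (germHom hx a) = germHom (U := f ⁻¹ᵁ U) hx (f.app U a) :=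
  congrArg (fun g => g.hom a) (f.germ_stalkMap U x hx)

/-- A germ that pulls back to zero cannot be invertible at the generic point, as the morphism hits
that point; hence it is nilpotent. -/
lemma isNilpotent_of_stalkMap_eq_zero (hf : f (genericPoint Y') = genericPoint Y) {x : Y'}
    {r : Y.presheaf.stalk (f x)} (hr : f.stalkMap x r = 0) : IsNilpotent r := by
  obtain ⟨U, hU, hx, -⟩ := exists_isAffineOpen_subset (Y := Y) (x := f x) (U := ⊤) trivial
  obtain ⟨a, s, hs, e⟩ := exists_germHom_mul_eq hU hx r
  have h1 : germHom (U := f ⁻¹ᵁ U) hx (f.app U a) = 0 := by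
    rw [← stalkMap_germHom f hx, ← e, map_mul, hr, mul_zero]
  have h2 := algebraMap_germHom (U := f ⁻¹ᵁ U) hx (f.app U a)
  rw [h1, map_zero] at h2
  have h3 : genericPoint Y ∉ Y.basicOpen a := by
    rw [← hf]
    intro h
    have h4 : genericPoint Y' ∈ Y'.basicOpen (f.app U a) := by
      rw [← Scheme.preimage_basicOpen]
      exact h
    rw [← isUnit_germHom_iff (genericPoint_mem (U := f ⁻¹ᵁ U) hx), ← h2] at h4
    exact not_isUnit_zero h4
  have h4 : IsNilpotent a := by
    rw [Scheme.isNilpotent_iff_basicOpen_eq_bot_of_isCompact hU.isCompact]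
    exact le_bot_iff.mp fun x hx => (h3 (genericPoint_mem hx)).elim
  have h5 := h4.map (germHom hx)
  rw [← e] at h5
  obtain ⟨t, ht⟩ := hs.exists_left_inv
  have := (Commute.all t _).isNilpotent_mul_left h5
  rwa [← mul_assoc, ht, one_mul] at this

end ClosedImmersion

/-! ## Nilpotent extensions of smooth proper curves over finite fields -/

/-- A smooth proper curve over a finite field. -/
class IsCurveOverFiniteField (X : Scheme.{0}) : Prop where
  exists_isProper_smooth : ∃ (k : Type) (_ : Field k) (_ : Finite k)
    (π : X ⟶ Spec (CommRingCat.of k)), IsProper π ∧ SmoothOfRelativeDimension 1 π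

/-! ### Local rings of the smooth curve -/

section Curve

open IsLocalRing

variable {X : Scheme.{0}}

lemma isMaximal_primeIdealOf {U : X.Opens} (hU : IsAffineOpen U) (x : U)
    (hx : IsClosed ({x.1} : Set X)) : (hU.primeIdealOf x).asIdeal.IsMaximal := by
  rw [← PrimeSpectrum.isClosed_singleton_iff_isMaximal]
  have e : ({hU.primeIdealOf x} : Set (PrimeSpectrum Γ(X, U))) = hU.fromSpec ⁻¹' {x.1} := by
    ext y
    refine (hU.fromSpec.isOpenEmbedding.injective.eq_iff (a := y)).symm.trans ?_
    rw [hU.fromSpec_primeIdealOf x]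
    rfl
  rw [e]
  exact hx.preimage hU.fromSpec.continuous

lemma exists_isStandardSmooth_section [IsCurveOverFiniteField X] (x : X) :
    ∃ (K : Type) (_ : CommRing K) (_ : IsField K) (_ : Finite K) (V : X.Opens)
      (_ : IsAffineOpen V) (_ : x ∈ V) (_ : Algebra K Γ(X, V)),
      Algebra.IsStandardSmoothOfRelativeDimension 1 K Γ(X, V) := by
  obtain ⟨k, _, _, π, hπ, hs⟩ := IsCurveOverFiniteField.exists_isProper_smooth (X := X)
  obtain ⟨U, hU, V, hV, hx, e, h⟩ := hs.exists_isStandardSmoothOfRelativeDimension x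
  -- The spectrum of a field has only one point, so the affine neighbourhood in the base is
  -- everything.
  have hU' : U = ⊤ := by
    rw [eq_top_iff]
    intro y _
    have : Subsingleton (Spec (CommRingCat.of k)) :=
      inferInstanceAs (Subsingleton (PrimeSpectrum k))
    exact Subsingleton.elim (π x) y ▸ e hx
  subst hU'
  let i : Γ(Spec (CommRingCat.of k), ⊤) ≃+* k :=
    (Scheme.ΓSpecIso (CommRingCat.of k)).commRingCatIsoToRingEquiv
  refine ⟨Γ(Spec (CommRingCat.of k), ⊤), inferInstance,
    i.toMulEquiv.isField (Field.toIsField k), Finite.of_equiv k i.symm.toEquiv, V, hV, hx,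
    (π.appLE ⊤ V e).hom.toAlgebra, h⟩

variable [IsIntegral X] [IsCurveOverFiniteField X]

lemma isDiscreteValuationRing_stalk (x : X) (hx : IsClosed ({x} : Set X)) :
    IsDiscreteValuationRing (X.presheaf.stalk x) := by
  obtain ⟨K, _, hK, _, V, hV, hxV, _, h⟩ := exists_isStandardSmooth_section x
  have : Nonempty V := ⟨⟨x, hxV⟩⟩
  let := X.presheaf.algebra_section_stalk ⟨x, hxV⟩
  have := hV.isLocalization_stalk ⟨x, hxV⟩
  have := isMaximal_primeIdealOf hV ⟨x, hxV⟩ hx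
  exact isDiscreteValuationRing_of_isStandardSmooth hK (hV.primeIdealOf ⟨x, hxV⟩).asIdeal _

lemma finite_residueField_stalk (x : X) (hx : IsClosed ({x} : Set X)) :
    Finite (ResidueField (X.presheaf.stalk x)) := by
  obtain ⟨K, _, hK, _, V, hV, hxV, _, h⟩ := exists_isStandardSmooth_section x
  let := hK.toField
  have := Algebra.IsStandardSmoothOfRelativeDimension.isStandardSmooth 1 (R := K) (S := Γ(X, V))
  let := X.presheaf.algebra_section_stalk ⟨x, hxV⟩
  have := hV.isLocalization_stalk ⟨x, hxV⟩
  have := isMaximal_primeIdealOf hV ⟨x, hxV⟩ hx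
  let m := (hV.primeIdealOf ⟨x, hxV⟩).asIdeal
  let := Ideal.Quotient.field m
  have : Module.Finite K (Γ(X, V) ⧸ m) := finite_of_finite_type_of_isJacobsonRing K _
  have : Finite (Γ(X, V) ⧸ m) := Module.finite_of_finite K
  exact Finite.of_equiv _ (IsLocalization.AtPrime.equivQuotMaximalIdeal m
    (X.presheaf.stalk x)).toEquiv

lemma exists_prime_eq_zero_functionField (X : Scheme.{0}) [IsIntegral X]
    [IsCurveOverFiniteField X] : ∃ p : ℕ, p.Prime ∧ (p : X.functionField) = 0 := by
  obtain ⟨K, _, hK, _, V, hV, hxV, _, h⟩ := exists_isStandardSmooth_section (genericPoint X)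
  let := hK.toField
  obtain ⟨p, hp⟩ := CharP.exists K
  have : Fact p.Prime := ⟨CharP.char_is_prime K p⟩
  refine ⟨p, Fact.out, ?_⟩
  have h1 := congrArg ((germHom hxV).comp (algebraMap K Γ(X, V))) (CharP.cast_eq_zero K p)
  rwa [map_natCast, map_zero] at h1

end Curve

/-! ### Finiteness and countability for nilpotent extensions -/

section Extension

open IsLocalRing

variable {X : Scheme.{0}} [IsIntegral X] (C : NilpotentExtension X)

instance isLocallyNoetherian_scheme : IsLocallyNoetherian C.scheme := by
  have : IsLocallyNoetherian (⊤_ Scheme.{0}) :=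
    isLocallyNoetherian_of_isOpenImmersion
      (Limits.terminalIsTerminal.uniqueUpToIso specZIsTerminal).hom
  have := C.locallyOfFiniteType
  exact LocallyOfFiniteType.isLocallyNoetherian (Limits.terminal.from C.scheme)

instance compactSpace_scheme : CompactSpace C.scheme := by
  have := C.quasiCompact
  have : CompactSpace (⊤_ Scheme.{0}) := inferInstance
  exact QuasiCompact.compactSpace_of_compactSpace (Limits.terminal.from C.scheme)

instance isNoetherian_scheme : IsNoetherian C.scheme where

lemma countable_of_finiteType (R S : Type) [CommRing R] [CommRing S] [Algebra R S] [Countable R]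
    [h : Algebra.FiniteType R S] : Countable S := by
  obtain ⟨n, g, hg⟩ := Algebra.FiniteType.iff_quotient_mvPolynomial''.mp h
  have : Countable (MvPolynomial (Fin n) R) := by
    rw [← Cardinal.mk_le_aleph0_iff]
    refine MvPolynomial.cardinalMk_le_max.trans ?_
    simp
  exact hg.countable

lemma countable_section {U : C.scheme.Opens} (hU : IsAffineOpen U) : Countable Γ(C.scheme, U) := by
  have := C.locallyOfFiniteType
  let e := (Limits.terminalIsTerminal.uniqueUpToIso specZIsTerminal).hom
  let f : C.scheme ⟶ Spec (CommRingCat.of ℤ) := Limits.terminal.from C.scheme ≫ e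
  have h := LocallyOfFiniteType.finiteType_appLE f (isAffineOpen_top _) hU le_top
  let i : Γ(Spec (CommRingCat.of ℤ), ⊤) ≃+* ℤ :=
    (Scheme.ΓSpecIso (CommRingCat.of ℤ)).commRingCatIsoToRingEquiv
  have : Countable Γ(Spec (CommRingCat.of ℤ), ⊤) := i.toEquiv.countable_iff.mpr inferInstance
  let := (f.appLE ⊤ U le_top).hom.toAlgebra
  have : Algebra.FiniteType Γ(Spec (CommRingCat.of ℤ), ⊤) Γ(C.scheme, U) := h
  exact countable_of_finiteType Γ(Spec (CommRingCat.of ℤ), ⊤) _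

instance countable_functionRing : Countable (FunctionRing C) := by
  obtain ⟨U, hU, hη, -⟩ := exists_isAffineOpen_subset (Y := C.scheme)
    (x := genericPoint C.scheme) (U := ⊤) trivial
  have := countable_section C hU
  have hne : Nontrivial (FunctionRing C) := inferInstanceAs (Nontrivial (C.scheme.presheaf.stalk _))
  have hs : Function.Surjective fun a : Γ(C.scheme, U) × Γ(C.scheme, U) =>
      germHom hη a.1 * Ring.inverse (germHom hη a.2) := by
    intro z
    obtain ⟨a, s, hs, e⟩ := exists_germHom_mul_eq hU hη z
    refine ⟨(a, s), ?_⟩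
    simp only
    rw [← e, mul_comm, ← mul_assoc, Ring.inverse_mul_cancel _ hs, one_mul]
  exact hs.countable

instance isNoetherianRing_functionRing : IsNoetherianRing (FunctionRing C) :=
  inferInstanceAs (IsNoetherianRing (C.scheme.presheaf.stalk _))

lemma incl_genericPoint : C.incl (genericPoint X) = genericPoint C.scheme := by
  have hs : Function.Surjective C.incl := C.surjective.surj
  apply ((genericPoint_spec C.scheme).eq _).symm
  have h := (genericPoint_spec X).image C.incl.continuous
  rwa [Set.image_univ, hs.range_eq, closure_univ] at h

variable [IsCurveOverFiniteField X]

/-- The stalk surjects with nil kernel onto the discrete valuation ring of the reduced curve at the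
same point. It therefore has the same primes, and its residue field embeds into a finite one. -/
lemma isCurveLocalRing_stalk (z : C.scheme) (hz : IsClosed ({z} : Set C.scheme)) :
    IsCurveLocalRing (C.scheme.presheaf.stalk z) := by
  have := C.isClosedImmersion
  obtain ⟨x, rfl⟩ := C.surjective.surj z
  have hx : IsClosed ({x} : Set X) := by
    have h := hz.preimage C.incl.continuous
    have e : C.incl ⁻¹' {C.incl x} = {x} := by
      ext y
      exact C.incl.isClosedEmbedding.injective.eq_iff
    rwa [e] at h
  have := isDiscreteValuationRing_stalk x hx
  have := finite_residueField_stalk x hx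
  let φ := (C.incl.stalkMap x).hom
  have hφ : Function.Surjective φ := C.incl.stalkMap_surjective x
  have hker : RingHom.ker φ ≤ nilradical _ := fun r hr =>
    isNilpotent_of_stalkMap_eq_zero C.incl (incl_genericPoint C) hr
  have hlocal : IsLocalHom φ := inferInstanceAs (IsLocalHom (C.incl.stalkMap x).hom)
  refine { isNoetherianRing := inferInstance, finite_residueField := ?_,
           isPrime_nilradical := isPrime_nilradical_stalk _, eq_nilradical_or_eq := ?_ }
  · exact Finite.of_injective (ResidueField.map φ) (ResidueField.map φ).injective
  · intro q hq
    have hkq : RingHom.ker φ ≤ q := hker.trans (nilradical_le_prime q)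
    have hq' : (q.map φ).IsPrime := Ideal.map_isPrime_of_surjective hφ hkq
    have hc : (q.map φ).comap φ = q := by
      rw [Ideal.comap_map_of_surjective φ hφ]
      exact sup_eq_left.mpr hkq
    by_cases h0 : q.map φ = ⊥
    · left
      refine le_antisymm ?_ (nilradical_le_prime q)
      rw [← hc, h0]
      exact hker
    · right
      rw [← hc, IsLocalRing.eq_maximalIdeal (hq'.isMaximal h0)]
      exact ((local_hom_TFAE φ).out 0 4).mp hlocal

instance isLocallyCurve : C.IsLocallyCurve where
  isCurveLocalRing p := isCurveLocalRing_stalk C p.1 p.2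
  isLocalization p := by
    have := isPrime_nilradical_stalk p.1
    exact isLocalization_functionField p.1

lemma finite_notMem {U : C.scheme.Opens} (hU : genericPoint C.scheme ∈ U) :
    {p : ClosedPoint C | p.1 ∉ U}.Finite := by
  have h := finite_compl_of_isOpen (eq_genericPoint_or_isClosed fun p hp =>
    (isCurveLocalRing_stalk C p hp).eq_nilradical_or_eq) hU
  exact h.preimage Subtype.val_injective.injOn

lemma eventually_mem {U : C.scheme.Opens} (hU : genericPoint C.scheme ∈ U) :
    ∀ᶠ p : ClosedPoint C in Filter.cofinite, p.1 ∈ U :=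
  finite_notMem C hU

instance nonempty_closedPoint : Nonempty (ClosedPoint C) := by
  obtain ⟨p, -, hp⟩ := (isClosed_univ (X := C.scheme)).exists_closed_singleton
    ⟨genericPoint C.scheme, trivial⟩
  exact ⟨⟨p, hp⟩⟩

/-- Closed points of an affine chart inject into the ideals of a countable Noetherian ring, and only
finitely many closed points lie outside the chart. -/
instance countable_closedPoint : Countable (ClosedPoint C) := by
  obtain ⟨U, hU, hη, -⟩ := exists_isAffineOpen_subset (Y := C.scheme)
    (x := genericPoint C.scheme) (U := ⊤) trivial
  have := countable_section C hU
  have : IsNoetherianRing Γ(C.scheme, U) := IsLocallyNoetherian.component_noetherian ⟨U, hU⟩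
  have : Countable (Ideal Γ(C.scheme, U)) := by
    have h : Function.Surjective fun s : Finset Γ(C.scheme, U) =>
        Ideal.span (s : Set Γ(C.scheme, U)) := fun I => I.fg_of_isNoetherianRing
    exact h.countable
  have hinj : Function.Injective fun p : {p : ClosedPoint C // p.1 ∈ U} =>
      (hU.primeIdealOf ⟨p.1.1, p.2⟩).asIdeal := by
    intro p q h
    have h1 := PrimeSpectrum.ext h
    have h2 := congrArg hU.fromSpec h1
    rw [hU.fromSpec_primeIdealOf, hU.fromSpec_primeIdealOf] at h2
    exact Subtype.ext (Subtype.ext h2)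
  have h1 : {p : ClosedPoint C | p.1 ∈ U}.Countable := hinj.countable
  have h2 := h1.union (finite_notMem C hη).countable
  rw [← Set.countable_univ_iff]
  exact h2.mono fun p _ => Classical.em _

end Extension

/-! ## Spreading out and the topology of the adeles -/

section Spreading

open IsLocalRing

variable {X : Scheme.{0}} [IsIntegral X] [IsCurveOverFiniteField X] {C : NilpotentExtension X}

lemma eventually_exists_eq_algebraMap (f : FunctionRing C) :
    ∀ᶠ p : ClosedPoint C in Filter.cofinite, ∃ r, f = algebraMap (LocalRing p) _ r := by
  obtain ⟨U, hU, g, rfl⟩ := C.scheme.presheaf.exists_germ_eq f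
  filter_upwards [eventually_mem C hU] with p hp
  exact ⟨germHom hp g, (algebraMap_germHom hp g).symm⟩

/-- On an affine chart, the sections vanishing at the generic point form a finitely generated ideal,
killed by a single section that is invertible there. Wherever that section is invertible the stalk
has no such elements; thus only finitely many closed points can be embedded. -/
lemma eventually_algebraMap_injective : ∀ᶠ p : ClosedPoint C in Filter.cofinite,
    Function.Injective (algebraMap (LocalRing p) (FunctionRing C)) := by
  obtain ⟨U, hU, hη, -⟩ := exists_isAffineOpen_subset (Y := C.scheme)
    (x := genericPoint C.scheme) (U := ⊤) trivial
  have : IsNoetherianRing Γ(C.scheme, U) := IsLocallyNoetherian.component_noetherian ⟨U, hU⟩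
  obtain ⟨S, hS⟩ := (RingHom.ker (germHom hη)).fg_of_isNoetherianRing
  have h1 : ∀ a ∈ S, ∃ s, IsUnit (germHom hη s) ∧ s * a = 0 := fun a ha =>
    exists_mul_eq_zero_of_germHom_eq_zero hU hη
      (RingHom.mem_ker.mp (hS ▸ Ideal.subset_span ha : a ∈ RingHom.ker (germHom hη)))
  choose! s hs hsa using h1
  have hsU : IsUnit (germHom hη (∏ a ∈ S, s a)) := by
    rw [map_prod]
    exact IsUnit.prod_iff.mpr hs
  have h2 := (isUnit_germHom_iff hη _).mp hsU
  filter_upwards [eventually_mem C hη, eventually_mem C h2] with p hp hp'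
  rw [injective_iff_map_eq_zero]
  intro r hr
  obtain ⟨a, t, ht, e⟩ := exists_germHom_mul_eq hU hp r
  have h3 : a ∈ RingHom.ker (germHom hη) := by
    rw [RingHom.mem_ker, ← algebraMap_germHom hp, ← e, map_mul, hr, mul_zero]
  rw [← hS] at h3
  have h4 : (∏ a ∈ S, s a) * a = 0 := by
    have h5 : Ideal.span (S : Set Γ(C.scheme, U)) ≤
        LinearMap.ker (LinearMap.mulLeft Γ(C.scheme, U) (∏ a ∈ S, s a)) := by
      rw [Ideal.span_le]
      classical
      intro b hb
      change (∏ a ∈ S, s a) * b = 0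
      rw [← Finset.prod_erase_mul _ _ hb, mul_assoc, hsa b hb, mul_zero]
    exact h5 h3
  have h5 := congrArg (germHom hp) h4
  rw [map_mul, map_zero, ← e] at h5
  have h6 := (isUnit_germHom_iff hp _).mpr hp'
  exact (ht.mul_right_eq_zero).mp ((h6.mul_right_eq_zero).mp h5)

/-- An ideal of `F` has a finite set of generators that also generates its intersection with almost
all local rings. -/
lemma exists_generators (I : Ideal (FunctionRing C)) :
    ∃ (n : ℕ) (e : Fin n → FunctionRing C), Ideal.span (Set.range e) = I ∧
      ∀ᶠ p : ClosedPoint C in Filter.cofinite, ∀ r : LocalRing p, algebraMap _ _ r ∈ I →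
        ∃ b : Fin n → LocalRing p,
          algebraMap _ (FunctionRing C) r = ∑ i, algebraMap _ (FunctionRing C) (b i) * e i := by
  obtain ⟨U, hU, hη, -⟩ := exists_isAffineOpen_subset (Y := C.scheme)
    (x := genericPoint C.scheme) (U := ⊤) trivial
  have : IsNoetherianRing Γ(C.scheme, U) := IsLocallyNoetherian.component_noetherian ⟨U, hU⟩
  obtain ⟨n, e, he⟩ := Submodule.fg_iff_exists_fin_generating_family.mp
    (I.comap (germHom hη)).fg_of_isNoetherianRing
  have key : ∀ a, germHom hη a ∈ I → ∃ b : Fin n → Γ(C.scheme, U), a = ∑ i, b i * e i := by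
    intro a ha
    have h1 : a ∈ Submodule.span Γ(C.scheme, U) (Set.range e) := by
      rw [he]
      exact ha
    obtain ⟨b, hb⟩ := (Submodule.mem_span_range_iff_exists_fun _).mp h1
    exact ⟨b, hb.symm⟩
  refine ⟨n, fun i => germHom hη (e i), le_antisymm ?_ fun f hf => ?_, ?_⟩
  · rw [Ideal.span_le]
    rintro _ ⟨i, rfl⟩
    have h1 : e i ∈ I.comap (germHom hη) := he ▸ Submodule.subset_span ⟨i, rfl⟩
    exact h1
  · obtain ⟨a, s, hs, h1⟩ := exists_germHom_mul_eq hU hη f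
    obtain ⟨b, rfl⟩ := key a (h1 ▸ Ideal.mul_mem_left _ _ hf)
    obtain ⟨t, ht⟩ := hs.exists_left_inv
    have h2 : f = t * germHom hη (∑ i, b i * e i) := by rw [← h1, ← mul_assoc, ht, one_mul]
    rw [h2, map_sum]
    refine Ideal.mul_mem_left _ _ (sum_mem fun i _ => ?_)
    rw [map_mul]
    exact Ideal.mul_mem_left _ _ (Ideal.subset_span ⟨i, rfl⟩)
  · filter_upwards [eventually_mem C hη] with p hp r hr
    obtain ⟨a, s, hs, h1⟩ := exists_germHom_mul_eq hU hp r
    have h2 := congrArg (algebraMap (LocalRing p) (FunctionRing C)) h1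
    rw [map_mul, algebraMap_germHom hp a] at h2
    obtain ⟨b, rfl⟩ := key a (h2 ▸ Ideal.mul_mem_left _ _ hr)
    obtain ⟨t, ht⟩ := hs.exists_left_inv
    refine ⟨fun i => t * germHom hp (b i), ?_⟩
    have h3 : r = t * germHom hp (∑ i, b i * e i) := by rw [← h1, ← mul_assoc, ht, one_mul]
    rw [h3, map_mul, algebraMap_germHom hp, map_sum, Finset.mul_sum]
    refine Finset.sum_congr rfl fun i _ => ?_
    rw [map_mul, map_mul, algebraMap_germHom hp, mul_assoc]

variable (C) in
/-- The diagonal embedding of `F` in the adeles. -/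
def principalAdele : FunctionRing C →+* Adele C where
  toFun f := ⟨fun p => ofFunctionRing p f, by
    filter_upwards [eventually_exists_eq_algebraMap f] with p ⟨r, hr⟩
    rw [hr, ofFunctionRing_algebraMap]
    exact ⟨_, rfl⟩⟩
  map_one' := by
    ext p
    exact map_one (ofFunctionRing p)
  map_zero' := by
    ext p
    exact map_zero (ofFunctionRing p)
  map_mul' x y := by
    ext p
    exact map_mul (ofFunctionRing p) x y
  map_add' x y := by
    ext p
    exact map_add (ofFunctionRing p) x y

lemma adeleComponents_comp_principalAdele :
    (adeleComponents C).comp (principalAdele C) = diagonal C := rfl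

lemma mem_integralAdeles_iff {a : Adele C} :
    a ∈ integralAdeles C ↔ ∀ p, a p ∈ integerRing p := by
  rw [integralAdeles, Subring.mem_iInf]
  rfl

instance fact_isOpen_integerRing :
    Fact (∀ p : ClosedPoint C, IsOpen (integerRing p : Set (LocalFunctionRing p))) :=
  ⟨isOpen_integerRing⟩

instance isTopologicalRing_adele : IsTopologicalRing (Adele C) :=
  RestrictedProduct.isTopologicalRing _

instance t2Space_adele : T2Space (Adele C) := inferInstance

lemma isOpen_integralAdeles : IsOpen (integralAdeles C : Set (Adele C)) := by
  have h := RestrictedProduct.isOpen_forall_mem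
    (A := fun p : ClosedPoint C => (integerRing p : Set (LocalFunctionRing p))) isOpen_integerRing
  convert h using 1
  ext a
  exact mem_integralAdeles_iff

lemma range_structureMap_eq : Set.range (RestrictedProduct.structureMap
    (fun p : ClosedPoint C => LocalFunctionRing p) (fun p => (integerRing p : Set _))
      Filter.cofinite) = integralAdeles C := by
  rw [RestrictedProduct.range_structureMap]
  ext a
  exact mem_integralAdeles_iff.symm

lemma isCompact_integralAdeles : IsCompact (integralAdeles C : Set (Adele C)) := by
  rw [← range_structureMap_eq]
  have : ∀ p : ClosedPoint C, CompactSpace (integerRing p : Set (LocalFunctionRing p)) :=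
    fun p => isCompact_iff_compactSpace.mp (isCompact_integerRing p)
  exact isCompact_range RestrictedProduct.isEmbedding_structureMap.continuous

lemma secondCountableTopology_integralAdeles :
    SecondCountableTopology (integralAdeles C : Set (Adele C)) := by
  have h := RestrictedProduct.isEmbedding_structureMap (𝓕 := Filter.cofinite)
    (R := fun p : ClosedPoint C => LocalFunctionRing p) (A := fun p => (integerRing p : Set _))
  rw [← range_structureMap_eq]
  exact h.toHomeomorph.symm.secondCountableTopology

/-- The compact set is covered by finitely many translates of the integral adeles and `F` is
countable, so countably many open second countable translates cover `𝔸`. -/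
lemma secondCountableTopology_adele {Q : Set (Adele C)} (hQ : IsCompact Q)
    (h : ∀ a : Adele C, ∃ f, ∃ q ∈ Q, a = principalAdele C f + q) :
    SecondCountableTopology (Adele C) := by
  have := secondCountableTopology_integralAdeles (C := C)
  let τ : Adele C → Adele C ≃ₜ Adele C := fun b => Homeomorph.addLeft b
  have hopen : ∀ b, IsOpen (τ b '' (integralAdeles C : Set (Adele C))) := fun b =>
    (τ b).isOpenMap _ isOpen_integralAdeles
  obtain ⟨t, ht⟩ := hQ.elim_finite_subcover (fun b => τ b '' (integralAdeles C : Set (Adele C)))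
    hopen fun q _ => Set.mem_iUnion.mpr ⟨q, 0, zero_mem _, add_zero _⟩
  let U : FunctionRing C × t → Set (Adele C) := fun i =>
    τ (principalAdele C i.1 + i.2) '' (integralAdeles C : Set (Adele C))
  have : ∀ i, SecondCountableTopology (U i) := fun i =>
    ((τ (principalAdele C i.1 + i.2)).image _).symm.secondCountableTopology
  refine TopologicalSpace.secondCountableTopology_of_countable_cover (U := U) (fun i => hopen _) ?_
  refine Set.eq_univ_of_forall fun a => ?_
  obtain ⟨f, q, hq, rfl⟩ := h a
  obtain ⟨b, hb, o, ho, rfl⟩ := Set.mem_iUnion₂.mp (ht hq)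
  exact Set.mem_iUnion.mpr ⟨(f, ⟨b, hb⟩), o, ho, add_assoc _ _ _⟩

end Spreading

/-! ## Reduction of adeles -/

section ReductionAdeles

open IsLocalRing

variable {X : Scheme.{0}} [IsIntegral X] {C' C : NilpotentExtension X}
  (j : NilpotentExtension.ClosedEmbedding C' C)

lemma mapPoint_surjective : Function.Surjective (mapPoint j) := by
  have := j.isClosedImmersion
  intro p
  obtain ⟨y, hy⟩ := C.surjective.surj p.1
  have hz : j.hom (C'.incl y) = p.1 := by
    rw [← Scheme.Hom.comp_apply, j.comm, hy]
  have hcl : IsClosed ({C'.incl y} : Set C'.scheme) := by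
    have h := p.2.preimage j.hom.continuous
    have e : j.hom ⁻¹' {p.1} = {C'.incl y} := by
      ext z
      rw [← hz]
      exact j.hom.isClosedEmbedding.injective.eq_iff
    rwa [e] at h
  exact ⟨⟨C'.incl y, hcl⟩, Subtype.ext hz⟩

lemma reduceLocalRing_surjective (p : ClosedPoint C') :
    Function.Surjective (reduceLocalRing j p) := by
  have := j.isClosedImmersion
  exact j.hom.stalkMap_surjective p.1

lemma isNilpotent_of_reduceLocalRing_eq_zero (p : ClosedPoint C') {r : LocalRing (mapPoint j p)}
    (hr : reduceLocalRing j p r = 0) : IsNilpotent r :=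
  isNilpotent_of_stalkMap_eq_zero j.hom j.map_genericPoint hr

lemma isNilpotent_iff_reduceLocalRing (p : ClosedPoint C') (r : LocalRing (mapPoint j p)) :
    reduceLocalRing j p r ∈ nilradical _ ↔ r ∈ nilradical _ := by
  constructor
  · rintro ⟨n, hn⟩
    rw [← map_pow] at hn
    exact (isNilpotent_of_reduceLocalRing_eq_zero j p hn).of_pow
  · exact fun h => IsNilpotent.map h _

lemma isNilpotent_ker_reduceFunctionRing : IsNilpotent (RingHom.ker (reduceFunctionRing j)) := by
  rw [(RingHom.ker (reduceFunctionRing j)).fg_of_isNoetherianRing.isNilpotent_iff_le_nilradical]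
  intro f hf
  rcases isUnit_or_isNilpotent_functionField f with h | h
  · have h1 := h.map (reduceFunctionRing j)
    have : Nontrivial (FunctionRing C') :=
      inferInstanceAs (Nontrivial (C'.scheme.presheaf.stalk _))
    rw [RingHom.mem_ker.mp hf] at h1
    exact (not_isUnit_zero h1).elim
  · exact h

variable [IsCurveOverFiniteField X]

lemma reduceFunctionRing_surjective : Function.Surjective (reduceFunctionRing j) := by
  obtain ⟨p⟩ := nonempty_closedPoint C'
  intro z
  obtain ⟨s', hs', r', e⟩ := exists_mul_eq_algebraMap p z
  obtain ⟨s, rfl⟩ := reduceLocalRing_surjective j p s'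
  obtain ⟨r, rfl⟩ := reduceLocalRing_surjective j p r'
  have hs := (isNilpotent_iff_reduceLocalRing j p s).not.mp hs'
  obtain ⟨t, ht⟩ := (isUnit_algebraMap_functionRing _ hs).exists_left_inv
  refine ⟨t * algebraMap _ _ r, ?_⟩
  have h1 := RingHom.congr_fun (reduceLocalRing_compat j p)
  simp only [RingHom.comp_apply] at h1
  rw [map_mul, h1, ← e, ← h1, ← mul_assoc, ← map_mul, ht, map_one, one_mul]

lemma reduceCompletedLocalRing_surjective (p : ClosedPoint C') :
    Function.Surjective (reduceCompletedLocalRing j p) :=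
  completionMap_surjective _ _ (reduceLocalRing_surjective j p)

lemma continuous_reduceLocalFunctionRing (p : ClosedPoint C') :
    Continuous (reduceLocalFunctionRing j p) := by
  refine continuous_def.mpr fun S hS x hx => ?_
  obtain ⟨n, hn⟩ := hS _ hx
  refine ⟨n, fun y hy => ?_⟩
  rw [Set.mem_preimage, map_add, reduceLocalFunctionRing_ofCompletedLocalRing]
  refine hn _ ?_
  have h1 := evalₐ_completionMap (reduceLocalRing j p) (maximalIdeal_le_comap j p) n y
  rw [← ker_evalₐ_eq] at hy ⊢
  rw [RingHom.mem_ker] at hy ⊢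
  rw [hy, map_zero] at h1
  exact h1

lemma continuous_reduceAdele : Continuous (reduceAdele j) :=
  RestrictedProduct.mapAlong_continuous _ _ _ (mapPoint_injective j).tendsto_cofinite
    (fun p x => reduceLocalFunctionRing j p x) (Filter.Eventually.of_forall fun p => by
      rintro _ ⟨x, rfl⟩
      exact ⟨_, (reduceLocalFunctionRing_ofCompletedLocalRing j p x).symm⟩)
    (continuous_reduceLocalFunctionRing j)

lemma reduceLocalFunctionRing_surjective (p : ClosedPoint C') (x : LocalFunctionRing p) :
    ∃ y, reduceLocalFunctionRing j p y = x ∧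
      (x ∈ integerRing p → y ∈ integerRing (mapPoint j p)) := by
  by_cases hx : x ∈ integerRing p
  · obtain ⟨z, rfl⟩ := hx
    obtain ⟨w, rfl⟩ := reduceCompletedLocalRing_surjective j p z
    exact ⟨_, reduceLocalFunctionRing_ofCompletedLocalRing j p w, fun _ => ⟨w, rfl⟩⟩
  · obtain ⟨f, z, -, rfl⟩ := exists_sub_ofFunctionRing_mem p 0 x
    obtain ⟨w, rfl⟩ := reduceCompletedLocalRing_surjective j p z
    obtain ⟨g, rfl⟩ := reduceFunctionRing_surjective j f
    refine ⟨ofFunctionRing _ g + ofCompletedLocalRing _ w, ?_, fun h => (hx h).elim⟩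
    rw [map_add, reduceLocalFunctionRing_ofCompletedLocalRing,
      reduceLocalFunctionRing_ofFunctionRing]

/-- Components are lifted one at a time, integral ones to integral ones, so that the family of lifts
is again an adele. -/
lemma exists_reduceAdele_eq (a : Adele C') : ∃ b, reduceAdele j b = a ∧
    (a ∈ integralAdeles C' → b ∈ integralAdeles C) := by
  choose y hy hy' using fun p => reduceLocalFunctionRing_surjective j p (a p)
  -- The lifts are indexed by points of `C'`; they are transported to points of `C` along the
  -- bijection `mapPoint j`.
  have h1 : ∀ q : ClosedPoint C, ∃ z : LocalFunctionRing q, ∀ p (h : mapPoint j p = q), h ▸ y p = z := by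
    intro q
    obtain ⟨p, rfl⟩ := mapPoint_surjective j q
    refine ⟨y p, fun p' h => ?_⟩
    obtain rfl := mapPoint_injective j h
    rfl
  choose z hz using h1
  have hz' : ∀ p, z (mapPoint j p) = y p := fun p => (hz (mapPoint j p) p rfl).symm
  have hint : {q | z q ∉ integerRing q}.Finite := by
    refine Set.Finite.subset ((Filter.eventually_cofinite.mp a.2).image (mapPoint j)) ?_
    intro q hq
    obtain ⟨p, rfl⟩ := mapPoint_surjective j q
    refine ⟨p, fun h => hq ?_, rfl⟩
    rw [hz']
    exact hy' p h
  refine ⟨⟨z, hint⟩, ?_, fun ha => ?_⟩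
  · ext p
    change reduceLocalFunctionRing j p (z (mapPoint j p)) = a p
    rw [hz', hy]
  · rw [mem_integralAdeles_iff] at ha
    refine mem_integralAdeles_iff.mpr fun q => ?_
    obtain ⟨p, rfl⟩ := mapPoint_surjective j q
    change z (mapPoint j p) ∈ _
    rw [hz']
    exact hy' p (ha p)

lemma reduceAdele_principalAdele (f : FunctionRing C) :
    reduceAdele j (principalAdele C f) = principalAdele C' (reduceFunctionRing j f) := by
  ext p
  exact reduceLocalFunctionRing_ofFunctionRing j p f

lemma mem_map_ker_of_reduceCompletedLocalRing_eq_zero (p : ClosedPoint C')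
    {y : CompletedLocalRing (mapPoint j p)} (hy : reduceCompletedLocalRing j p y = 0) :
    y ∈ (RingHom.ker (reduceLocalRing j p)).map (algebraMap _ _) := by
  rw [← ker_completionMap _ _ (reduceLocalRing_surjective j p)]
  exact hy

lemma algebraMap_mem_ker_reduceFunctionRing (p : ClosedPoint C') {r : LocalRing (mapPoint j p)}
    (hr : reduceLocalRing j p r = 0) :
    algebraMap _ (FunctionRing C) r ∈ RingHom.ker (reduceFunctionRing j) := by
  have h1 := RingHom.congr_fun (reduceLocalRing_compat j p) r
  simp only [RingHom.comp_apply] at h1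
  rw [RingHom.mem_ker, h1, hr, map_zero]

lemma mem_map_of_reduceLocalFunctionRing_eq_zero (p : ClosedPoint C')
    {x : LocalFunctionRing (mapPoint j p)} (hx : reduceLocalFunctionRing j p x = 0) :
    x ∈ (RingHom.ker (reduceFunctionRing j)).map (ofFunctionRing (mapPoint j p)) := by
  obtain ⟨s, hs, y, hy⟩ := exists_mul_eq_ofCompletedLocalRing _ x
  have h1 := congrArg (reduceLocalFunctionRing j p) hy
  rw [map_mul, hx, mul_zero, reduceLocalFunctionRing_ofCompletedLocalRing] at h1
  obtain ⟨t', ht', e⟩ := (ofCompletedLocalRing_eq_zero_iff p _).mp h1.symm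
  obtain ⟨t, rfl⟩ := reduceLocalRing_surjective j p t'
  have ht := (isNilpotent_iff_reduceLocalRing j p t).not.mp ht'
  have h2 : reduceCompletedLocalRing j p (algebraMap _ _ t * y) = 0 := by
    rw [map_mul, ← e]
    congr 1
  have h3 := mem_map_ker_of_reduceCompletedLocalRing_eq_zero j p h2
  have h4 : (RingHom.ker (reduceLocalRing j p)).map (algebraMap _ _) ≤
      ((RingHom.ker (reduceFunctionRing j)).map (ofFunctionRing (mapPoint j p))).comap
        (ofCompletedLocalRing (mapPoint j p)) := by
    rw [Ideal.map_le_iff_le_comap]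
    intro r hr
    rw [Ideal.mem_comap, Ideal.mem_comap, ← ofFunctionRing_algebraMap]
    exact Ideal.mem_map_of_mem _ (algebraMap_mem_ker_reduceFunctionRing j p hr)
  have h5 := h4 h3
  rw [Ideal.mem_comap, map_mul, ← hy, ← mul_assoc, ← map_mul, ← map_mul,
    ← ofFunctionRing_algebraMap] at h5
  have hts : t * s ∉ nilradical _ := fun h =>
    (Ideal.IsPrime.mem_or_mem inferInstance h).elim ht hs
  exact (Ideal.unit_mul_mem_iff_mem _
    ((isUnit_algebraMap_functionRing _ hts).map (ofFunctionRing _))).mp h5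

/-- At each point the kernel is generated by the kernel of `F_C → F_{C'}`. For these local
statements to give an adelic one, the coefficients on a fixed finite set of generators must be
integral at almost all points; `exists_generators` supplies such a set. -/
lemma ker_reduceAdele : RingHom.ker (reduceAdele j) =
    (RingHom.ker (reduceFunctionRing j)).map (principalAdele C) := by
  apply le_antisymm
  · intro a ha
    obtain ⟨n, e, he, hgen⟩ := exists_generators (RingHom.ker (reduceFunctionRing j))
    have h0 : ∀ p, reduceLocalFunctionRing j p (a (mapPoint j p)) = 0 := fun p =>
      congrArg (fun b : Adele C' => b p) (RingHom.mem_ker.mp ha)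
    let good : Set (ClosedPoint C) := {q | ∃ b : Fin n → LocalFunctionRing q,
      a q = ∑ i, b i * ofFunctionRing q (e i) ∧ ∀ i, b i ∈ integerRing q}
    have hall : ∀ q : ClosedPoint C, ∃ b : Fin n → LocalFunctionRing q,
        a q = ∑ i, b i * ofFunctionRing q (e i) ∧ (q ∈ good → ∀ i, b i ∈ integerRing q) := by
      intro q
      by_cases hq : q ∈ good
      · obtain ⟨b, h1, h2⟩ := hq
        exact ⟨b, h1, fun _ => h2⟩
      · obtain ⟨p, rfl⟩ := mapPoint_surjective j q
        have h1 := mem_map_of_reduceLocalFunctionRing_eq_zero j p (h0 p)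
        rw [← he, Ideal.map_span, ← Set.range_comp] at h1
        obtain ⟨b, hb⟩ := (Submodule.mem_span_range_iff_exists_fun _).mp h1
        exact ⟨b, hb.symm, fun h => (hq h).elim⟩
    -- Excluded are the points where the local ring of `C'` does not embed in its function ring,
    -- where the generators fail to generate integrally, or where `a` is not integral. Elsewhere `a`
    -- comes from `y` reducing to zero in the completed local ring itself, so `y` is a combination
    -- of elements of the kernel on local rings, with integral coefficients.
    have hgood : goodᶜ.Finite := by
      have h1 := (Filter.eventually_cofinite.mp
        (eventually_algebraMap_injective (C := C'))).image (mapPoint j)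
      refine ((h1.union (Filter.eventually_cofinite.mp hgen)).union
        (Filter.eventually_cofinite.mp a.2)).subset fun q hq => ?_
      by_contra hq'
      simp only [Set.mem_union, not_or, Set.mem_ofPred_eq, not_not] at hq'
      obtain ⟨⟨hq1, hq2⟩, y, hy : ofCompletedLocalRing q y = a q⟩ := hq'
      obtain ⟨p, rfl⟩ := mapPoint_surjective j q
      have hinj : Function.Injective (algebraMap (LocalRing p) (FunctionRing C')) := by
        by_contra h
        exact hq1 ⟨p, h, rfl⟩
      refine hq ?_
      have h2 : reduceCompletedLocalRing j p y = 0 := by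
        have h3 := h0 p
        rw [← hy, reduceLocalFunctionRing_ofCompletedLocalRing,
          ofCompletedLocalRing_eq_zero_iff_mem, (RingHom.injective_iff_ker_eq_bot _).mp hinj,
          Ideal.map_bot] at h3
        exact h3
      have h3 := mem_map_ker_of_reduceCompletedLocalRing_eq_zero j p h2
      have key : ∃ b : Fin n → CompletedLocalRing (mapPoint j p), ofCompletedLocalRing _ y =
          ∑ i, ofCompletedLocalRing _ (b i) * ofFunctionRing _ (e i) := by
        clear hy h2
        induction h3 using Submodule.span_induction with
        | mem z hz =>
          obtain ⟨r, hr, rfl⟩ := hz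
          obtain ⟨b, hb⟩ := hq2 r (algebraMap_mem_ker_reduceFunctionRing j p hr)
          refine ⟨fun i => algebraMap _ _ (b i), ?_⟩
          rw [← ofFunctionRing_algebraMap, hb, map_sum]
          refine Finset.sum_congr rfl fun i _ => ?_
          rw [map_mul, ofFunctionRing_algebraMap]
        | zero => exact ⟨0, by simp⟩
        | add z w _ _ hz hw =>
          obtain ⟨b, hb⟩ := hz
          obtain ⟨b', hb'⟩ := hw
          refine ⟨b + b', ?_⟩
          rw [map_add, hb, hb', ← Finset.sum_add_distrib]
          refine Finset.sum_congr rfl fun i _ => ?_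
          rw [Pi.add_apply, map_add, add_mul]
        | smul c z _ hz =>
          obtain ⟨b, hb⟩ := hz
          refine ⟨c • b, ?_⟩
          rw [smul_eq_mul, map_mul, hb, Finset.mul_sum]
          refine Finset.sum_congr rfl fun i _ => ?_
          rw [Pi.smul_apply, smul_eq_mul, map_mul, mul_assoc]
      obtain ⟨b, hb⟩ := key
      exact ⟨fun i => ofCompletedLocalRing _ (b i), hy.symm.trans hb, fun i => ⟨_, rfl⟩⟩
    choose b hb hbi using hall
    let β : Fin n → Adele C := fun i => ⟨fun q => b q i,
      hgood.subset fun q hq h => hq (hbi q h i)⟩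
    have ea : a = ∑ i, β i * principalAdele C (e i) := by
      have h1 := map_sum (adeleComponents C) (fun i => β i * principalAdele C (e i)) Finset.univ
      ext q
      refine (hb q).trans ?_
      have h2 := congrFun h1 q
      rw [Finset.sum_apply] at h2
      exact h2.symm
    rw [ea]
    refine sum_mem fun i _ => Ideal.mul_mem_left _ _ (Ideal.mem_map_of_mem _ ?_)
    rw [← he]
    exact Ideal.subset_span ⟨i, rfl⟩
  · rw [Ideal.map_le_iff_le_comap]
    intro f hf
    rw [Ideal.mem_comap, RingHom.mem_ker, reduceAdele_principalAdele, RingHom.mem_ker.mp hf,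
      map_zero]

end ReductionAdeles

/-! ## Reduction to the reduced curve -/

section Devissage

open IsLocalRing

variable {X : Scheme.{0}} [IsIntegral X]

/-- The reduced curve as a nilpotent extension of itself. -/
def NilpotentExtension.reduced (C : NilpotentExtension X) : NilpotentExtension X where
  scheme := X
  incl := 𝟙 X
  isClosedImmersion := inferInstance
  surjective := inferInstance
  locallyOfFiniteType := by
    have := C.locallyOfFiniteType
    have := C.isClosedImmersion
    rw [show Limits.terminal.from X = C.incl ≫ Limits.terminal.from C.scheme from
      Subsingleton.elim _ _]
    infer_instance
  quasiCompact := by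
    have := C.quasiCompact
    have := C.isClosedImmersion
    rw [show Limits.terminal.from X = C.incl ≫ Limits.terminal.from C.scheme from
      Subsingleton.elim _ _]
    infer_instance

/-- The embedding of the reduced curve. -/
def NilpotentExtension.reducedEmbedding (C : NilpotentExtension X) :
    NilpotentExtension.ClosedEmbedding C.reduced C where
  hom := C.incl
  isClosedImmersion := C.isClosedImmersion
  comm := Category.id_comp _

variable (C : NilpotentExtension X) [IsCurveOverFiniteField X]

lemma exists_prime_isNilpotent_adele : ∃ p : ℕ, p.Prime ∧ IsNilpotent (p : Adele C) := by
  obtain ⟨p, hp, h⟩ := exists_prime_eq_zero_functionField X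
  refine ⟨p, hp, ?_⟩
  have h1 : (p : FunctionRing C) ∈ RingHom.ker (reduceFunctionRing C.reducedEmbedding) := by
    rw [RingHom.mem_ker, map_natCast]
    exact h
  have h2 : IsNilpotent (p : FunctionRing C) := by
    obtain ⟨n, hn⟩ := isNilpotent_ker_reduceFunctionRing C.reducedEmbedding
    refine ⟨n, ?_⟩
    have := Ideal.pow_mem_pow h1 n
    rwa [hn] at this
  have h3 := h2.map (principalAdele C)
  rwa [map_natCast] at h3

variable {C}

/-- Cover the compact set by finitely many translates of the integral adeles, lift the centres, and
use that integral adeles lift to integral adeles. -/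
lemma exists_isCompact_image_reduceAdele {C' : NilpotentExtension X}
    (j : NilpotentExtension.ClosedEmbedding C' C) {Q' : Set (Adele C')} (hQ' : IsCompact Q') :
    ∃ Q : Set (Adele C), IsCompact Q ∧ ∀ q' ∈ Q', ∃ q ∈ Q, reduceAdele j q = q' := by
  let τ : Adele C' → Adele C' ≃ₜ Adele C' := fun b => Homeomorph.addLeft b
  have hopen : ∀ b, IsOpen (τ b '' (integralAdeles C' : Set (Adele C'))) := fun b =>
    (τ b).isOpenMap _ isOpen_integralAdeles
  obtain ⟨t, ht⟩ := hQ'.elim_finite_subcover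
    (fun b => τ b '' (integralAdeles C' : Set (Adele C'))) hopen
    fun q _ => Set.mem_iUnion.mpr ⟨q, 0, zero_mem _, add_zero _⟩
  choose lift hlift using fun a => exists_reduceAdele_eq j a
  refine ⟨⋃ b ∈ t, (fun o => lift b + o) '' (integralAdeles C : Set (Adele C)),
    t.isCompact_biUnion fun b _ => isCompact_integralAdeles.image (by fun_prop), fun q' hq' => ?_⟩
  obtain ⟨b, hb, o', ho', e⟩ := Set.mem_iUnion₂.mp (ht hq')
  obtain ⟨o, ho, hoi⟩ := exists_reduceAdele_eq j o'
  refine ⟨lift b + o, Set.mem_iUnion₂.mpr ⟨b, hb, o, hoi ho', rfl⟩, ?_⟩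
  rw [map_add, (hlift b).1, ho]
  exact e

/-- With `N` the kernel on `F`, every adele is `f + q + n` with `q` in a fixed compact set and `n ∈
N𝔸`. Multiplying by generators of `N ^ k` decomposes `N ^ k 𝔸` up to `N ^ (k + 1) 𝔸`, and `N` is
nilpotent. -/
lemma exists_isCompact_add_of_reduceAdele {C' : NilpotentExtension X}
    (j : NilpotentExtension.ClosedEmbedding C' C) {Q' : Set (Adele C')} (hQ' : IsCompact Q')
    (h : ∀ a : Adele C', ∃ f, ∃ q ∈ Q', a = principalAdele C' f + q) :
    ∃ Q : Set (Adele C), IsCompact Q ∧ ∀ a : Adele C, ∃ f, ∃ q ∈ Q, a = principalAdele C f + q := by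
  obtain ⟨Q₀, hQ₀, hQ₀'⟩ := exists_isCompact_image_reduceAdele j hQ'
  let N := RingHom.ker (reduceFunctionRing j)
  have hsucc : ∀ b : Adele C, ∃ f, ∃ q ∈ Q₀, ∃ n ∈ N.map (principalAdele C),
      b = principalAdele C f + q + n := by
    intro b
    obtain ⟨f', q', hq', e⟩ := h (reduceAdele j b)
    obtain ⟨f, rfl⟩ := reduceFunctionRing_surjective j f'
    obtain ⟨q, hq, rfl⟩ := hQ₀' q' hq'
    refine ⟨f, q, hq, b - (principalAdele C f + q), ?_, by ring⟩
    rw [← ker_reduceAdele, RingHom.mem_ker, map_sub, map_add, reduceAdele_principalAdele, e,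
      sub_self]
  -- Downward induction on `k`, with `i` the number of steps after which the power of `N` vanishes;
  -- `k = 0` is the whole ring.
  have key : ∀ i k, IsNilpotent N → N ^ (i + k) = ⊥ → ∃ Q : Set (Adele C), IsCompact Q ∧
      ∀ a ∈ (N ^ k).map (principalAdele C), ∃ f, ∃ q ∈ Q, a = principalAdele C f + q := by
    intro i
    induction i with
    | zero =>
      intro k _ hk
      refine ⟨{0}, isCompact_singleton, fun a ha => ⟨0, 0, rfl, ?_⟩⟩
      rw [zero_add] at hk
      rw [hk, Ideal.map_bot] at ha
      simpa using ha
    | succ i ih =>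
      intro k hN hk
      obtain ⟨Q₁, hQ₁, h₁⟩ := ih (k + 1) hN (by rwa [← add_assoc, add_right_comm])
      obtain ⟨n, e, he⟩ := Submodule.fg_iff_exists_fin_generating_family.mp
        (N ^ k).fg_of_isNoetherianRing
      have hQc : IsCompact ((fun x : (Fin n → Adele C) × Adele C =>
          ∑ l, x.1 l * principalAdele C (e l) + x.2) ''
            (Set.pi Set.univ (fun _ => Q₀) ×ˢ Q₁)) :=
        ((isCompact_univ_pi fun _ => hQ₀).prod hQ₁).image (by fun_prop)
      refine ⟨_, hQc, fun a ha => ?_⟩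
      have he' : Ideal.span (Set.range e) = N ^ k := he
      rw [← he', Ideal.map_span, ← Set.range_comp] at ha
      obtain ⟨b, rfl⟩ := (Submodule.mem_span_range_iff_exists_fun _).mp ha
      choose f q hq m hm hb using fun l => hsucc (b l)
      have hm' : ∑ l, m l * principalAdele C (e l) ∈ (N ^ (k + 1)).map (principalAdele C) := by
        refine sum_mem fun l _ => ?_
        rw [pow_succ', Ideal.map_mul]
        refine Ideal.mul_mem_mul (hm l) (Ideal.mem_map_of_mem _ ?_)
        rw [← he']
        exact Ideal.subset_span ⟨l, rfl⟩
      obtain ⟨g, r, hr, e'⟩ := h₁ _ hm'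
      refine ⟨∑ l, f l * e l + g, _, ⟨(q, r), ⟨fun l _ => hq l, hr⟩, rfl⟩, ?_⟩
      have h2 : ∑ l, b l • (principalAdele C ∘ e) l = ∑ l, (principalAdele C (f l * e l) +
          q l * principalAdele C (e l) + m l * principalAdele C (e l)) := by
        refine Finset.sum_congr rfl fun l _ => ?_
        rw [smul_eq_mul, Function.comp_apply, map_mul, ← add_mul, ← add_mul, ← hb l]
      rw [h2, Finset.sum_add_distrib, Finset.sum_add_distrib, e', map_add, map_sum]
      ring
  have hN := isNilpotent_ker_reduceFunctionRing j
  obtain ⟨m, hm⟩ := hN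
  obtain ⟨Q, hQ, h'⟩ := key m 0 ⟨m, hm⟩ hm
  exact ⟨Q, hQ, fun a => h' a (by rw [pow_zero, Ideal.one_eq_top, Ideal.map_top]; trivial)⟩

/-- Finitely many translates of the integral adeles cover `Q`, and two principal adeles in the same
translate differ by an integral one. -/
lemma finite_principalAdele_mem_of_isCompact
    (h : {f : FunctionRing C | principalAdele C f ∈ integralAdeles C}.Finite)
    {Q : Set (Adele C)} (hQ : IsCompact Q) : {f : FunctionRing C | principalAdele C f ∈ Q}.Finite := by
  let τ : Adele C → Adele C ≃ₜ Adele C := fun b => Homeomorph.addLeft b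
  have hopen : ∀ b, IsOpen (τ b '' (integralAdeles C : Set (Adele C))) := fun b =>
    (τ b).isOpenMap _ isOpen_integralAdeles
  obtain ⟨t, ht⟩ := hQ.elim_finite_subcover
    (fun b => τ b '' (integralAdeles C : Set (Adele C))) hopen
    fun q _ => Set.mem_iUnion.mpr ⟨q, 0, zero_mem _, add_zero _⟩
  refine (t.finite_toSet.biUnion (t := fun b => {f : FunctionRing C |
    principalAdele C f ∈ τ b '' (integralAdeles C : Set (Adele C))}) fun b _ => ?_).subset
      fun f hf => ?_
  · by_cases hne : ∃ f₀ : FunctionRing C,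
        principalAdele C f₀ ∈ τ b '' (integralAdeles C : Set (Adele C))
    · obtain ⟨f₀, o₀, ho₀, e₀⟩ := hne
      refine (h.image (fun f => f₀ + f)).subset ?_
      rintro f ⟨o, ho, e⟩
      refine ⟨f - f₀, ?_, add_sub_cancel _ _⟩
      change principalAdele C (f - f₀) ∈ integralAdeles C
      have h1 : principalAdele C (f - f₀) = o - o₀ := by
        rw [map_sub, ← e, ← e₀]
        exact add_sub_add_left_eq_sub _ _ _
      rw [h1]
      exact sub_mem ho ho₀
    · push Not at hne
      convert Set.finite_empty
      ext f
      simpa using hne f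
  · obtain ⟨b, hb, h1⟩ := Set.mem_iUnion₂.mp (ht hf)
    exact Set.mem_iUnion₂.mpr ⟨b, hb, h1⟩

/-- By Nakayama for a nilpotent ideal, `I` modulo `ker ρ • I` is a nonzero vector space over `F ⧸
ker ρ ≃ E`; take a functional on it. It serves to pass from elements of `I` to elements of the
function field of the reduced curve. -/
lemma exists_semilinear_ne_zero {F E : Type} [CommRing F] [Field E] (ρ : F →+* E)
    (hρ : Function.Surjective ρ) (hn : IsNilpotent (RingHom.ker ρ)) {I : Ideal F} (hI : I ≠ ⊥) :
    ∃ φ : I →+ E, (∀ (f : F) (x : I), φ (f • x) = ρ f * φ x) ∧ ∃ x, φ x ≠ 0 := by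
  have hmax : (RingHom.ker ρ).IsMaximal := RingHom.ker_isMaximal_of_surjective ρ hρ
  let := Ideal.Quotient.field (RingHom.ker ρ)
  have htop : (RingHom.ker ρ • ⊤ : Submodule F I) ≠ ⊤ := by
    intro h
    have h1 : ∀ n : ℕ, (RingHom.ker ρ ^ n • ⊤ : Submodule F I) = ⊤ := by
      intro n
      induction n with
      | zero => simp
      | succ n ih => rw [pow_succ, mul_smul, h, ih]
    obtain ⟨n, hn⟩ := hn
    have h2 := h1 n
    rw [hn, Submodule.zero_eq_bot, Submodule.bot_smul] at h2
    refine hI ((Submodule.eq_bot_iff _).mpr fun x hx => ?_)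
    have h3 : (⟨x, hx⟩ : I) ∈ (⊥ : Submodule F I) := h2 ▸ trivial
    exact congrArg Subtype.val ((Submodule.mem_bot F).mp h3)
  obtain ⟨x, hx⟩ : ∃ x : I, x ∉ (RingHom.ker ρ • ⊤ : Submodule F I) := by
    by_contra! h
    exact htop (eq_top_iff.mpr fun x _ => h x)
  let v : I ⧸ (RingHom.ker ρ • ⊤ : Submodule F I) := Submodule.Quotient.mk x
  have hv : v ≠ 0 := fun h => hx ((Submodule.Quotient.mk_eq_zero _).mp h)
  have h1 := (Module.forall_dual_apply_eq_zero_iff (F ⧸ RingHom.ker ρ) v).not.mpr hv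
  push Not at h1
  obtain ⟨ψ, hψ⟩ := h1
  refine ⟨(RingHom.kerLift ρ).toAddMonoidHom.comp (ψ.toAddMonoidHom.comp
    (Submodule.mkQ (RingHom.ker ρ • ⊤ : Submodule F I)).toAddMonoidHom), ?_, x, ?_⟩
  · intro f y
    change RingHom.kerLift ρ (ψ ((Ideal.Quotient.mk (RingHom.ker ρ) f) •
      (Submodule.Quotient.mk y : I ⧸ (RingHom.ker ρ • ⊤ : Submodule F I)))) = _
    rw [map_smul, smul_eq_mul, map_mul]
    rfl
  · exact fun h => hψ (RingHom.kerLift_injective ρ (h.trans (map_zero _).symm))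

/-- Integral elements of `I` are integral combinations of fixed generators at almost all points,
where the images of the generators are integral too. At each remaining point the denominators are
bounded. The compact set is a multiple `V * O` of the integral adeles. -/
lemma exists_isCompact_semilinear {C' : NilpotentExtension X}
    (j : NilpotentExtension.ClosedEmbedding C' C) {I : Ideal (FunctionRing C)}
    (φ : I →+ FunctionRing C') (hφ : ∀ f x, φ (f • x) = reduceFunctionRing j f * φ x) :
    ∃ Q : Set (Adele C'), IsCompact Q ∧ ∀ x : I, principalAdele C x ∈ integralAdeles C →
      principalAdele C' (φ x) ∈ Q := by
  have hred : ∀ (p : ClosedPoint C') (r : LocalRing (mapPoint j p)),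
      reduceFunctionRing j (algebraMap _ _ r) = algebraMap _ _ (reduceLocalRing j p r) :=
    fun p r => RingHom.congr_fun (reduceLocalRing_compat j p) r
  have hsum : ∀ {n : ℕ} (p : ClosedPoint C') (b : Fin n → LocalRing (mapPoint j p)) (e : Fin n → I)
      (x : I), (x : FunctionRing C) = ∑ i, algebraMap _ (FunctionRing C) (b i) * (e i : FunctionRing C) →
      φ x = ∑ i, algebraMap _ _ (reduceLocalRing j p (b i)) * φ (e i) := by
    intro n p b e x hx
    have h1 : x = ∑ i, algebraMap _ (FunctionRing C) (b i) • e i := by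
      apply Subtype.ext
      rw [hx]
      push_cast
      rfl
    rw [h1, map_sum]
    exact Finset.sum_congr rfl fun i _ => by rw [hφ, hred]
  obtain ⟨n, e, he, hgen⟩ := exists_generators I
  have heI : ∀ i, e i ∈ I := fun i => he ▸ Ideal.subset_span ⟨i, rfl⟩
  let good : Set (ClosedPoint C') := {p | ∀ x : I,
    ofFunctionRing (mapPoint j p) x ∈ integerRing (mapPoint j p) →
      ofFunctionRing p (φ x) ∈ integerRing p}
  have hgood : goodᶜ.Finite := by
    have h1 : ∀ᶠ p : ClosedPoint C' in Filter.cofinite, ∀ i,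
        ∃ r, φ ⟨e i, heI i⟩ = algebraMap (LocalRing p) _ r :=
      Filter.eventually_all.mpr fun i => eventually_exists_eq_algebraMap _
    have h2 := (mapPoint_injective j).tendsto_cofinite.eventually hgen
    refine Set.Finite.subset (Filter.eventually_cofinite.mp (h1.and h2)) fun p hp hp' => hp ?_
    intro x hx
    obtain ⟨r, hr⟩ := exists_eq_algebraMap_of_mem_integerRing _ hx
    choose c hc using hp'.1
    obtain ⟨b, hb⟩ := hp'.2 r (hr ▸ x.2)
    rw [hsum p b (fun i => ⟨e i, heI i⟩) x (hr.trans hb), map_sum]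
    refine sum_mem fun i _ => ?_
    rw [hc, ← map_mul, ofFunctionRing_algebraMap]
    exact ⟨_, rfl⟩
  have hall : ∀ p : ClosedPoint C', ∃ v : LocalFunctionRing p, (p ∈ good → v = 1) ∧
      ∀ x : I, ofFunctionRing (mapPoint j p) x ∈ integerRing (mapPoint j p) →
        ∃ o ∈ integerRing p, ofFunctionRing p (φ x) = v * o := by
    intro p
    by_cases hp : p ∈ good
    · exact ⟨1, fun _ => rfl, fun x hx => ⟨_, hp x hx, (one_mul _).symm⟩⟩
    -- At a bad point, take generators of the ideal of the local ring defined by `I`. The product of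
    -- the denominators of their images under `φ` bounds all denominators.
    · obtain ⟨m, r, hr⟩ := Submodule.fg_iff_exists_fin_generating_family.mp
        (I.comap (algebraMap (LocalRing (mapPoint j p)) (FunctionRing C))).fg_of_isNoetherianRing
      have hrI : ∀ k, algebraMap _ (FunctionRing C) (r k) ∈ I := fun k => by
        have h1 : r k ∈ I.comap (algebraMap (LocalRing (mapPoint j p)) (FunctionRing C)) :=
          hr ▸ Submodule.subset_span ⟨k, rfl⟩
        exact h1
      choose s hs c hc using fun k => exists_mul_eq_algebraMap p (φ ⟨_, hrI k⟩)
      have hsp : (∏ k, s k) ∉ nilradical (LocalRing p) := by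
        intro h
        obtain ⟨k, -, hk⟩ := (Ideal.IsPrime.prod_mem_iff).mp h
        exact hs k hk
      obtain ⟨t, ht⟩ := (isUnit_algebraMap_functionRing p hsp).exists_left_inv
      refine ⟨ofFunctionRing p t, fun h => (hp h).elim, fun x hx => ?_⟩
      refine ⟨ofFunctionRing p (algebraMap _ _ (∏ k, s k) * φ x), ?_, ?_⟩
      · obtain ⟨y, hy⟩ := exists_eq_algebraMap_of_mem_integerRing _ hx
        have hyI : y ∈ Submodule.span (LocalRing (mapPoint j p)) (Set.range r) := by
          rw [hr, Ideal.mem_comap, ← hy]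
          exact x.2
        obtain ⟨b, hb⟩ := (Submodule.mem_span_range_iff_exists_fun _).mp hyI
        rw [hsum p b (fun k => ⟨_, hrI k⟩) x (by rw [hy, ← hb, map_sum]; simp), Finset.mul_sum,
          map_sum]
        refine sum_mem fun k _ => ?_
        classical
        have h1 : algebraMap (LocalRing p) (FunctionRing C') (∏ k, s k) *
            (algebraMap _ _ (reduceLocalRing j p (b k)) * φ ⟨_, hrI k⟩) = algebraMap _ _
              (c k * (∏ l ∈ Finset.univ.erase k, s l) * reduceLocalRing j p (b k)) := by
          rw [← Finset.mul_prod_erase _ _ (Finset.mem_univ k), map_mul, map_mul, map_mul, ← hc]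
          ring
        rw [h1, ofFunctionRing_algebraMap]
        exact ⟨_, rfl⟩
      · rw [← map_mul, ← mul_assoc, ht, one_mul]
  choose v hv hvx using hall
  let V : Adele C' := ⟨v, hgood.subset fun p hp h => hp (by
    change v p ∈ integerRing p
    rw [hv p h]
    exact one_mem _)⟩
  refine ⟨(fun o => V * o) '' (integralAdeles C' : Set (Adele C')),
    isCompact_integralAdeles.image (by fun_prop), fun x hx => ?_⟩
  have hx' := fun p => hvx p x (mem_integralAdeles_iff.mp hx (mapPoint j p))
  choose o ho hox using hx'
  refine ⟨⟨o, Filter.Eventually.of_forall ho⟩, mem_integralAdeles_iff.mpr ho, ?_⟩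
  ext p
  exact (hox p).symm

/-- Induction over the ideals of the Artinian ring `F`. A nonzero semilinear map `φ` on `I` sends
integral elements into a finite set, and its fibres are translates of the integral elements of a
strictly smaller ideal. -/
lemma finite_principalAdele_mem_of_reduced
    (h : {f : FunctionRing C.reduced | principalAdele C.reduced f ∈
      integralAdeles C.reduced}.Finite) :
    {f : FunctionRing C | principalAdele C f ∈ integralAdeles C}.Finite := by
  let j := C.reducedEmbedding
  let : Field (FunctionRing C.reduced) := inferInstanceAs (Field X.functionField)
  have hn := isNilpotent_ker_reduceFunctionRing j
  have hart : IsArtinianRing (FunctionRing C) := by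
    have : IsLocalRing (FunctionRing C) :=
      inferInstanceAs (IsLocalRing (C.scheme.presheaf.stalk _))
    rw [isArtinianRing_iff_isNilpotent_maximalIdeal]
    have h1 : RingHom.ker (reduceFunctionRing j) = IsLocalRing.maximalIdeal _ :=
      IsLocalRing.eq_maximalIdeal
        (RingHom.ker_isMaximal_of_surjective _ (reduceFunctionRing_surjective j))
    rwa [← h1]
  have key : ∀ I : Ideal (FunctionRing C),
      {f : FunctionRing C | f ∈ I ∧ principalAdele C f ∈ integralAdeles C}.Finite := by
    intro I
    induction I using WellFoundedLT.induction with
    | ind I ih =>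
    by_cases hI : I = ⊥
    · refine (Set.finite_singleton 0).subset fun f hf => ?_
      rw [hI] at hf
      exact hf.1
    · obtain ⟨φ, hφ, x₀, hx₀⟩ := exists_semilinear_ne_zero (reduceFunctionRing j)
        (reduceFunctionRing_surjective j) hn hI
      obtain ⟨Q, hQ, hQφ⟩ := exists_isCompact_semilinear j φ hφ
      have hfin := finite_principalAdele_mem_of_isCompact h hQ
      let I' : Ideal (FunctionRing C) :=
        { carrier := {x | ∃ h : x ∈ I, φ ⟨x, h⟩ = 0}
          zero_mem' := ⟨zero_mem _, map_zero φ⟩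
          add_mem' := fun {a b} ⟨ha, ha'⟩ ⟨hb, hb'⟩ => ⟨add_mem ha hb, by
            have h1 := map_add φ ⟨a, ha⟩ ⟨b, hb⟩
            rw [ha', hb', add_zero] at h1
            exact h1⟩
          smul_mem' := fun c x ⟨hx, hx'⟩ => ⟨Ideal.mul_mem_left _ _ hx, by
            have h1 := hφ c ⟨x, hx⟩
            rw [hx', mul_zero] at h1
            exact h1⟩ }
      have hlt : I' < I := by
        refine lt_of_le_of_ne (fun x hx => hx.1) fun e => hx₀ ?_
        have h1 : (x₀ : FunctionRing C) ∈ I' := e.ge x₀.2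
        exact h1.2
      classical
      let Φ : FunctionRing C → FunctionRing C.reduced := fun x =>
        if h : x ∈ I then φ ⟨x, h⟩ else 0
      refine Set.Finite.of_finite_fibers Φ (hfin.subset ?_) ?_
      · rintro _ ⟨x, hx, rfl⟩
        simp only [Φ, dif_pos hx.1]
        exact hQφ ⟨x, hx.1⟩ hx.2
      · rintro _ ⟨x, hx, rfl⟩
        refine ((ih I' hlt).image (fun z => x + z)).subset ?_
        rintro z ⟨hz, hzx⟩
        refine ⟨z - x, ⟨⟨sub_mem hz.1 hx.1, ?_⟩, ?_⟩, add_sub_cancel _ _⟩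
        · have h1 : Φ z = Φ x := hzx
          simp only [Φ, dif_pos hz.1, dif_pos hx.1] at h1
          have h2 := map_sub φ ⟨z, hz.1⟩ ⟨x, hx.1⟩
          rw [h1, sub_self] at h2
          exact h2
        · rw [map_sub]
          exact sub_mem hz.2 hx.2
  refine (key ⊤).subset fun f hf => ⟨trivial, hf⟩

end Devissage

/-! ## Noether normalization of affine curves -/

section NoetherNormalization

/-- Noether normalization, where at most one variable can occur: with two, the prime generated by
one variable would lie under a nonzero prime, which is maximal by hypothesis, and would itself be
maximal. With no variable, `t = 0` works. -/
lemma exists_forall_isIntegral_aeval (K B : Type) [Field K] [CommRing B] [IsDomain B] [Algebra K B]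
    [Algebra.FiniteType K B] (hB : ∀ P : Ideal B, P.IsPrime → P ≠ ⊥ → P.IsMaximal) :
    ∃ t : B, ∀ b : B, (Polynomial.aeval (R := K) t).toRingHom.IsIntegralElem b := by
  obtain ⟨s, g, hg, hi⟩ := exists_integral_inj_algHom_of_fg K B
  have hs : s ≤ 1 := by
    by_contra! hs
    let i0 : Fin s := ⟨0, by omega⟩
    let i1 : Fin s := ⟨1, by omega⟩
    let P : Ideal (MvPolynomial (Fin s) K) := Ideal.span {MvPolynomial.X i0}
    have hP : P.IsPrime := by
      rw [Ideal.span_singleton_prime (MvPolynomial.X_ne_zero i0)]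
      exact MvPolynomial.X_prime
    let := g.toRingHom.toAlgebra
    have : Algebra.IsIntegral (MvPolynomial (Fin s) K) B := ⟨hi⟩
    obtain ⟨Q, -, hQ, e⟩ := Ideal.exists_ideal_over_prime_of_isIntegral P (⊥ : Ideal B) (by
      intro x hx
      have h : g x = 0 := hx
      rw [map_eq_zero_iff g hg] at h
      rw [h]
      exact P.zero_mem)
    have hQ0 : Q ≠ ⊥ := by
      rintro rfl
      have h : MvPolynomial.X i0 ∈ P := Ideal.mem_span_singleton_self _
      rw [← e] at h
      exact MvPolynomial.X_ne_zero i0 ((map_eq_zero_iff g hg).mp h)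
    have := hB Q hQ hQ0
    have hPm : P.IsMaximal := by
      rw [← e]
      exact Ideal.isMaximal_comap_of_isIntegral_of_isMaximal Q
    let c : MvPolynomial (Fin s) K →+* K := MvPolynomial.constantCoeff
    have hle : P ≤ RingHom.ker c := by
      rw [Ideal.span_singleton_le_iff_mem, RingHom.mem_ker]
      exact MvPolynomial.constantCoeff_X _ _
    have hc : RingHom.ker c ≠ ⊤ := RingHom.ker_ne_top c
    have h1 : MvPolynomial.X i1 ∈ P := by
      rw [hPm.eq_of_le hc hle, RingHom.mem_ker]
      exact MvPolynomial.constantCoeff_X _ _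
    rw [Ideal.mem_span_singleton, MvPolynomial.X_dvd_X] at h1
    simp [i0, i1] at h1
  have key : ∃ t : B, ∀ x : MvPolynomial (Fin s) K, ∃ q : Polynomial K, g x = q.aeval t := by
    interval_cases s
    · refine ⟨0, fun x => ⟨Polynomial.C (MvPolynomial.constantCoeff x), ?_⟩⟩
      obtain ⟨c, rfl⟩ := MvPolynomial.C_surjective (Fin 0) x
      simp
    · refine ⟨g (MvPolynomial.X 0), fun x =>
        ⟨MvPolynomial.aeval (fun _ => Polynomial.X) x, ?_⟩⟩
      have h : g = (Polynomial.aeval (g (MvPolynomial.X 0))).comp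
          (MvPolynomial.aeval (fun _ => Polynomial.X)) := by
        ext i
        simp [Subsingleton.elim i 0]
      exact congrArg (fun φ => φ x) h
  obtain ⟨t, ht⟩ := key
  refine ⟨t, fun b => ?_⟩
  obtain ⟨p, hp, hpb⟩ := hi b
  choose q hq using ht
  let S : Subring B := (Polynomial.aeval (R := K) t).toRingHom.range
  let f : MvPolynomial (Fin s) K →+* S := g.toRingHom.codRestrict S fun x => ⟨q x, (hq x).symm⟩
  have h1 : IsIntegral S b := by
    refine ⟨p.map f, hp.map f, ?_⟩
    rw [Polynomial.eval₂_map]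
    exact hpb
  obtain ⟨r, hr, hrb⟩ := h1
  have hl : r ∈ Polynomial.lifts (Polynomial.aeval (R := K) t).toRingHom.rangeRestrict := by
    rw [Polynomial.lifts_iff_coeff_lifts]
    exact fun n => RingHom.rangeRestrict_surjective _ _
  obtain ⟨r', hr', -, hm⟩ := Polynomial.lifts_and_degree_eq_and_monic hl hr
  refine ⟨r', hm, ?_⟩
  rw [← hr', Polynomial.eval₂_map] at hrb
  exact hrb

/-- An element algebraic over `K[t]` divides a nonzero element of `K[t]`, so denominators can be
taken to be monic polynomials in `t`. -/
lemma exists_mul_aeval_eq {K B : Type} [Field K] [CommRing B] [IsDomain B] [Algebra K B] {t : B}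
    (ht : ∀ b : B, (Polynomial.aeval (R := K) t).toRingHom.IsIntegralElem b) {y : B} (hy : y ≠ 0) :
    ∃ (p : Polynomial K) (z : B), p.Monic ∧ p.aeval t ≠ 0 ∧ p.aeval t = y * z := by
  let S : Subring B := (Polynomial.aeval (R := K) t).toRingHom.range
  have hi : IsIntegral S y := by
    obtain ⟨p, hp, hpy⟩ := ht y
    refine ⟨p.map (Polynomial.aeval (R := K) t).toRingHom.rangeRestrict, hp.map _, ?_⟩
    rw [Polynomial.eval₂_map]
    exact hpy
  obtain ⟨⟨_, p, rfl⟩, hr, z, e⟩ :=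
    hi.isAlgebraic.exists_nonzero_dvd (mem_nonZeroDivisors_of_ne_zero hy)
  have hp : p.aeval t ≠ 0 := fun h => hr (Subtype.ext h)
  change p.aeval t = y * z at e
  have hp0 : p ≠ 0 := by
    rintro rfl
    simp at hp
  have hl : p.leadingCoeff ≠ 0 := by simpa using hp0
  refine ⟨p * Polynomial.C p.leadingCoeff⁻¹, z * algebraMap K B p.leadingCoeff⁻¹,
    Polynomial.monic_mul_leadingCoeff_inv hp0, ?_, ?_⟩
  · rw [map_mul, Polynomial.aeval_C]
    refine mul_ne_zero hp ?_
    rw [Ne, map_eq_zero_iff _ (algebraMap K B).injective]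
    exact inv_ne_zero hl
  · rw [map_mul, Polynomial.aeval_C, e, mul_assoc]

end NoetherNormalization

/-! ### Approximation at finitely many absolute values -/

section Approximation

variable {E : Type} [Field E]

/-- The valuation ring of a nonarchimedean absolute value. -/
def absIntegers (v : AbsoluteValue E ℝ) (hv : IsNonarchimedean v) : ValuationSubring E where
  carrier := {x | v x ≤ 1}
  mul_mem' {x y} hx hy := by
    change v (x * y) ≤ 1
    rw [map_mul]
    exact mul_le_one₀ hx (v.nonneg y) hy
  one_mem' := (map_one v).le
  add_mem' {x y} hx hy := (hv x y).trans (max_le hx hy)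
  zero_mem' := by
    change v 0 ≤ 1
    simp
  neg_mem' {x} hx := by
    change v (-x) ≤ 1
    rwa [map_neg_eq_map]
  mem_or_inv_mem' x := by
    change v x ≤ 1 ∨ v x⁻¹ ≤ 1
    rw [map_inv₀]
    rcases le_or_gt (v x) 1 with h | h
    · exact Or.inl h
    · exact Or.inr (inv_le_one_of_one_le₀ h.le)

lemma absoluteValue_sub_le {v : AbsoluteValue E ℝ} (hv : IsNonarchimedean v) (x y : E) :
    v (x - y) ≤ max (v x) (v y) := by
  have h := hv x (-y)
  rwa [map_neg_eq_map, ← sub_eq_add_neg] at h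

variable {K B : Type} [Field K] [Finite K] [CommRing B] [IsDomain B] [Algebra K B]
  [Algebra B E] [IsFractionRing B E]

/-- Nonzero elements of a finite field are roots of unity. -/
lemma absoluteValue_algebraMap_le_one (v : AbsoluteValue E ℝ) (c : K) :
    v (algebraMap B E (algebraMap K B c)) ≤ 1 := by
  rcases eq_or_ne c 0 with rfl | hc
  · simp
  · obtain ⟨n, hn, e⟩ := (isOfFinOrder_of_finite (Units.mk0 c hc)).exists_pow_eq_one
    have e' : c ^ n = 1 := congrArg Units.val e
    have h : v (algebraMap B E (algebraMap K B c)) ^ n = 1 := by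
      rw [← map_pow, ← map_pow, ← map_pow, e', map_one, map_one, map_one]
    exact ((pow_eq_one_iff_of_nonneg (v.nonneg _) hn.ne').mp h).le

/-- If `t` were in the valuation ring, so would be `K[t]`. Being integrally closed, the valuation
ring would then contain all of `B`. -/
lemma one_lt_of_forall_isIntegral {t : B}
    (ht : ∀ b : B, (Polynomial.aeval (R := K) t).toRingHom.IsIntegralElem b)
    {v : AbsoluteValue E ℝ} (hv : IsNonarchimedean v) (h : ∃ b : B, 1 < v (algebraMap B E b)) :
    1 < v (algebraMap B E t) := by
  by_contra! ht1
  obtain ⟨b, hb⟩ := h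
  refine hb.not_ge ?_
  have hp : ∀ p : Polynomial K, algebraMap B E (p.aeval t) ∈ absIntegers v hv := by
    intro p
    induction p using Polynomial.induction_on' with
    | add p q hp hq =>
      rw [map_add, map_add]
      exact add_mem hp hq
    | monomial n c =>
      rw [Polynomial.aeval_monomial, map_mul, map_pow]
      exact mul_mem (absoluteValue_algebraMap_le_one v c) (pow_mem ht1 n)
  let φ : Polynomial K →+* absIntegers v hv :=
    ((algebraMap B E).comp (Polynomial.aeval (R := K) t).toRingHom).codRestrict _ hp
  have hi : IsIntegral (absIntegers v hv) (algebraMap B E b) := by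
    obtain ⟨p, hpm, e⟩ := ht b
    refine ⟨p.map φ, hpm.map φ, ?_⟩
    rw [Polynomial.eval₂_map]
    change Polynomial.eval₂ ((algebraMap B E).comp (Polynomial.aeval (R := K) t).toRingHom) _ p = 0
    rw [← Polynomial.hom_eval₂, e, map_zero]
  obtain ⟨y, hy⟩ := IsIntegrallyClosed.isIntegral_iff.mp hi
  rw [← hy]
  exact y.2

variable {ι : Type} [Finite ι] {v : ι → AbsoluteValue E ℝ}

/-- Weak approximation for a finite family of nonarchimedean absolute values. -/
lemma exists_forall_absoluteValue_sub_le (hn : ∀ i, (v i).IsNontrivial)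
    (hp : Pairwise fun i j => ¬ (v i).IsEquiv (v j)) (c : ι → E) :
    ∃ l : E, ∀ i, v i (c i - l) ≤ 1 := by
  have := Fintype.ofFinite ι
  obtain ⟨l, hl⟩ := Metric.denseRange_iff.mp (AbsoluteValue.denseRange_algebraMap_pi hn hp)
    (fun i => (WithAbs.equiv (v i)).symm (c i)) 1 one_pos
  refine ⟨l, fun i => ?_⟩
  have h := (dist_pi_lt_iff one_pos).mp hl i
  rw [dist_eq_norm] at h
  exact h.le

/-- Only finitely many tuples of local representatives occur; choose one simultaneously integral
element for each tuple. The ultrametric inequality makes it a representative for every element with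
the same tuple. -/
lemma exists_finite_forall_absoluteValue_sub_le (hna : ∀ i, IsNonarchimedean (v i)) {u : E}
    (hf : ∀ i, ∃ T : Set E, T.Finite ∧ ∀ c, v i c ≤ 1 → ∃ t ∈ T, v i (c - t) ≤ v i u) :
    ∃ T : Set E, T.Finite ∧ (∀ c ∈ T, ∀ i, v i c ≤ 1) ∧
      ∀ c, (∀ i, v i c ≤ 1) → ∃ t ∈ T, ∀ i, v i (c - t) ≤ v i u := by
  choose T hT h using hf
  choose! f hf hfu using h
  let R : Set E := {c | ∀ i, v i c ≤ 1}
  let F : E → ι → E := fun c i => f i c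
  have hFR : (F '' R).Finite := by
    refine (Set.Finite.pi' hT).subset ?_
    rintro _ ⟨c, hc, rfl⟩ i
    exact hf i c (hc i)
  obtain ⟨T', hT'R, hb⟩ := Set.exists_subset_bijOn R F
  refine ⟨T', hb.finite_iff_finite.mpr hFR, hT'R, fun c hc => ?_⟩
  obtain ⟨c', hc', e⟩ := hb.surjOn ⟨c, hc, rfl⟩
  refine ⟨c', hc', fun i => ?_⟩
  have e' : f i c' = f i c := congrFun e i
  have h := absoluteValue_sub_le (hna i) (c - f i c) (c' - f i c')
  rw [e', sub_sub_sub_cancel_right, ← e'] at h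
  exact h.trans (max_le (e' ▸ hfu i c (hc i)) (hfu i c' (hT'R hc' i)))

/-- Write `c = x / y` and `y z = p(t)` with `p` monic of degree `d`. At every `v i` the quotient
`p(t) / t ^ d` is `1` up to `1 / t`, so `c` is approximated by `c p(t) / t ^ d = x z / t ^ d`, which
equals `x z t ^ (n - d) / t ^ n`. -/
lemma exists_sub_mul_pow_le {t : B}
    (ht : ∀ b : B, (Polynomial.aeval (R := K) t).toRingHom.IsIntegralElem b)
    (hna : ∀ i, IsNonarchimedean (v i)) (hvt : ∀ i, 1 < v i (algebraMap B E t)) {c : E}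
    (hc : ∀ i, v i c ≤ 1) : ∃ d : ℕ, ∀ n, d ≤ n → ∃ b : B, ∀ i,
      v i (c - algebraMap B E b * (algebraMap B E t)⁻¹ ^ n) ≤ v i (algebraMap B E t)⁻¹ := by
  obtain ⟨x, y, hy, rfl⟩ := IsFractionRing.div_surjective (A := B) c
  obtain ⟨p, z, hpm, hp0, hp⟩ := exists_mul_aeval_eq ht (nonZeroDivisors.ne_zero hy)
  let τ := algebraMap B E t
  let P := algebraMap B E (p.aeval t)
  let d := p.natDegree
  have hinj : Function.Injective (algebraMap B E) := IsFractionRing.injective B E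
  have hP0 : P ≠ 0 := by
    rwa [Ne, map_eq_zero_iff _ hinj]
  have hy0 : algebraMap B E y ≠ 0 := by
    rw [Ne, map_eq_zero_iff _ hinj]
    exact nonZeroDivisors.ne_zero hy
  refine ⟨d, fun n hn => ⟨x * z * t ^ (n - d), fun i => ?_⟩⟩
  have hτ0 : τ ≠ 0 := fun h => by
    have := hvt i
    rw [show algebraMap B E t = 0 from h, map_zero] at this
    exact absurd this (by norm_num)
  have hu1 : v i τ⁻¹ ≤ 1 := by
    rw [map_inv₀]
    exact inv_le_one_of_one_le₀ (hvt i).le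
  have hP : P * τ⁻¹ ^ d - 1 =
      ∑ j ∈ Finset.range d, algebraMap B E (algebraMap K B (p.coeff j)) * τ⁻¹ ^ (d - j) := by
    have e : P = τ ^ d + ∑ j ∈ Finset.range d,
        algebraMap B E (algebraMap K B (p.coeff j)) * τ ^ j := by
      conv_lhs => simp only [P]; rw [hpm.as_sum]
      simp [τ, d]
    rw [e, add_mul, ← mul_pow, mul_inv_cancel₀ hτ0, one_pow, add_sub_cancel_left, Finset.sum_mul]
    refine Finset.sum_congr rfl fun j hj => ?_
    have hj' : j ≤ d := (Finset.mem_range.mp hj).le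
    rw [mul_assoc]
    congr 1
    rw [show τ⁻¹ ^ d = τ⁻¹ ^ j * τ⁻¹ ^ (d - j) by rw [← pow_add, Nat.add_sub_of_le hj'],
      ← mul_assoc, ← mul_pow, mul_inv_cancel₀ hτ0, one_pow, one_mul]
  have hle : v i (P * τ⁻¹ ^ d - 1) ≤ v i τ⁻¹ := by
    rw [hP]
    refine Finset.sum_induction _ (fun x => v i x ≤ v i τ⁻¹)
      (fun a b ha hb => (hna i a b).trans (max_le ha hb)) (by simp) fun j hj => ?_
    rw [map_mul, map_pow]
    have h1 : v i τ⁻¹ ^ (d - j) ≤ v i τ⁻¹ :=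
      pow_le_of_le_one ((v i).nonneg _) hu1 (Nat.sub_ne_zero_of_lt (Finset.mem_range.mp hj))
    exact (mul_le_of_le_one_left (pow_nonneg ((v i).nonneg _) _)
      (absoluteValue_algebraMap_le_one (v i) _)).trans h1
  have e : algebraMap B E x / algebraMap B E y -
      algebraMap B E (x * z * t ^ (n - d)) * τ⁻¹ ^ n =
      -(algebraMap B E x / algebraMap B E y * (P * τ⁻¹ ^ d - 1)) := by
    have h1 : algebraMap B E x / algebraMap B E y * P = algebraMap B E x * algebraMap B E z := by
      simp only [P]
      rw [hp, map_mul]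
      field_simp
    have h2 : τ⁻¹ ^ n = τ⁻¹ ^ (n - d) * τ⁻¹ ^ d := by
      rw [← pow_add, Nat.sub_add_cancel hn]
    have h3 : τ ^ (n - d) * τ⁻¹ ^ (n - d) = 1 := by
      rw [← mul_pow, mul_inv_cancel₀ hτ0, one_pow]
    have h4 : algebraMap B E (x * z * t ^ (n - d)) =
      algebraMap B E x * algebraMap B E z * τ ^ (n - d) := by simp [τ]
    rw [h4, h2, ← h1]
    linear_combination (-(algebraMap B E x / algebraMap B E y * P * τ⁻¹ ^ d)) * h3
  refine (congrArg (v i) e).le.trans ?_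
  rw [map_neg_eq_map, map_mul]
  exact (mul_le_of_le_one_left ((v i).nonneg _) (hc i)).trans hle

/-- Approximation of a family of elements at the points at infinity of an affine curve by a
regular function, up to a bounded error. -/
lemma exists_forall_exists_absoluteValue_le
    (hB : ∃ t : B, ∀ b : B, (Polynomial.aeval (R := K) t).toRingHom.IsIntegralElem b)
    (hn : ∀ i, (v i).IsNontrivial) (hp : Pairwise fun i j => ¬ (v i).IsEquiv (v j))
    (hna : ∀ i, IsNonarchimedean (v i)) (hvB : ∀ i, ∃ b : B, 1 < v i (algebraMap B E b))
    (hf : ∀ u ≠ 0, ∀ i, ∃ T : Set E, T.Finite ∧ ∀ c, v i c ≤ 1 → ∃ t ∈ T, v i (c - t) ≤ v i u) :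
    ∃ w : E, w ≠ 0 ∧ (∀ i, v i w ≤ 1) ∧ ∀ c : ι → E, ∃ b : B, ∀ i,
      v i (w * (c i - algebraMap B E b)) ≤ 1 := by
  rcases isEmpty_or_nonempty ι with hι | hι
  · exact ⟨1, one_ne_zero, fun i => isEmptyElim i, fun c => ⟨0, fun i => isEmptyElim i⟩⟩
  obtain ⟨t, ht⟩ := hB
  have hvt : ∀ i, 1 < v i (algebraMap B E t) := fun i =>
    one_lt_of_forall_isIntegral ht (hna i) (hvB i)
  let τ := algebraMap B E t
  have hτ0 : τ ≠ 0 := fun h => by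
    have := hvt hι.some
    rw [show algebraMap B E t = 0 from h, map_zero] at this
    exact absurd this (by norm_num)
  have hu1 : ∀ i, v i τ⁻¹ ≤ 1 := fun i => by
    rw [map_inv₀]
    exact inv_le_one_of_one_le₀ (hvt i).le
  obtain ⟨T, hT, hT1, hTu⟩ :=
    exists_finite_forall_absoluteValue_sub_le hna (hf τ⁻¹ (inv_ne_zero hτ0))
  have hd : ∀ c ∈ T, ∃ d : ℕ, ∀ n, d ≤ n → ∃ b : B, ∀ i,
      v i (c - algebraMap B E b * τ⁻¹ ^ n) ≤ v i τ⁻¹ := fun c hc =>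
    exists_sub_mul_pow_le ht hna hvt (hT1 c hc)
  choose! d hd using hd
  obtain ⟨N, hN⟩ := (hT.image d).bddAbove
  -- The threshold from the preceding approximation depends on `c`. Replacing `c` by one of finitely
  -- many representatives makes it uniform.
  have key : ∀ n, N ≤ n → ∀ c, (∀ i, v i c ≤ 1) → ∃ b : B, ∀ i,
      v i (c - algebraMap B E b * τ⁻¹ ^ n) ≤ v i τ⁻¹ := by
    intro n hn c hc
    obtain ⟨c', hc', h⟩ := hTu c hc
    obtain ⟨b, hb⟩ := hd c' hc' n ((hN ⟨c', hc', rfl⟩).trans hn)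
    refine ⟨b, fun i => ?_⟩
    have := hna i (c - c') (c' - algebraMap B E b * τ⁻¹ ^ n)
    rw [sub_add_sub_cancel] at this
    exact this.trans (max_le (h i) (hb i))
  -- Subtracting a suitable element of `B` lowers the pole order, measured in powers of `t`, by one;
  -- this can be repeated down to the uniform threshold `N`.
  have desc : ∀ m : ℕ, ∀ l : E, (∀ i, v i (l * τ⁻¹ ^ (N + m)) ≤ 1) → ∃ b : B, ∀ i,
      v i ((l - algebraMap B E b) * τ⁻¹ ^ N) ≤ 1 := by
    intro m
    induction m with
    | zero => exact fun l hl => ⟨0, fun i => by simpa using hl i⟩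
    | succ m ih =>
      intro l hl
      obtain ⟨b, hb⟩ := key (N + (m + 1)) (by omega) _ hl
      obtain ⟨b', hb'⟩ := ih (l - algebraMap B E b) fun i => by
        have h := hb i
        rw [← sub_mul, ← add_assoc, pow_succ, ← mul_assoc, map_mul] at h
        refine le_of_mul_le_mul_right (h.trans (one_mul _).ge) ?_
        exact (v i).pos (inv_ne_zero hτ0)
      refine ⟨b + b', fun i => ?_⟩
      have h := hb' i
      rwa [sub_sub, ← map_add] at h
  refine ⟨τ⁻¹ ^ N, pow_ne_zero _ (inv_ne_zero hτ0), fun i => ?_, fun c => ?_⟩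
  · rw [map_pow]
    exact pow_le_one₀ ((v i).nonneg _) (hu1 i)
  -- Weak approximation replaces the family `c` by a single element of the field, to which the
  -- descent applies.
  obtain ⟨l, hl⟩ := exists_forall_absoluteValue_sub_le hn hp c
  have hm : ∃ m : ℕ, ∀ i, v i (l * τ⁻¹ ^ (N + m)) ≤ 1 := by
    have h1 : ∀ i, ∃ m : ℕ, v i l ≤ v i τ ^ m := fun i =>
      (pow_unbounded_of_one_lt (v i l) (hvt i)).imp fun m hm => hm.le
    choose m hm using h1
    obtain ⟨M, hM⟩ := (Set.finite_range m).bddAbove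
    refine ⟨M, fun i => ?_⟩
    have h2 : v i l ≤ v i τ ^ (N + M) := (hm i).trans
      (pow_le_pow_right₀ (hvt i).le ((hM ⟨i, rfl⟩).trans (Nat.le_add_left _ _)))
    rw [map_mul, map_pow, map_inv₀, inv_pow]
    exact mul_inv_le_one_of_le₀ h2 (pow_nonneg ((v i).nonneg _) _)
  obtain ⟨m, hm⟩ := hm
  obtain ⟨b, hb⟩ := desc m l hm
  refine ⟨b, fun i => ?_⟩
  have e : τ⁻¹ ^ N * (c i - algebraMap B E b) =
      τ⁻¹ ^ N * (c i - l) + (l - algebraMap B E b) * τ⁻¹ ^ N := by ring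
  rw [e]
  refine (hna i _ _).trans (max_le ?_ (hb i))
  rw [map_mul, map_pow]
  exact mul_le_one₀ (pow_le_one₀ ((v i).nonneg _) (hu1 i)) ((v i).nonneg _) (hl i)

end Approximation

/-! ## Separatedness and global sections of a smooth proper curve -/

section Separated

variable {Y : Scheme.{0}} [IsIntegral Y]

lemma algebraMap_stalk_injective (y : Y) :
    Function.Injective (algebraMap (Y.presheaf.stalk y) Y.functionField) :=
  IsFractionRing.injective _ _

lemma isSeparated_of_isCurveOverFiniteField (Y : Scheme.{0}) [IsCurveOverFiniteField Y] :
    Y.IsSeparated := by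
  obtain ⟨k, _, _, π, _, _⟩ := IsCurveOverFiniteField.exists_isProper_smooth (X := Y)
  refine ⟨?_⟩
  rw [← Limits.terminal.comp_from π]
  infer_instance

/-- If all functions on the affine open `V` are regular at `y`, they define a morphism from the
spectrum of the stalk at `y` to `V`. It agrees generically with the canonical morphism to `Y`, hence
everywhere because `Y` is separated, and the closed point is sent to `y`. -/
lemma mem_of_forall_exists_algebraMap_eq [Y.IsSeparated] {V : Y.Opens} (hV : IsAffineOpen V)
    (hη : genericPoint Y ∈ V) (y : Y)
    (h : ∀ b : Γ(Y, V), ∃ r, algebraMap (Y.presheaf.stalk y) Y.functionField r = germHom hη b) :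
    y ∈ V := by
  have hs : genericPoint Y ⤳ y := (genericPoint_spec Y).specializes trivial
  have hinj : Function.Injective (Y.presheaf.stalkSpecializes hs).hom := algebraMap_stalk_injective y
  choose φ hφ using h
  let ψ : Γ(Y, V) →+* Y.presheaf.stalk y :=
    { toFun := φ
      map_one' := hinj (by
        change algebraMap _ Y.functionField _ = algebraMap _ Y.functionField _
        rw [hφ, map_one, map_one])
      map_zero' := hinj (by
        change algebraMap _ Y.functionField _ = algebraMap _ Y.functionField _
        rw [hφ, map_zero, map_zero])
      map_add' := fun a b => hinj (by
        change algebraMap _ Y.functionField _ = algebraMap _ Y.functionField _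
        rw [hφ, map_add, map_add, hφ, hφ])
      map_mul' := fun a b => hinj (by
        change algebraMap _ Y.functionField _ = algebraMap _ Y.functionField _
        rw [hφ, map_mul, map_mul, hφ, hφ]) }
  let ψ' : Γ(Y, V) ⟶ Y.presheaf.stalk y := CommRingCat.ofHom ψ
  have hψ : ψ' ≫ Y.presheaf.stalkSpecializes hs = Y.presheaf.germ V _ hη := by
    ext b
    exact hφ b
  have hd : IsDominant (Spec.map (Y.presheaf.stalkSpecializes hs)) := by
    refine ⟨PrimeSpectrum.denseRange_comap_iff_ker_le_nilRadical
      (Y.presheaf.stalkSpecializes hs).hom |>.mpr ?_⟩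
    rw [(RingHom.injective_iff_ker_eq_bot _).mp hinj]
    exact bot_le
  have e : Spec.map ψ' ≫ hV.fromSpec = Y.fromSpecStalk y := by
    refine ext_of_isDominant (Spec.map (Y.presheaf.stalkSpecializes hs)) ?_
    rw [Scheme.SpecMap_stalkSpecializes_fromSpecStalk, ← Category.assoc, ← Spec.map_comp, hψ,
      ← hV.fromSpecStalk_eq_fromSpecStalk hη, IsAffineOpen.fromSpecStalk]
  have h1 : (Y.fromSpecStalk y) (IsLocalRing.closedPoint (Y.presheaf.stalk y)) ∈ V := by
    rw [← e]
    exact hV.range_fromSpec.le ⟨Spec.map ψ' (IsLocalRing.closedPoint (Y.presheaf.stalk y)), rfl⟩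
  rwa [Scheme.fromSpecStalk_closedPoint] at h1

lemma eq_of_forall_exists_algebraMap_eq [Y.IsSeparated] {x y : Y} (hy : IsClosed ({y} : Set Y))
    (h : ∀ r : Y.presheaf.stalk x, ∃ s, algebraMap (Y.presheaf.stalk y) Y.functionField s =
      algebraMap (Y.presheaf.stalk x) Y.functionField r) : x = y := by
  by_contra hxy
  obtain ⟨V, hV, hx, hVy⟩ :=
    exists_isAffineOpen_subset (Y := Y) (x := x) (U := ⟨{y}ᶜ, hy.isOpen_compl⟩) hxy
  refine hVy (mem_of_forall_exists_algebraMap_eq hV (genericPoint_mem hx) y fun b => ?_) rfl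
  rw [← algebraMap_germHom hx]
  exact h _

lemma finite_sections [IsCurveOverFiniteField Y] : Finite Γ(Y, ⊤) := by
  obtain ⟨k, _, _, π, _, _⟩ := IsCurveOverFiniteField.exists_isProper_smooth (X := Y)
  have h := finite_appTop_of_universallyClosed k π
  let := π.appTop.hom.toAlgebra
  have : Module.Finite Γ(Spec (CommRingCat.of k), ⊤) Γ(Y, ⊤) := h
  have : Finite Γ(Spec (CommRingCat.of k), ⊤) := Finite.of_equiv k
    (Scheme.ΓSpecIso (CommRingCat.of k)).commRingCatIsoToRingEquiv.symm.toEquiv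
  exact Module.finite_of_finite Γ(Spec (CommRingCat.of k), ⊤)

/-- Local sections near the closed points glue, as they agree at the generic point. Their domains
cover everything, since a nonempty closed subset of a quasi-compact scheme contains a closed point.
-/
lemma exists_section_of_forall_closed [CompactSpace Y] {f : Y.functionField}
    (h : ∀ y : Y, IsClosed ({y} : Set Y) → ∃ r, f = algebraMap (Y.presheaf.stalk y) _ r) :
    ∃ s : Γ(Y, ⊤), germHom (U := (⊤ : Y.Opens)) (x := genericPoint Y) trivial s = f := by
  have h1 : ∀ y : {y : Y // IsClosed ({y} : Set Y)}, ∃ (U : Y.Opens) (hy : y.1 ∈ U) (s : Γ(Y, U)),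
      f = germHom (genericPoint_mem hy) s := by
    rintro ⟨y, hy⟩
    obtain ⟨r, hr⟩ := h y hy
    obtain ⟨U, hyU, s, hs⟩ := Y.presheaf.exists_germ_eq r
    refine ⟨U, hyU, s, ?_⟩
    rw [← algebraMap_germHom hyU, hr]
    exact congrArg _ hs.symm
  choose U hyU s hs using h1
  have hcover : (⊤ : Y.Opens) ≤ iSup U := by
    intro z _
    by_contra hz
    obtain ⟨p, hp, hpc⟩ := ((iSup U).isOpen.isClosed_compl).exists_closed_singleton ⟨z, hz⟩
    exact hp (TopologicalSpace.Opens.mem_iSup.mpr ⟨⟨p, hpc⟩, hyU _⟩)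
  have hcomp : TopCat.Presheaf.IsCompatible Y.sheaf.1 U s := by
    intro i j
    have hη : genericPoint Y ∈ U i ⊓ U j := ⟨genericPoint_mem (hyU i), genericPoint_mem (hyU j)⟩
    apply germ_injective_of_isIntegral Y (genericPoint Y) hη
    have e1 := TopCat.Presheaf.germ_res_apply Y.presheaf (TopologicalSpace.Opens.infLELeft (U i) (U j)) _ hη (s i)
    have e2 := TopCat.Presheaf.germ_res_apply Y.presheaf (TopologicalSpace.Opens.infLERight (U i) (U j)) _ hη (s j)
    exact e1.trans (((hs i).symm.trans (hs j)).trans e2.symm)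
  obtain ⟨t, ht, -⟩ := Y.sheaf.existsUnique_gluing' U ⊤ (fun i => homOfLE le_top) hcover s hcomp
  refine ⟨t, ?_⟩
  obtain ⟨p, -, hp⟩ := (isClosed_univ (X := Y)).exists_closed_singleton ⟨genericPoint Y, trivial⟩
  have e := TopCat.Presheaf.germ_res_apply Y.presheaf (homOfLE (le_top : U ⟨p, hp⟩ ≤ ⊤)) _
    (genericPoint_mem (hyU ⟨p, hp⟩)) t
  rw [hs ⟨p, hp⟩]
  refine e.symm.trans (congrArg _ (ht ⟨p, hp⟩))

end Separated

/-! ### Finiteness of the principal integral adeles -/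

section GlobalSections

variable {X : Scheme.{0}} [IsIntegral X] (C : NilpotentExtension X) [IsCurveOverFiniteField X]

lemma finite_principalAdele_mem_of_isIntegral [IsIntegral C.scheme]
    [IsCurveOverFiniteField C.scheme] :
    {f : FunctionRing C | principalAdele C f ∈ integralAdeles C}.Finite := by
  have := finite_sections (Y := C.scheme)
  refine (Set.finite_range (germHom (Y := C.scheme) (U := ⊤) (x := genericPoint C.scheme)
    trivial)).subset fun f hf => ?_
  refine exists_section_of_forall_closed fun y hy => ?_
  exact exists_eq_algebraMap_of_mem_integerRing (C := C) ⟨y, hy⟩ (mem_integralAdeles_iff.mp hf _)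

lemma finite_principalAdele_mem :
    {f : FunctionRing C | principalAdele C f ∈ integralAdeles C}.Finite := by
  have : IsIntegral C.reduced.scheme := inferInstanceAs (IsIntegral X)
  have : IsCurveOverFiniteField C.reduced.scheme := inferInstanceAs (IsCurveOverFiniteField X)
  exact finite_principalAdele_mem_of_reduced (finite_principalAdele_mem_of_isIntegral C.reduced)

end GlobalSections

/-! ## The absolute value of a discrete valuation ring -/

section DiscreteValuationRing

open IsLocalRing IsDedekindDomain

variable (R E : Type) [CommRing R] [IsDomain R] [IsDiscreteValuationRing R] [Field E] [Algebra R E]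
  [IsFractionRing R E]

/-- The absolute value on the fraction field of a discrete valuation ring. -/
def dvrAbs : AbsoluteValue E ℝ :=
  (IsDiscreteValuationRing.maximalIdeal R).adicAbv (K := E) (b := 2) one_lt_two

lemma isNonarchimedean_dvrAbs : IsNonarchimedean (dvrAbs R E) :=
  HeightOneSpectrum.isNonarchimedean_adicAbv _ _

variable {R E}

lemma dvrAbs_algebraMap_le_one (r : R) : dvrAbs R E (algebraMap R E r) ≤ 1 :=
  HeightOneSpectrum.adicAbv_coe_le_one _ _ r

lemma dvrAbs_algebraMap_lt_one_iff (r : R) :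
    dvrAbs R E (algebraMap R E r) < 1 ↔ r ∈ maximalIdeal R :=
  HeightOneSpectrum.adicAbv_coe_lt_one_iff _ _ r

lemma dvrAbs_le_one_iff (x : E) : dvrAbs R E x ≤ 1 ↔ ∃ r, algebraMap R E r = x := by
  refine ⟨fun h => ?_, fun ⟨r, hr⟩ => hr ▸ dvrAbs_algebraMap_le_one r⟩
  obtain ⟨r, hr⟩ | ⟨r, hr⟩ := ValuationRing.isInteger_or_isInteger R x
  · exact ⟨r, hr⟩
  · by_cases hu : IsUnit r
    · obtain ⟨s, hs⟩ := hu.exists_right_inv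
      refine ⟨s, ?_⟩
      have h1 : algebraMap R E r * algebraMap R E s = 1 := by rw [← map_mul, hs, map_one]
      rw [hr] at h1
      have hx : x ≠ 0 := fun h0 => by simp [h0] at h1
      field_simp at h1
      exact h1
    · have h1 := (dvrAbs_algebraMap_lt_one_iff (E := E) r).mpr hu
      rw [hr, map_inv₀] at h1
      rcases eq_or_ne x 0 with rfl | hx
      · exact ⟨0, map_zero _⟩
      · have := (inv_lt_one₀ ((dvrAbs R E).pos hx)).mp h1
        exact absurd h this.not_ge

variable (R E) in
lemma isNontrivial_dvrAbs : (dvrAbs R E).IsNontrivial := by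
  obtain ⟨ϖ, hϖ⟩ := IsDiscreteValuationRing.exists_irreducible R
  refine ⟨algebraMap R E ϖ, ?_, ((dvrAbs_algebraMap_lt_one_iff ϖ).mpr hϖ.not_isUnit).ne⟩
  rw [Ne, map_eq_zero_iff _ (IsFractionRing.injective R E)]
  exact hϖ.ne_zero

/-- Replacing `u = a / b` by the smaller `a`, one needs representatives modulo `a`; the quotient is
finite because the ideal of `a` is a power of the maximal ideal. -/
lemma exists_finite_dvrAbs_sub_le [Finite (ResidueField R)] {u : E} (hu : u ≠ 0) :
    ∃ T : Set E, T.Finite ∧ ∀ c, dvrAbs R E c ≤ 1 → ∃ t ∈ T, dvrAbs R E (c - t) ≤ dvrAbs R E u := by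
  obtain ⟨a, b, hb, rfl⟩ := IsFractionRing.div_surjective (A := R) u
  have ha : a ≠ 0 := by
    rintro rfl
    simp at hu
  have hle : dvrAbs R E (algebraMap R E a) ≤
      dvrAbs R E (algebraMap R E a / algebraMap R E b) := by
    rw [map_div₀]
    refine le_div_self ((dvrAbs R E).nonneg _) ((dvrAbs R E).pos ?_) (dvrAbs_algebraMap_le_one b)
    rw [Ne, map_eq_zero_iff _ (IsFractionRing.injective R E)]
    exact nonZeroDivisors.ne_zero hb
  have hfin : Finite (R ⧸ Ideal.span {a}) := by
    obtain ⟨ϖ, hϖ⟩ := IsDiscreteValuationRing.exists_irreducible R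
    obtain ⟨n, hn⟩ := IsDiscreteValuationRing.ideal_eq_span_pow_irreducible
      (s := Ideal.span {a}) (by simpa using ha) hϖ
    rw [hn, ← Ideal.span_singleton_pow, ← hϖ.maximalIdeal_eq]
    exact finite_quotient_pow R n
  refine ⟨_, Set.finite_range fun q : R ⧸ Ideal.span {a} => algebraMap R E (Quotient.out q),
    fun c hc => ?_⟩
  obtain ⟨r, rfl⟩ := (dvrAbs_le_one_iff c).mp hc
  refine ⟨_, ⟨Ideal.Quotient.mk _ r, rfl⟩, le_trans ?_ hle⟩
  have h1 : r - Quotient.out (Ideal.Quotient.mk (Ideal.span {a}) r) ∈ Ideal.span {a} := by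
    rw [← Ideal.Quotient.eq]
    exact (Quotient.out_eq (Ideal.Quotient.mk (Ideal.span {a}) r)).symm
  obtain ⟨s, hs⟩ := Ideal.mem_span_singleton'.mp h1
  rw [← map_sub, ← hs, map_mul, map_mul]
  exact mul_le_of_le_one_left ((dvrAbs R E).nonneg _) (dvrAbs_algebraMap_le_one s)

end DiscreteValuationRing

/-! ## Strong approximation -/

section StrongApproximation

open IsLocalRing

variable {X : Scheme.{0}} [IsIntegral X] [IsCurveOverFiniteField X] {C : NilpotentExtension X}

lemma exists_forall_sub_mem_integerRing (a : Adele C) :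
    ∃ f : ClosedPoint C → FunctionRing C, {p | f p ≠ 0}.Finite ∧
      ∀ p, a p - ofFunctionRing p (f p) ∈ integerRing p := by
  classical
  have h : ∀ p, ∃ f, a p - ofFunctionRing p f ∈ integerRing p := by
    intro p
    obtain ⟨f, y, -, e⟩ := exists_sub_ofFunctionRing_mem p 0 (a p)
    exact ⟨f, y, by rw [e, add_sub_cancel_left]⟩
  choose f hf using h
  refine ⟨fun p => if a p ∈ integerRing p then 0 else f p, a.2.subset fun p hp hp' => ?_,
    fun p => ?_⟩
  · exact hp (if_pos hp')
  · beta_reduce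
    split_ifs with hp
    · rwa [map_zero, sub_zero]
    · exact hf p

lemma germHom_mem_maximalIdeal {U : C.scheme.Opens} (hU : IsAffineOpen U) {x : C.scheme}
    (hx : x ∈ U) {b : Γ(C.scheme, U)} (hb : b ∈ (hU.primeIdealOf ⟨x, hx⟩).asIdeal) :
    germHom hx b ∈ maximalIdeal (C.scheme.presheaf.stalk x) := by
  let := C.scheme.presheaf.algebra_section_stalk ⟨x, hx⟩
  have := hU.isLocalization_stalk ⟨x, hx⟩
  exact (IsLocalization.AtPrime.to_map_mem_maximal_iff _ _ _).mpr hb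

lemma primeIdealOf_injective {U : C.scheme.Opens} (hU : IsAffineOpen U) {x y : U}
    (h : hU.primeIdealOf x = hU.primeIdealOf y) : x = y := by
  have := congrArg hU.fromSpec h
  rw [hU.fromSpec_primeIdealOf, hU.fromSpec_primeIdealOf] at this
  exact Subtype.ext this

variable [IsIntegral C.scheme]

/-- Clear the finitely many nonzero principal parts by a common denominator `b`. The Chinese
remainder theorem on the affine curve gives a numerator congruent to the prescribed ones to such a
high order that the differences are divisible by `b`. -/
lemma exists_sub_principalAdele_mem_integerRing {V : C.scheme.Opens} (hV : IsAffineOpen V)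
    (hη : genericPoint C.scheme ∈ V) (a : Adele C) :
    ∃ f, ∀ p : ClosedPoint C, p.1 ∈ V → a p - ofFunctionRing p f ∈ integerRing p := by
  have : Nonempty V := ⟨⟨_, hη⟩⟩
  have := functionField_isFractionRing_of_isAffineOpen C.scheme V hV
  obtain ⟨f, hfin, hf⟩ := exists_forall_sub_mem_integerRing a
  let T := {p | f p ≠ 0}
  have : Finite T := hfin
  obtain ⟨⟨b, hb⟩, hbf⟩ := IsLocalization.exist_integer_multiples_of_finite
    (nonZeroDivisors Γ(C.scheme, V)) (S := C.scheme.functionField) (fun p : T => f p)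
  have hb0 : germHom hη b ≠ 0 := by
    have hinj : Function.Injective (germHom hη) := germ_injective_of_isIntegral C.scheme _ hη
    rw [Ne, map_eq_zero_iff _ hinj]
    exact nonZeroDivisors.ne_zero hb
  have hbf' : ∀ p, ∃ g, germHom hη g = germHom hη b * f p := by
    intro p
    by_cases hp : f p = 0
    · exact ⟨0, by rw [hp, map_zero, mul_zero]⟩
    · obtain ⟨g, hg⟩ := hbf ⟨p, hp⟩
      exact ⟨g, hg.trans (Algebra.smul_def _ _)⟩
  choose g hg using hbf'
  have hbη : genericPoint C.scheme ∈ C.scheme.basicOpen b :=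
    (isUnit_germHom_iff hη b).mp (isUnit_iff_ne_zero.mpr hb0)
  -- At all other points of `V` the principal part is zero and `b` is invertible, so any numerator
  -- will do.
  let S : Set (ClosedPoint C) := {p | p.1 ∈ V ∧ (f p ≠ 0 ∨ p.1 ∉ C.scheme.basicOpen b)}
  have hS : S.Finite := (hfin.union (finite_notMem C hbη)).subset fun p hp => hp.2
  have : Finite S := hS
  have hn : ∀ p : S, ∃ n, maximalIdeal (LocalRing p.1) ^ n ≤ Ideal.span {germHom p.2.1 b} := by
    intro p
    have : IsCurveLocalRing (LocalRing p.1) := isCurveLocalRing_stalk C p.1.1 p.1.2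
    obtain ⟨n, hn⟩ := exists_pow_maximalIdeal_le (R := LocalRing p.1) (s := germHom p.2.1 b)
      (fun h => by
        have h1 := (mem_nilradical.mp h).map (algebraMap (LocalRing p.1) (FunctionRing C))
        have h2 := algebraMap_germHom p.2.1 b
        rw [h2] at h1
        exact hb0 h1.eq_zero) 0
    exact ⟨n, by simpa using hn⟩
  choose n hn using hn
  let I : S → Ideal Γ(C.scheme, V) := fun p => (hV.primeIdealOf ⟨p.1.1, p.2.1⟩).asIdeal ^ n p
  have hI : Pairwise (Function.onFun IsCoprime I) := by
    intro p q hpq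
    have := isMaximal_primeIdealOf hV ⟨p.1.1, p.2.1⟩ p.1.2
    have := isMaximal_primeIdealOf hV ⟨q.1.1, q.2.1⟩ q.1.2
    refine (Ideal.isCoprime_of_isMaximal fun h => hpq ?_).pow
    have := congrArg (Subtype.val) (primeIdealOf_injective hV (PrimeSpectrum.ext h))
    exact Subtype.ext (Subtype.ext this)
  obtain ⟨c, hc⟩ := Ideal.exists_forall_sub_mem_ideal hI fun p => g p.1
  refine ⟨germHom hη c / germHom hη b, fun p hp => ?_⟩
  have key : ∃ r : LocalRing p, germHom hη c / germHom hη b - f p =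
      algebraMap (LocalRing p) (FunctionRing C) r := by
    by_cases hpS : p ∈ S
    · have h1 : germHom hp (c - g p) ∈ maximalIdeal (LocalRing p) ^ n ⟨p, hpS⟩ := by
        have h2 := Ideal.mem_map_of_mem (germHom hp) (hc ⟨p, hpS⟩)
        rw [Ideal.map_pow] at h2
        refine Ideal.pow_right_mono (Ideal.map_le_iff_le_comap.mpr fun x hx => ?_) _ h2
        exact germHom_mem_maximalIdeal hV hp hx
      obtain ⟨r, hr⟩ := Ideal.mem_span_singleton'.mp (hn ⟨p, hpS⟩ h1)
      refine ⟨r, ?_⟩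
      have h3 := congrArg (algebraMap (LocalRing p) (FunctionRing C)) hr
      rw [map_mul] at h3
      have h4 : ∀ x, algebraMap (LocalRing p) (FunctionRing C) (germHom hp x) = germHom hη x :=
        fun x => algebraMap_germHom hp x
      rw [h4, h4, map_sub, hg] at h3
      rw [sub_eq_iff_eq_add, div_eq_iff hb0, add_mul, h3]
      ring
    · have hp1 : f p = 0 := by
        by_contra h
        exact hpS ⟨hp, Or.inl h⟩
      have hp2 : p.1 ∈ C.scheme.basicOpen b := by
        by_contra h
        exact hpS ⟨hp, Or.inr h⟩
      obtain ⟨s, hs⟩ := ((isUnit_germHom_iff hp b).mpr hp2).exists_right_inv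
      refine ⟨germHom hp c * s, ?_⟩
      have h4 : ∀ x, algebraMap (LocalRing p) (FunctionRing C) (germHom hp x) = germHom hη x :=
        fun x => algebraMap_germHom hp x
      have h3 := congrArg (algebraMap (LocalRing p) (FunctionRing C)) hs
      rw [map_mul, map_one, h4] at h3
      rw [hp1, sub_zero, map_mul, h4, div_eq_iff hb0, mul_assoc, mul_comm (algebraMap _ _ s), h3,
        mul_one]
  obtain ⟨r, hr⟩ := key
  have e : a p - ofFunctionRing p (germHom hη c / germHom hη b) =
      (a p - ofFunctionRing p (f p)) - ofCompletedLocalRing p (algebraMap _ _ r) := by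
    rw [← ofFunctionRing_algebraMap, ← hr, map_sub]
    ring
  rw [e]
  exact sub_mem (hf p) ⟨_, rfl⟩

lemma isMaximal_of_isPrime_section {V : C.scheme.Opens} (hV : IsAffineOpen V)
    (P : Ideal Γ(C.scheme, V)) (hP : P.IsPrime) (h0 : P ≠ ⊥) : P.IsMaximal := by
  let z : Spec Γ(C.scheme, V) := (⟨P, hP⟩ : PrimeSpectrum Γ(C.scheme, V))
  have hz : hV.fromSpec z ∈ V := hV.range_fromSpec.le ⟨z, rfl⟩
  have e : hV.primeIdealOf ⟨hV.fromSpec z, hz⟩ = z :=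
    hV.fromSpec.isOpenEmbedding.injective (hV.fromSpec_primeIdealOf _)
  have h1 := eq_genericPoint_or_isClosed (Y := C.scheme) (fun p hp =>
    (isCurveLocalRing_stalk C p hp).eq_nilradical_or_eq) (hV.fromSpec z)
  rcases h1 with h1 | h1
  · refine absurd ?_ h0
    have : Nonempty V := ⟨⟨_, hz⟩⟩
    have h2 := hV.primeIdealOf_genericPoint
    rw [genericPoint_eq_bot_of_affine] at h2
    have h3 : hV.primeIdealOf ⟨hV.fromSpec z, hz⟩ = hV.primeIdealOf ⟨genericPoint C.scheme, h1 ▸ hz⟩ := by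
      congr 1
      exact Subtype.ext h1
    rw [e] at h3
    exact congrArg PrimeSpectrum.asIdeal (h3.trans h2)
  · have h2 := isMaximal_primeIdealOf hV ⟨_, hz⟩ h1
    rwa [e] at h2

variable (C)

/-- The Chinese remainder theorem settles the points of the affine open set `V`. At the finitely
many points outside, subtract a regular function on `V`, which does not spoil integrality on `V`;
this leaves an error with denominator bounded by `w`. -/
lemma exists_isCompact_add_of_isIntegral [IsCurveOverFiniteField C.scheme] :
    ∃ Q : Set (Adele C), IsCompact Q ∧ ∀ a : Adele C, ∃ f, ∃ q ∈ Q, a = principalAdele C f + q := by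
  classical
  obtain ⟨K, _, hK, _, V, hV, hη, _, hs⟩ :=
    exists_isStandardSmooth_section (genericPoint C.scheme)
  let := hK.toField
  have := Algebra.IsStandardSmoothOfRelativeDimension.isStandardSmooth 1 (R := K)
    (S := Γ(C.scheme, V))
  have : Nonempty V := ⟨⟨_, hη⟩⟩
  have := functionField_isFractionRing_of_isAffineOpen C.scheme V hV
  have hB := exists_forall_isIntegral_aeval K Γ(C.scheme, V) (isMaximal_of_isPrime_section hV)
  have hsep := isSeparated_of_isCurveOverFiniteField C.scheme
  let ι := {p : ClosedPoint C // p.1 ∉ V}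
  have : Finite ι := finite_notMem C hη
  have hdvr : ∀ p : ClosedPoint C, IsDiscreteValuationRing (LocalRing p) := fun p =>
    isDiscreteValuationRing_stalk p.1 p.2
  have hres : ∀ p : ClosedPoint C, Finite (ResidueField (LocalRing p)) := fun p =>
    finite_residueField_stalk p.1 p.2
  let v : ι → AbsoluteValue C.scheme.functionField ℝ := fun p =>
    dvrAbs (LocalRing p.1) C.scheme.functionField
  -- If every regular function on `V` were integral at a point outside `V`, separatedness would
  -- force that point into `V`. The same principle shows next that distinct points give inequivalent
  -- absolute values.
  have hvB : ∀ p, ∃ b : Γ(C.scheme, V), 1 < v p (algebraMap _ C.scheme.functionField b) := by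
    intro p
    by_contra! h
    refine p.2 (mem_of_forall_exists_algebraMap_eq hV hη p.1.1 fun b => ?_)
    exact (dvrAbs_le_one_iff _).mp (h b)
  have hpair : Pairwise fun p q => ¬ (v p).IsEquiv (v q) := by
    intro p q hpq h
    refine hpq (Subtype.ext (Subtype.ext
      (eq_of_forall_exists_algebraMap_eq q.1.2 fun r => ?_)))
    exact (dvrAbs_le_one_iff _).mp (h.le_one_iff.mp (dvrAbs_algebraMap_le_one r))
  obtain ⟨w, hw0, hw1, hw⟩ := exists_forall_exists_absoluteValue_le (v := v) hB
    (fun p => isNontrivial_dvrAbs _ _) hpair (fun p => isNonarchimedean_dvrAbs _ _) hvB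
    (fun u hu p => exists_finite_dvrAbs_sub_le hu)
  -- The compact set is `m` times the integral adeles, where `m` allows the denominator `w` only
  -- outside `V`.
  let m : Adele C := ⟨fun p => if p.1 ∈ V then 1 else ofFunctionRing p w⁻¹, by
    filter_upwards [eventually_mem C hη] with p hp
    rw [if_pos hp]
    exact one_mem _⟩
  have hm1 : ∀ p : ClosedPoint C, p.1 ∈ V → m p = 1 := fun p hp => if_pos hp
  have hm2 : ∀ p : ClosedPoint C, p.1 ∉ V → m p = ofFunctionRing p w⁻¹ := fun p hp => if_neg hp
  refine ⟨(fun a => m * a) '' (integralAdeles C : Set (Adele C)),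
    isCompact_integralAdeles.image (continuous_const.mul continuous_id), fun a => ?_⟩
  obtain ⟨f, hf⟩ := exists_sub_principalAdele_mem_integerRing hV hη a
  obtain ⟨c, -, hc⟩ := exists_forall_sub_mem_integerRing (a - principalAdele C f)
  obtain ⟨b, hb⟩ := hw fun p => c p.1
  have key : ∀ p : ClosedPoint C, ∃ y ∈ integerRing p,
      a p - ofFunctionRing p (f + germHom hη b) = m p * y := by
    intro p
    by_cases hp : p.1 ∈ V
    · refine ⟨_, ?_, by rw [hm1 p hp, one_mul]⟩
      rw [map_add, ← sub_sub]
      refine sub_mem (hf p hp) ?_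
      rw [← algebraMap_germHom hp]
      exact ⟨_, (ofFunctionRing_algebraMap p _).symm⟩
    · refine ⟨ofFunctionRing p w * (a p - ofFunctionRing p (f + germHom hη b)), ?_, ?_⟩
      · have hwi : ∀ x : C.scheme.functionField, v ⟨p, hp⟩ x ≤ 1 →
            ofFunctionRing p x ∈ integerRing p := by
          intro x hx
          obtain ⟨r, rfl⟩ := (dvrAbs_le_one_iff x).mp hx
          exact ⟨_, (ofFunctionRing_algebraMap p _).symm⟩
        have e : ofFunctionRing p w * (a p - ofFunctionRing p (f + germHom hη b)) =
            ofFunctionRing p w * ((a - principalAdele C f) p - ofFunctionRing p (c p)) +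
              ofFunctionRing p (w * (c p - germHom hη b)) := by
          change _ = ofFunctionRing p w * ((a p - ofFunctionRing p f) - ofFunctionRing p (c p)) + _
          simp only [map_add, map_mul, map_sub]
          ring
        rw [e]
        exact add_mem (mul_mem (hwi w (hw1 _)) (hc p)) (hwi _ (hb ⟨p, hp⟩))
      · rw [hm2 p hp, ← mul_assoc, ← map_mul, inv_mul_cancel₀ hw0, map_one, one_mul]
  choose y hy e using key
  refine ⟨f + germHom hη b, _, ⟨⟨y, Filter.Eventually.of_forall hy⟩,
    mem_integralAdeles_iff.mpr hy, rfl⟩, ?_⟩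
  ext p
  exact (eq_add_of_sub_eq' (e p))

end StrongApproximation

/-! ### Cocompactness of the principal adeles for a nilpotent extension -/

section Approximation

variable {X : Scheme.{0}} [IsIntegral X] [IsCurveOverFiniteField X] (C : NilpotentExtension X)

lemma exists_isCompact_add :
    ∃ Q : Set (Adele C), IsCompact Q ∧ ∀ a : Adele C, ∃ f, ∃ q ∈ Q, a = principalAdele C f + q := by
  have : IsIntegral C.reduced.scheme := inferInstanceAs (IsIntegral X)
  have : IsCurveOverFiniteField C.reduced.scheme := inferInstanceAs (IsCurveOverFiniteField X)
  obtain ⟨Q, hQ, h⟩ := exists_isCompact_add_of_isIntegral C.reduced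
  exact exists_isCompact_add_of_reduceAdele C.reducedEmbedding hQ h

instance instSecondCountableTopologyAdele : SecondCountableTopology (Adele C) := by
  obtain ⟨Q, hQ, h⟩ := exists_isCompact_add C
  exact secondCountableTopology_adele hQ h

end Approximation

/-! ## The action of the Hecke algebra -/

section HeckeAction

variable {A : Type} [CommRing A] [HopfAlgebra ℤ A]
variable {X : Scheme.{0}} [IsIntegral X] {C : NilpotentExtension X}
variable {K : Subgroup (Points A (Adele C))}

/-- As `K` is open, the quotient by `K` is discrete, so the compact support of `h` has finite image
in it. -/
lemma finite_hecke_coset_ne_zero [IsTopologicalRing (Adele C)]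
    (hK : IsOpen (K : Set (Points A (Adele C)))) (h : hecke K) :
    {y : Points A (Adele C) ⧸ K | h.1 {x | (x : Points A (Adele C) ⧸ K) = y} ≠ 0}.Finite := by
  obtain ⟨⟨Z, hZ, hS⟩, -⟩ := h.2
  have := QuotientGroup.discreteTopology hK
  have h1 := hZ.image (f := fun x : Points A (Adele C) => (x : Points A (Adele C) ⧸ K))
    continuous_quotient_mk'
  refine (isCompact_iff_finite.mp h1).subset fun y hy => ?_
  by_contra hyZ
  refine hy (hS _ (Set.disjoint_left.mpr fun x hx hxZ => hyZ ⟨x, hxZ, hx⟩))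

/-- The constant term of `h * f` at `g` is a finite combination of the constant terms of `f` at the
elements `g * y.out`, each of which converges and vanishes. -/
lemma heckeAction_mem_constantTermKernel [IsTopologicalRing (Adele C)]
    (hK : IsOpen (K : Set (Points A (Adele C)))) (h : hecke K)
    {Γ H : Subgroup (Points A (Adele C))} {f : Bun A C K → ℂ} (hf : f ∈ constantTermKernel Γ H) :
    heckeAction h f ∈ constantTermKernel Γ H := by
  intro g
  let S := (finite_hecke_coset_ne_zero hK h).toFinset
  let w : Points A (Adele C) ⧸ K → ℂ := fun y => h.1 {x | (x : Points A (Adele C) ⧸ K) = y}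
  have e : ∀ u : H, heckeAction h f (Bun.mk K (u * g)) =
      ∑ y ∈ S, w y * f (Bun.mk K (u * (g * y.out))) := by
    intro u
    change convolution h.1 f (u * g) = _
    unfold convolution
    rw [finsum_eq_sum_of_support_subset (s := S)]
    · simp only [mul_assoc, w]
    · intro y hy
      simp only [S, Set.Finite.coe_toFinset]
      exact left_ne_zero_of_mul hy
  constructor
  · unfold ConvergesAlong
    simp only [e]
    exact integrable_finsetSum _ fun y _ => (hf (g * y.out)).1.const_mul _
  · unfold constantTermAlong
    simp only [e]
    rw [integral_finsetSum _ fun y _ => (hf (g * y.out)).1.const_mul _]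
    refine Finset.sum_eq_zero fun y _ => ?_
    rw [integral_const_mul]
    have h1 := (hf (g * y.out)).2
    unfold constantTermAlong at h1
    rw [h1, mul_zero]

lemma heckeAction_mem_cuspidal [IsTopologicalRing (Adele C)]
    (hK : IsOpen (K : Set (Points A (Adele C)))) (h : hecke K) {B : ClosedSubgroup A}
    {f : Bun A C K → ℂ} (hf : f ∈ cuspidal C K B) : heckeAction h f ∈ cuspidal C K B := by
  simp only [cuspidal, Submodule.mem_iInf] at hf ⊢
  exact fun P U hP hU => heckeAction_mem_constantTermKernel hK h (hf P U hP hU)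

lemma heckeAction_mem_iCuspidal [IsTopologicalRing (Adele C)]
    (hK : IsOpen (K : Set (Points A (Adele C)))) (h : hecke K) {B : ClosedSubgroup A} {i : ℕ}
    {f : Bun A C K → ℂ} (hf : f ∈ iCuspidal C K B i) : heckeAction h f ∈ iCuspidal C K B i := by
  simp only [iCuspidal, Submodule.mem_iInf] at hf ⊢
  exact fun P U hP hU => heckeAction_mem_constantTermKernel hK h (hf P U hP hU)

end HeckeAction

/-! ## Haar measures and fundamental domains -/

section Haar

open scoped Topology

variable {A : Type} [CommRing A] [HopfAlgebra ℤ A] [Algebra.FiniteType ℤ A]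
variable {X : Scheme.{0}} [IsIntegral X] [IsCurveOverFiniteField X] {C : NilpotentExtension X}

lemma integralPoints_mem_nhds {g : Points A (Adele C)} (hg : g ∈ integralPoints A C) :
    (integralPoints A C : Set (Points A (Adele C))) ∈ 𝓝 g :=
  (isOpen_integralPoints isOpen_integralAdeles).mem_nhds hg

instance locallyCompactSpace_points : LocallyCompactSpace (Points A (Adele C)) :=
  (isCompact_integralPoints isCompact_integralAdeles).locallyCompactSpace_of_mem_nhds_of_group
    (integralPoints_mem_nhds (one_mem _))

/-- A point is determined by its values on finitely many generators of `A`, and each value is one of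
the finitely many everywhere integral elements of `F`. -/
lemma finite_rationalPoints_inter_integralPoints :
    {g : Points A (Adele C) | g ∈ rationalPoints A C ∧ g ∈ integralPoints A C}.Finite := by
  obtain ⟨S, hS⟩ := (inferInstance : Algebra.FiniteType ℤ A).out
  have h1 : {x : Points A (FunctionRing C) | ∀ a ∈ S,
      principalAdele C (x a) ∈ integralAdeles C}.Finite := by
    let r : Points A (FunctionRing C) → S → FunctionRing C := fun x a => x a
    have hr : Function.Injective r := fun x y h =>
      Points.ext_of_adjoin_eq_top hS fun a ha => congrFun h ⟨a, ha⟩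
    refine ((Set.Finite.pi' fun _ : S => finite_principalAdele_mem C).preimage hr.injOn).subset ?_
    exact fun x hx a => hx a a.2
  refine (h1.image (Points.map (principalAdele C))).subset ?_
  rintro g ⟨hg, hgO⟩
  obtain ⟨x, -, rfl⟩ := (mem_principal_iff (adeleComponents_comp_principalAdele (C := C)) _).mp hg
  exact ⟨x, fun a _ => mem_integralPoints_iff.mp hgO a, rfl⟩

variable (A C) in
lemma exists_nhds_one_rationalPoints : ∃ W ∈ 𝓝 (1 : Points A (Adele C)),
    ∀ γ ∈ rationalPoints A C, γ ∈ W → γ = 1 := by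
  refine ⟨(integralPoints A C : Set (Points A (Adele C))) \
    ({g | g ∈ rationalPoints A C ∧ g ∈ integralPoints A C} \ {1}), ?_, fun γ hγ hW => ?_⟩
  · refine Filter.inter_mem (integralPoints_mem_nhds (one_mem _)) ?_
    exact (finite_rationalPoints_inter_integralPoints.sdiff).isClosed.isOpen_compl.mem_nhds
      fun h => h.2 rfl
  · by_contra h
    exact hW.2 ⟨⟨hγ, hW.1⟩, h⟩

lemma principal_le_rationalPoints (S : Subgroup (Points A (FunctionRing C))) :
    principal S ≤ rationalPoints A C :=
  Subgroup.comap_mono (Subgroup.map_mono le_top)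

variable {H : Subgroup (Points A (Adele C))}

lemma exists_nhds_one_subgroupOf (S : Subgroup (Points A (FunctionRing C))) :
    ∃ W ∈ 𝓝 (1 : H), ∀ γ ∈ (principal S).subgroupOf H, γ ∈ W → γ = 1 := by
  obtain ⟨W, hW, h⟩ := exists_nhds_one_rationalPoints A C
  refine ⟨Subtype.val ⁻¹' W, continuous_subtype_val.continuousAt hW, fun γ hγ hγW => ?_⟩
  exact Subtype.ext (h γ (principal_le_rationalPoints S hγ) hγW)

/-- `haar` is a choice, so existence has to be supplied: on a closed subgroup the integral points
form a compact neighbourhood of `1`, to which Haar measure can be normalized. -/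
lemma haar_spec (hH : IsClosed (H : Set (Points A (Adele C)))) :
    (haar H).IsHaarMeasure ∧ haar H {x | (x : Points A (Adele C)) ∈ integralPoints A C} = 1 := by
  have hex : ∃ μ : Measure H, μ.IsHaarMeasure ∧
      μ {x | (x : Points A (Adele C)) ∈ integralPoints A C} = 1 := by
    let K₀ : TopologicalSpace.PositiveCompacts H :=
      { carrier := {x | (x : Points A (Adele C)) ∈ integralPoints A C}
        isCompact' := hH.isClosedEmbedding_subtypeVal.isCompact_preimage
          (isCompact_integralPoints isCompact_integralAdeles)
        interior_nonempty' := by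
          refine ⟨1, mem_interior_iff_mem_nhds.mpr ?_⟩
          exact continuous_subtype_val.continuousAt (integralPoints_mem_nhds (one_mem _)) }
    exact ⟨Measure.haarMeasure K₀, inferInstance, Measure.haarMeasure_self⟩
  exact Classical.epsilon_spec hex

instance instSecondCountableTopologyPoints : SecondCountableTopology (Points A (Adele C)) := by
  have : Countable A := countable_of_finiteType ℤ A
  exact secondCountableTopology_points

instance instSecondCountableTopologySubgroup : SecondCountableTopology H :=
  TopologicalSpace.Subtype.secondCountableTopology (H : Set (Points A (Adele C)))

/-- `fundDomain` is a choice too; it is legitimate because rational points are discrete and the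
group is second countable. -/
lemma isFundamentalDomain_fundDomain
    (S : Subgroup (Points A (FunctionRing C))) :
    IsFundamentalDomain ((principal S).subgroupOf H) (fundDomain (principal S) H) (haar H) := by
  obtain ⟨W, hW, h⟩ := exists_nhds_one_subgroupOf (H := H) S
  obtain ⟨D, hD, hD'⟩ := exists_strict_fundDomain ((principal S).subgroupOf H) hW h
  exact Classical.epsilon_spec (p := fun S' =>
    IsFundamentalDomain ((principal S).subgroupOf H) S' (haar H))
    ⟨D, IsFundamentalDomain.mk' hD.nullMeasurableSet hD'⟩

end Haar

/-! ## Reduction of constant terms -/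

section Reduction

open scoped Topology

variable {A : Type} [CommRing A] [HopfAlgebra ℤ A] [Algebra.FiniteType ℤ A]
variable {X : Scheme.{0}} [IsIntegral X] [IsCurveOverFiniteField X] {C C' : NilpotentExtension X}
variable (j : NilpotentExtension.ClosedEmbedding C' C)

lemma reduceAdele_surjective : Function.Surjective (reduceAdele j) := fun a =>
  (exists_reduceAdele_eq j a).imp fun _ h => h.1

lemma isNilpotent_ker_reduceAdele : IsNilpotent (RingHom.ker (reduceAdele j)) := by
  rw [ker_reduceAdele]
  obtain ⟨n, hn⟩ := isNilpotent_ker_reduceFunctionRing j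
  refine ⟨n, ?_⟩
  rw [← Ideal.map_pow, hn, Ideal.zero_eq_bot, Ideal.map_bot, Ideal.zero_eq_bot]

/-- The reduction map on integral adeles. -/
def reduceIntegralAdele : integralAdeles C →+* integralAdeles C' :=
  ((reduceAdele j).comp (integralAdeles C).subtype).codRestrict _
    fun a => reduceAdele_mem_integralAdeles j a.2

lemma reduceIntegralAdele_surjective : Function.Surjective (reduceIntegralAdele j) := by
  rintro ⟨a, ha⟩
  obtain ⟨b, hb, hbO⟩ := exists_reduceAdele_eq j a
  exact ⟨⟨b, hbO ha⟩, Subtype.ext hb⟩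

lemma isNilpotent_ker_reduceIntegralAdele : IsNilpotent (RingHom.ker (reduceIntegralAdele j)) := by
  obtain ⟨n, hn⟩ := isNilpotent_ker_reduceAdele j
  refine ⟨n, ?_⟩
  have h1 : RingHom.ker (reduceIntegralAdele j) ≤
      (RingHom.ker (reduceAdele j)).comap (integralAdeles C).subtype := fun a ha =>
    congrArg Subtype.val (RingHom.mem_ker.mp ha)
  rw [Ideal.zero_eq_bot, eq_bot_iff]
  refine (Ideal.pow_right_mono h1 n).trans ((Ideal.le_comap_pow _ n).trans fun a ha => ?_)
  rw [hn] at ha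
  exact Subtype.ext ha

variable {U : ClosedSubgroup A}

variable (U) in
/-- The reduction map `U(𝔸_C) → U(𝔸_{C'})`. -/
def reducePoints : U.points (Adele C) →* U.points (Adele C') :=
  ((Points.map (reduceAdele j)).comp (U.points (Adele C)).subtype).codRestrict _
    fun x => U.map_mem _ x.2

lemma coe_reducePoints (x : U.points (Adele C)) :
    (reducePoints j U x : Points A (Adele C')) = Points.map (reduceAdele j) x := rfl

lemma continuous_reducePoints : Continuous (reducePoints j U) :=
  ((continuous_map_reduceAdele (continuous_reduceAdele j)).comp continuous_subtype_val).subtype_mk _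

variable [Algebra.Smooth ℤ (A ⧸ U.ideal)]

lemma reducePoints_surjective : Function.Surjective (reducePoints j U) := by
  rintro ⟨y, hy⟩
  obtain ⟨x, hx, e⟩ := U.exists_map_eq (reduceAdele j) (reduceAdele_surjective j)
    (isNilpotent_ker_reduceAdele j) hy
  exact ⟨⟨x, hx⟩, Subtype.ext e⟩

/-- Infinitesimal lifting over the rings of integral adeles. It shows that the image of the compact
group of integral points contains a neighbourhood of the identity. -/
lemma exists_mem_integralPoints_reducePoints_eq {y : U.points (Adele C')}
    (hy : (y : Points A (Adele C')) ∈ integralPoints A C') :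
    ∃ x : U.points (Adele C), (x : Points A (Adele C)) ∈ integralPoints A C ∧
      reducePoints j U x = y := by
  obtain ⟨y, hyU⟩ := y
  obtain ⟨y, rfl⟩ := hy
  have hy' : y ∈ U.points (integralAdeles C') := fun a ha => Subtype.ext (hyU a ha)
  obtain ⟨x, hx, rfl⟩ := U.exists_map_eq (reduceIntegralAdele j) (reduceIntegralAdele_surjective j)
    (isNilpotent_ker_reduceIntegralAdele j) hy'
  exact ⟨⟨Points.map (integralAdeles C).subtype x, U.map_mem _ hx⟩, ⟨x, rfl⟩, rfl⟩

lemma map_reducePoints_principal :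
    ((principal (U.points (FunctionRing C))).subgroupOf (U.points (Adele C))).map
      (reducePoints j U) =
      (principal (U.points (FunctionRing C'))).subgroupOf (U.points (Adele C')) := by
  have hC := adeleComponents_comp_principalAdele (C := C)
  have hC' := adeleComponents_comp_principalAdele (C := C')
  ext y
  constructor
  · rintro ⟨x, hx, rfl⟩
    obtain ⟨γ, hγ, e⟩ := (mem_principal_iff hC _).mp (Subgroup.mem_subgroupOf.mp hx)
    refine Subgroup.mem_subgroupOf.mpr ((mem_principal_iff hC' _).mpr
      ⟨Points.map (reduceFunctionRing j) γ, U.map_mem _ hγ, Points.ext_apply fun a => ?_⟩)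
    rw [coe_reducePoints, ← e]
    exact (reduceAdele_principalAdele j _).symm
  · intro hy
    obtain ⟨γ', hγ', e⟩ := (mem_principal_iff hC' _).mp (Subgroup.mem_subgroupOf.mp hy)
    obtain ⟨γ, hγ, rfl⟩ := U.exists_map_eq (reduceFunctionRing j) (reduceFunctionRing_surjective j)
      (isNilpotent_ker_reduceFunctionRing j) hγ'
    refine ⟨⟨Points.map (principalAdele C) γ, U.map_mem _ hγ⟩,
      Subgroup.mem_subgroupOf.mpr ((mem_principal_iff hC _).mpr ⟨γ, hγ, rfl⟩),
      Subtype.ext (Eq.trans (Points.ext_apply fun a => ?_) e)⟩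
    exact reduceAdele_principalAdele j _

/-- A point in the kernel is congruent to `1` modulo the kernel of `𝔸_C → 𝔸_{C'}`, which is
generated by the nilpotent kernel on `F`; the congruence subgroup decomposition therefore applies.
-/
lemma exists_isCompact_ker_reducePoints : ∃ Q : Set (U.points (Adele C)), IsCompact Q ∧
    ∀ v ∈ (reducePoints j U).ker,
      ∃ δ ∈ (principal (U.points (FunctionRing C))).subgroupOf (U.points (Adele C)) ⊓
        (reducePoints j U).ker, ∃ q ∈ Q, v = δ * q := by
  have hC := adeleComponents_comp_principalAdele (C := C)
  obtain ⟨Q, hQ, h⟩ := exists_isCompact_add C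
  obtain ⟨K, hK, hKU, hKv⟩ := U.exists_isCompact_congruence (principalAdele C) hQ h
    (isNilpotent_ker_reduceFunctionRing j)
  refine ⟨Subtype.val ⁻¹' K,
    (isClosed_subgroup_points U).isClosedEmbedding_subtypeVal.isCompact_preimage hK, fun v hv => ?_⟩
  obtain ⟨γ, hγ, hγJ, q, hq, e⟩ := hKv v v.2 (by
    rw [← ker_reduceAdele, Points.mem_ker_map_mk_iff]
    intro a
    have h1 : Points.map (reduceAdele j) (v : Points A (Adele C)) = 1 :=
      congrArg Subtype.val (MonoidHom.mem_ker.mp hv)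
    rw [RingHom.mem_ker, map_sub, map_intCast, ← Points.map_apply, h1, Points.one_apply, sub_self])
  refine ⟨⟨Points.map (principalAdele C) γ, U.map_mem _ hγ⟩,
    ⟨Subgroup.mem_subgroupOf.mpr ((mem_principal_iff hC _).mpr ⟨γ, hγ, rfl⟩),
      MonoidHom.mem_ker.mpr (Subtype.ext (Points.ext_apply fun a => ?_))⟩,
    ⟨q, hKU hq⟩, hq, Subtype.ext e⟩
  have h1 := (Points.mem_ker_map_mk_iff _ _).mp hγJ a
  rw [RingHom.mem_ker, map_sub, map_intCast, sub_eq_zero] at h1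
  have h2 : reduceAdele j (principalAdele C (γ a)) = (augmentation A a : ℤ) := by
    rw [reduceAdele_principalAdele, h1, map_intCast]
  exact h2.trans (Points.one_apply a).symm

lemma isMulRightInvariant_haar (hU : ∀ (Ω : Type) [Field Ω] [IsAlgClosed Ω],
    ∀ x ∈ U.points Ω, IsUnipotentElt x) :
    (haar (U.points (Adele C))).IsMulRightInvariant := by
  have hcl := isClosed_subgroup_points (C := C) U
  have : LocallyCompactSpace (U.points (Adele C)) :=
    hcl.isClosedEmbedding_subtypeVal.locallyCompactSpace
  have := (haar_spec hcl).1
  obtain ⟨p, hp, hpn⟩ := exists_prime_isNilpotent_adele C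
  have : Fact p.Prime := ⟨hp⟩
  refine isMulRightInvariant_of_finite_order _ fun x => ?_
  obtain ⟨n, hn, e⟩ := U.exists_pow_eq_one hU hpn x.2
  exact ⟨n, hn, Subtype.ext e⟩

/-- Right invariance under the open subgroup of integral points makes the function locally constant.
-/
lemma continuous_bun_mk_mul (f : Bun A C (integralPoints A C) → ℂ) (g : Points A (Adele C))
    (H : Subgroup (Points A (Adele C))) :
    Continuous fun u : H => f (Bun.mk (integralPoints A C) (u * g)) := by
  refine IsLocallyConstant.continuous (IsLocallyConstant.iff_eventually_eq _ |>.mpr fun u => ?_)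
  have hc : Continuous fun u' : H => ((u : Points A (Adele C)) * g)⁻¹ * (u' * g) :=
    continuous_const.mul (continuous_subtype_val.mul continuous_const)
  have hO : IsOpen (integralPoints A C : Set (Points A (Adele C))) :=
    isOpen_integralPoints isOpen_integralAdeles
  have h1 : ∀ᶠ u' : H in 𝓝 u,
      ((u : Points A (Adele C)) * g)⁻¹ * (u' * g) ∈ integralPoints A C := by
    refine (hO.preimage hc).mem_nhds ?_
    rw [Set.mem_preimage, inv_mul_cancel]
    exact one_mem _
  filter_upwards [h1] with u' hu'
  congr 1
  rw [eq_comm, DoubleCoset.eq]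
  exact ⟨1, one_mem _, _, hu', by rw [one_mul, mul_inv_cancel_left]⟩

lemma bun_mk_mul_of_mem_rationalPoints {K : Subgroup (Points A (Adele C))} {γ : Points A (Adele C)}
    (hγ : γ ∈ rationalPoints A C) (g : Points A (Adele C)) : Bun.mk K (γ * g) = Bun.mk K g := by
  rw [eq_comm, DoubleCoset.eq]
  exact ⟨γ, hγ, 1, one_mem _, by rw [mul_one]⟩

/-- Integration over the fibres of `U(𝔸_C) → U(𝔸_{C'})`. The constant absorbs the volume of the
fibre quotient and the normalizations of the Haar measures; it depends neither on `f` nor on `g`. -/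
lemma exists_constantTerm_pullback (hU : ∀ (Ω : Type) [Field Ω] [IsAlgClosed Ω],
    ∀ x ∈ U.points Ω, IsUnipotentElt x) :
    ∃ c : ℝ, c ≠ 0 ∧ ∀ (f : Bun A C' (integralPoints A C') → ℂ) (g : Points A (Adele C)),
      (ConvergesAlong (principal (U.points (FunctionRing C))) (U.points (Adele C))
          (pullback A j f) g ↔
        ConvergesAlong (principal (U.points (FunctionRing C'))) (U.points (Adele C')) f
          (Points.map (reduceAdele j) g)) ∧
      constantTermAlong (principal (U.points (FunctionRing C))) (U.points (Adele C))
          (pullback A j f) g =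
        c * constantTermAlong (principal (U.points (FunctionRing C'))) (U.points (Adele C')) f
          (Points.map (reduceAdele j) g) := by
  have hcl := isClosed_subgroup_points (C := C) U
  have hcl' := isClosed_subgroup_points (C := C') U
  have : LocallyCompactSpace (U.points (Adele C')) :=
    hcl'.isClosedEmbedding_subtypeVal.locallyCompactSpace
  have := (haar_spec hcl).1
  have := (haar_spec hcl').1
  have := isMulRightInvariant_haar (C := C) hU
  have := isMulRightInvariant_haar (C := C') hU
  obtain ⟨W, hW, hΓW⟩ := exists_nhds_one_subgroupOf (H := U.points (Adele C))
    (U.points (FunctionRing C))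
  obtain ⟨W', hW', hΓW'⟩ := exists_nhds_one_subgroupOf (H := U.points (Adele C'))
    (U.points (FunctionRing C'))
  obtain ⟨Q, hQ, hker⟩ := exists_isCompact_ker_reducePoints j (U := U)
  obtain ⟨c, hc, h⟩ := integral_fundDomain_comp (reducePoints j U) (haar (U.points (Adele C)))
    (haar (U.points (Adele C'))) (continuous_reducePoints j) (reducePoints_surjective j) _ _
    (map_reducePoints_principal j) hW hΓW hW' hΓW' hQ hker
    (hcl.isClosedEmbedding_subtypeVal.isCompact_preimage
      (isCompact_integralPoints isCompact_integralAdeles))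
    (by
      have h1 : Subtype.val ⁻¹' (integralPoints A C' : Set (Points A (Adele C'))) ∈
          𝓝 (1 : U.points (Adele C')) :=
        continuous_subtype_val.continuousAt (integralPoints_mem_nhds (one_mem _))
      refine Filter.mem_of_superset h1 fun y hy => ?_
      obtain ⟨x, hx, e⟩ := exists_mem_integralPoints_reducePoints_eq j hy
      exact ⟨x, hx, e⟩)
    (isFundamentalDomain_fundDomain _) (isFundamentalDomain_fundDomain _)
  refine ⟨c, hc, fun f g => ?_⟩
  have key := h (fun u => f (Bun.mk _ (u * Points.map (reduceAdele j) g)))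
    (continuous_bun_mk_mul f _ _) fun γ hγ x => by
      rw [Subgroup.coe_mul, mul_assoc, bun_mk_mul_of_mem_rationalPoints
        (principal_le_rationalPoints _ (Subgroup.mem_subgroupOf.mp hγ))]
  have e : ∀ u : U.points (Adele C), pullback A j f (Bun.mk _ (u * g)) =
      f (Bun.mk _ (reducePoints j U u * Points.map (reduceAdele j) g)) := by
    intro u
    rw [coe_reducePoints, ← map_mul]
    rfl
  unfold ConvergesAlong constantTermAlong
  simp only [e]
  exact key

lemma pullback_mem_constantTermKernel_iff [Algebra.FormallySmooth ℤ A]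
    (hU : ∀ (Ω : Type) [Field Ω] [IsAlgClosed Ω], ∀ x ∈ U.points Ω, IsUnipotentElt x)
    (f : Bun A C' (integralPoints A C') → ℂ) :
    pullback A j f ∈ constantTermKernel (principal (U.points (FunctionRing C)))
        (U.points (Adele C)) ↔
      f ∈ constantTermKernel (principal (U.points (FunctionRing C'))) (U.points (Adele C')) := by
  obtain ⟨c, hc, h⟩ := exists_constantTerm_pullback j hU
  have hsurj := Points.map_surjective_of_formallySmooth (A := A) (reduceAdele j)
    (reduceAdele_surjective j) (isNilpotent_ker_reduceAdele j)
  have hc' : (c : ℂ) ≠ 0 := by exact_mod_cast hc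
  constructor
  · intro hf g'
    -- Constant terms of the pullback test `f` only at reductions of adelic points of `G`;
    -- smoothness of `G` makes these all of `G(𝔸_{C'})`.
    obtain ⟨g, rfl⟩ := hsurj g'
    have h1 := (h f g).2
    rw [(hf g).2, eq_comm, mul_eq_zero] at h1
    exact ⟨(h f g).1.mp (hf g).1, h1.resolve_left hc'⟩
  · intro hf g
    refine ⟨(h f g).1.mpr (hf _).1, ?_⟩
    rw [(h f g).2, (hf _).2, mul_zero]

end Reduction

/-! ### Cuspidal functions under pullback -/

section Pullback

variable {A : Type} [CommRing A] [HopfAlgebra ℤ A] [Algebra.Smooth ℤ A]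
variable {X : Scheme.{0}} [IsIntegral X] [IsCurveOverFiniteField X] {C C' : NilpotentExtension X}
variable (j : NilpotentExtension.ClosedEmbedding C' C)

lemma pullback_injective : Function.Injective (pullback A j) := by
  refine LinearMap.funLeft_injective_of_surjective _ _ _ fun b => ?_
  induction b using Quotient.inductionOn' with
  | h g' =>
    obtain ⟨g, rfl⟩ := Points.map_surjective_of_formallySmooth (A := A) (reduceAdele j)
      (reduceAdele_surjective j) (isNilpotent_ker_reduceAdele j) g'
    exact ⟨Bun.mk _ g, rfl⟩

lemma pullback_mem_cuspidal_iff (B : ClosedSubgroup A)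
    (f : Bun A C' (integralPoints A C') → ℂ) :
    pullback A j f ∈ cuspidal C (integralPoints A C) B ↔
      f ∈ cuspidal C' (integralPoints A C') B := by
  simp only [cuspidal, Submodule.mem_iInf]
  refine forall₄_congr fun P U hP hU => ?_
  have := hU.smooth
  exact pullback_mem_constantTermKernel_iff j (fun Ω _ _ x hx => (hU.fibres Ω).1.2.2.2 x hx) f

lemma map_pullback_cuspidal (B : ClosedSubgroup A) :
    (cuspidal C' (integralPoints A C') B).map (pullback A j) =
      LinearMap.range (pullback A j) ⊓ cuspidal C (integralPoints A C) B := by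
  ext f
  constructor
  · rintro ⟨f, hf, rfl⟩
    exact ⟨⟨f, rfl⟩, (pullback_mem_cuspidal_iff j B f).mpr hf⟩
  · rintro ⟨⟨f, rfl⟩, hf⟩
    exact ⟨f, (pullback_mem_cuspidal_iff j B f).mp hf, rfl⟩

end Pullback

end NilBun

end

theorem propositionA (k : Type) [Field k] [Finite k] (X : Scheme.{0}) [IsIntegral X]
    (π : X ⟶ Spec (CommRingCat.of k)) [IsProper π] [SmoothOfRelativeDimension 1 π]
    (A : Type) [CommRing A] [HopfAlgebra ℤ A] (hA : NilBun.IsConnectedReductive A)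
    (T B : NilBun.ClosedSubgroup A) (hT : T.IsSplitMaximalTorus) (hB : B.IsBorel) (hTB : T ≤ B) :
    (∀ (C : NilBun.NilpotentExtension X) (K : Subgroup (NilBun.Points A (NilBun.Adele C))),
      IsOpen (K : Set (NilBun.Points A (NilBun.Adele C))) →
      IsCompact (K : Set (NilBun.Points A (NilBun.Adele C))) →
      ∀ (h : NilBun.hecke K) (f : NilBun.Bun A C K → ℂ),
        (f ∈ NilBun.cuspidal C K B → NilBun.heckeAction h f ∈ NilBun.cuspidal C K B) ∧
        ∀ i : ℕ, f ∈ NilBun.iCuspidal C K B i →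
          NilBun.heckeAction h f ∈ NilBun.iCuspidal C K B i) ∧
    ∀ (C C' : NilBun.NilpotentExtension X) (j : NilBun.NilpotentExtension.ClosedEmbedding C' C),
      Function.Injective (NilBun.pullback A j) ∧
      (NilBun.cuspidal C' (NilBun.integralPoints A C') B).map (NilBun.pullback A j) =
        LinearMap.range (NilBun.pullback A j) ⊓
          NilBun.cuspidal C (NilBun.integralPoints A C) B := by
  have : NilBun.IsCurveOverFiniteField X := ⟨k, _, inferInstance, π, inferInstance, inferInstance⟩
  have := hA.smooth
  exact ⟨fun C K hK _ h f => ⟨NilBun.heckeAction_mem_cuspidal hK h,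
    fun i => NilBun.heckeAction_mem_iCuspidal hK h⟩,
    fun C C' j => ⟨NilBun.pullback_injective j, NilBun.map_pullback_cuspidal j B⟩⟩
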